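/- **Theorem.** Let $\lambda>0$, $0\le\beta<\frac18-\frac{\lambda}{2}$ and $\ell=\ell(n)=\lfloor\lambda n\rfloor$. Let $\mathcal F=\mathcal F_n$ be a two-universal family of hash functions with range $\{0,1\}^{\ell}$, applicable to the restriction $x|_I=(x_i)_{i\in I}$ of $x\in\{0,1\}^n$ to any $I\subseteq\{1,\dots,n\}$ (for all $I$ and all $y\ne y'$ in $\{0,1\}^I$, $\Pr_{f\in_R\mathcal F}[f(y)=f(y')]\le 2^{-\ell}$), such that sampling $f\in_R\mathcal F$ and evaluating $f(x|_I)$ are done by circuits of size polynomial in $n$. Then the protocol $1\text{-}2\,\mathrm{QOT}^\ell$ securely implements one-out-of-two oblivious transfer of $\ell$-bit strings against $\beta$-benign Bob. The terms are as follows. *Protocol.* Alice has input $(s_0,s_1)\in(\{0,1\}^\ell)^2$, honest Bob has input $k\in\{0,1\}$. Preparation: Alice picks uniform $x\in\{0,1\}^n$, $\theta\in\{+,\times\}^n$ and sends $|x\rangle_\theta=\bigotimes_i|x_i\rangle_{\theta_i}$; (honest) Bob measures it in uniformly random bases $\hat\theta$ with result $\hat x$. Then Alice sends $\theta$; Bob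 sends a partition $(I_0,I_1)$ of $\{1,\dots,n\}$ (honestly, $I_k=\{i:\theta_i=\hat\theta_i\}$); Alice sends independent $f_0,f_1\in_R\mathcal F$ and $m_b=s_b\oplus f_b(x|_{I_b})$, $b=0,1$; honest Bob outputs $m_k\oplus f_k(\hat x|_{I_k})$. Alice has no output. *Adversaries.* A dishonest Bob $\mathsf B'$ is a family, indexed by $n$, of interactive quantum circuits over fresh ancillas $|0\rangle$ and arbitrary unitary gates on at most three qubits, of arbitrary size; some wires may be measured or discarded at the end of each round. His running time is the number of gates plus the number of wires of his circuits. A legitimate input state is $\rho_{UZV'}=\sum_{u,z}P_{UZ}(u,z)\,|u\rangle\langle u|\otimes|z\rangle\langle z|\otimes\rho^z_{V'}$, where $u=(s_0,s_1)$ is Alice's input and $(Z,V')$ Bob's. *Benign Bob.* $\mathsf B'$ is $\beta$-benign if after the preparation phase he either aborts or outputs a string $\hat\theta\in\{+,\times\}^n$, besides classical information and a quantum register $E$, such that for every family of legitimate input states the joint state of Alice and $\mathsf B'$ at that point has negligible trace distance from a state with the following property. For all fixed values of $\theta$, of $\hat\theta$ and of Bob's classical information $z$ (including his classical input) that occur without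 abort, conditioned on these values, $$H_\infty\bigl(X|_I\,\big|\,X|_{\bar I}=x|_{\bar I}\bigr)\ \ge\ d_H\bigl(\theta|_I,\hat\theta|_I\bigr)-\beta n$$ for all $I\subseteq\{1,\dots,n\}$ and all $x|_{\bar I}$ of positive probability, where $\bar I$ is the complement of $I$, $H_\infty(Y)=-\log_2\max_yP_Y(y)$ and $d_H$ is the Hamming distance; and $$H_0(\rho_{ER})=\log_2\operatorname{rank}\rho_{ER}\ \le\ \beta n$$ for some pointwise purification $\rho_{ER}=\sum_xP_X(x)\,|\psi^x_{ER}\rangle\langle\psi^x_{ER}|$ of the state $\rho_E=\sum_xP_X(x)\rho_E^x$ of $E$, where $\operatorname{tr}_R|\psi^x_{ER}\rangle\langle\psi^x_{ER}|=\rho^x_E$. *Security.* There is a polynomial $p$ such that for every $\beta$-benign $\mathsf B'$ there is an ideal-world adversary $\hat{\mathsf B}'$ (a family of circuits which from $(Z,V')$ computes an input $k$ for the ideal functionality, receives $s_k$, and then produces a quantum output), whose running time is at most $p$ of the running time of $\mathsf B'$, such that for every family of legitimate input states the output states of the real and of the ideal world (taken jointly with $U$ and $Z$) have trace distance negligible in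 $n$. -/

import Mathlib

/-! String oblivious transfer from BB84 qubits: quantum circuits with running time, dishonest and
benign receivers, the real and the ideal experiment. -/

noncomputable section

namespace QOT

open Matrix
open scoped ComplexOrder

/-! ### Strings, states, distances -/

/-- Bit strings of length `n`; a basis string uses `false` for `+` and `true` for `×`. -/
abbrev Bits (n : ℕ) : Type := Fin n → Bool

/-- Operators on a register of qubits labelled by `W`; the computational basis is `W → Bool`. -/
abbrev Op (W : Type) : Type := Matrix (W → Bool) (W → Bool) ℂ

/-- `tr |A|` with `|A| = √(A A†)`: the sum of the square roots of the eigenvalues of `A A†`. -/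
def traceNorm {ι : Type} [Fintype ι] [DecidableEq ι] (A : Matrix ι ι ℂ) : ℝ :=
  ∑ i, √((isHermitian_mul_conjTranspose_self A).eigenvalues i)

/-- A state of a classical register with values in `J` and a quantum register `W`: the family
`j ↦ P(j) ρ_j`, standing for the density matrix `∑ j, P(j) |j⟩⟨j| ⊗ ρ_j`. -/
def IsCQState {J W : Type} [Fintype J] [Fintype W] [DecidableEq W] (ρ : J → Op W) : Prop :=
  (∀ j, (ρ j).PosSemidef) ∧ ∑ j, (ρ j).trace = 1

/-- Trace distance `½ tr |ρ - σ|` of two classical-quantum states (which are block diagonal). -/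
def traceDist {J W : Type} [Fintype J] [Fintype W] [DecidableEq W] (ρ σ : J → Op W) : ℝ :=
  (1 / 2) * ∑ j, traceNorm (ρ j - σ j)

/-- Negligible functions of the security parameter. -/
def Negligible (f : ℕ → ℝ) : Prop :=
  Asymptotics.SuperpolynomialDecay Filter.atTop (fun n : ℕ => (n : ℝ)) f

/-- The amplitude `⟨y|b⟩_t` of a BB84 qubit encoding the bit `b` in the basis `t`. -/
def bb84Qubit (t b y : Bool) : ℂ :=
  if t then (if b && y then -1 else 1) / (√2 : ℝ) else (if y = b then 1 else 0)

/-- The vector `|x⟩_θ = |x_1⟩_{θ_1} ⊗ ⋯ ⊗ |x_n⟩_{θ_n}`. -/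
def bb84Ket {n : ℕ} (x θ : Bits n) : Bits n → ℂ :=
  fun y => ∏ i, bb84Qubit (θ i) (x i) (y i)

/-- The state `|x⟩⟨x|_θ ⊗ σ`. -/
def bb84With {n b : ℕ} (x θ : Bits n) (σ : Op (Fin b)) : Op (Fin n ⊕ Fin b) :=
  Matrix.of fun s t =>
    bb84Ket x θ (s ∘ Sum.inl) * star (bb84Ket x θ (t ∘ Sum.inl)) * σ (s ∘ Sum.inr) (t ∘ Sum.inr)

/-! ### Entropies -/

/-- `H_∞(P) = - log₂ max P`. -/
def minEntropy {ι : Type} (P : ι → ℝ) : ℝ := -Real.logb 2 (⨆ i, P i)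

/-- `H_0(ρ) = log₂ rank ρ`. -/
def maxEntropy {ι : Type} [Fintype ι] [DecidableEq ι] (ρ : Matrix ι ι ℂ) : ℝ :=
  Real.logb 2 (ρ.rank : ℝ)

/-- The string that equals `y` on `I` and `x` outside `I`. -/
def glue {n : ℕ} (I : Finset (Fin n)) (y : I → Bool) (x : Bits n) : Bits n :=
  fun i => if h : i ∈ I then y ⟨i, h⟩ else x i

/-- The conditional distribution of `X|_I` given that `X` agrees with `x` outside `I`, for `X`
distributed according to `P`. -/
def condDist {n : ℕ} (P : Bits n → ℝ) (I : Finset (Fin n)) (x : Bits n) : (I → Bool) → ℝ :=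
  fun y => P (glue I y x) / ∑ y' : I → Bool, P (glue I y' x)

/-- `ψ x` is a purification of `ρ x`, for every `x` of positive probability. -/
def IsPointwisePurification {X E R : Type} [Fintype R] (P : X → ℝ) (ρ : X → Matrix E E ℂ)
    (ψ : X → E × R → ℂ) : Prop :=
  ∀ x, P x ≠ 0 → ∀ i j, ∑ r, ψ x (i, r) * star (ψ x (j, r)) = ρ x i j

/-- The mixture `∑ x, P(x) |ψ^x⟩⟨ψ^x|`. -/
def mixture {X ι : Type} [Fintype X] (P : X → ℝ) (ψ : X → ι → ℂ) : Matrix ι ι ℂ :=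
  ∑ x, P x • vecMulVec (ψ x) (star (ψ x))

/-! ### Quantum circuits -/

/-- An elementary gate: an arbitrary unitary on at most three qubits. -/
structure Gate (W : Type) [DecidableEq W] where
  supp : Finset W
  card_le : supp.card ≤ 3
  unitary : Matrix.unitaryGroup (supp → Bool) ℂ

/-- The gate as an operator on all wires: identity outside its support. -/
def Gate.toOp {W : Type} [DecidableEq W] [Fintype W] (g : Gate W) : Op W :=
  Matrix.of fun s t =>
    if ∀ i, i ∉ g.supp → s i = t i then
      (g.unitary : Matrix (g.supp → Bool) (g.supp → Bool) ℂ) (g.supp.restrict s) (g.supp.restrict t)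
    else 0

/-- The operator of a list of gates; the head of the list is applied first. -/
def gatesOp {W : Type} [DecidableEq W] [Fintype W] : List (Gate W) → Op W
  | [] => 1
  | g :: gs => gatesOp gs * g.toOp

/-- A quantum circuit with classical input wires `CI`, quantum input wires `QI`, classical output
wires `CO` and quantum output wires `QO`. It uses `anc` fresh qubits in state `|0⟩`; at the end the
wires `CO` are measured in the computational basis and `garbage` wires are discarded. -/
structure Circuit (CI QI CO QO : Type) [DecidableEq CI] [DecidableEq QI] where
  anc : ℕ
  garbage : ℕ
  layout : CI ⊕ (QI ⊕ Fin anc) ≃ CO ⊕ (QO ⊕ Fin garbage)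
  gates : List (Gate (CI ⊕ (QI ⊕ Fin anc)))

namespace Circuit

variable {CI QI CO QO : Type} [Fintype CI] [DecidableEq CI] [Fintype QI] [DecidableEq QI]

/-- Running time: one step for every wire and one for every gate. -/
def time (C : Circuit CI QI CO QO) : ℕ :=
  Fintype.card (CI ⊕ (QI ⊕ Fin C.anc)) + C.gates.length

/-- The initial state `|x⟩⟨x| ⊗ ρ ⊗ |0⟩⟨0|` of all wires. -/
def initial (C : Circuit CI QI CO QO) (x : CI → Bool) (ρ : Op QI) : Op (CI ⊕ (QI ⊕ Fin C.anc)) :=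
  Matrix.of fun s t =>
    if (∀ i, s (Sum.inl i) = x i) ∧ (∀ i, t (Sum.inl i) = x i) ∧
        (∀ a, s (Sum.inr (Sum.inr a)) = false) ∧ (∀ a, t (Sum.inr (Sum.inr a)) = false) then
      ρ (fun q => s (Sum.inr (Sum.inl q))) (fun q => t (Sum.inr (Sum.inl q)))
    else 0

/-- The state of all wires after the gates. -/
def final (C : Circuit CI QI CO QO) (x : CI → Bool) (ρ : Op QI) : Op (CI ⊕ (QI ⊕ Fin C.anc)) :=
  gatesOp C.gates * C.initial x ρ * (gatesOp C.gates)ᴴ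

/-- The instrument realized by the circuit: on classical input `x` and quantum input `ρ`, the
unnormalized state of the quantum output if the classical output is `c`; its trace is the
probability of `c` (for `ρ` of trace one). -/
def run (C : Circuit CI QI CO QO) (x : CI → Bool) (ρ : Op QI) (c : CO → Bool) : Op QO :=
  Matrix.of fun q q' => ∑ g : Fin C.garbage → Bool,
    C.final x ρ (Sum.elim c (Sum.elim q g) ∘ C.layout) (Sum.elim c (Sum.elim q' g) ∘ C.layout)

end Circuit

/-! ### Universal hashing -/

/-- For every `n` a finite family of functions with range `{0,1}^(ℓ n)`, described by the strings in
`keys n`; they can be applied to the restriction `x|_I = (x_i)_{i ∈ I}` of an `n`-bit string to any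
`I` (for instance after padding with zeros). -/
structure HashFamily (ℓ : ℕ → ℕ) where
  keyLen : ℕ → ℕ
  keys : ∀ n, Finset (Bits (keyLen n))
  keys_nonempty : ∀ n, (keys n).Nonempty
  hash : ∀ n, Bits (keyLen n) → (I : Finset (Fin n)) → (I → Bool) → Bits (ℓ n)

/-- Two different strings collide under at most a fraction `2^(-ℓ)` of the functions. -/
def HashFamily.TwoUniversal {ℓ : ℕ → ℕ} (H : HashFamily ℓ) : Prop :=
  ∀ (n : ℕ) (I : Finset (Fin n)) (y y' : I → Bool), y ≠ y' →
    ((H.keys n).filter fun κ => H.hash n κ I y = H.hash n κ I y').card * 2 ^ ℓ n ≤ (H.keys n).card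

/-- Circuits of size polynomial in `n` sample a uniformly random function, and evaluate `f_κ(x|_I)`
on input `κ`, `I` (as its indicator string) and `x`. -/
def HashFamily.Efficient {ℓ : ℕ → ℕ} (H : HashFamily ℓ) : Prop :=
  ∃ p : Polynomial ℕ, ∀ n : ℕ,
    (∃ C : Circuit Empty Empty (Fin (H.keyLen n)) Empty, C.time ≤ p.eval n ∧
      ∀ κ, C.run Empty.elim 1 κ = if κ ∈ H.keys n then ((H.keys n).card : ℝ)⁻¹ • 1 else 0) ∧
    (∃ C : Circuit (Fin (H.keyLen n) ⊕ (Fin n ⊕ Fin n)) Empty (Fin (ℓ n)) Empty,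
      C.time ≤ p.eval n ∧
      ∀ κ ∈ H.keys n, ∀ (I : Finset (Fin n)) (x : Bits n),
        C.run (Sum.elim κ (Sum.elim (fun i => decide (i ∈ I)) x)) 1
          (H.hash n κ I (I.restrict x)) = 1)

/-! ### Input states and dishonest receivers -/

/-- A legitimate input state `ρ_{UZV'} = ∑ P_{UZ}(s,z) |s⟩⟨s| ⊗ |z⟩⟨z| ⊗ ρ^z`: the sender's input is
the pair `s = (s_0, s_1)` (with `s_0 = s false`, `s_1 = s true`), the receiver gets `a` classical bits
`z` and `b` qubits which are correlated with `s` only via `z`. -/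
structure LegitInput (l a b : ℕ) where
  prob : PMF ((Bool → Bits l) × Bits a)
  state : Bits a → Op (Fin b)
  state_posSemidef : ∀ z, (state z).PosSemidef
  state_trace : ∀ z, (state z).trace = 1

/-- The distribution of the receiver's classical input `Z`. -/
def LegitInput.probZ {l a b : ℕ} (inp : LegitInput l a b) (z : Bits a) : ℝ :=
  ∑ s, (inp.prob (s, z)).toReal

/-- A dishonest receiver in the protocol with `n` qubits, strings of length `l` and keys of length
`r`. He keeps classical information only in the register `w` between preparation and the rest. -/
structure DishonestBob (n l r : ℕ) where
  /-- number of bits of the classical input `z` -/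
  zLen : ℕ
  /-- number of qubits of the quantum input -/
  vLen : ℕ
  /-- number of bits of the classical memory `w` after the preparation phase -/
  wLen : ℕ
  /-- number of qubits of the quantum memory `E` after the preparation phase -/
  eLen : ℕ
  /-- number of qubits kept after the announcement of the partition -/
  memLen : ℕ
  /-- number of qubits of the output -/
  outLen : ℕ
  /-- preparation phase: takes his input and the `n` qubits of the sender; outputs whether he aborts,
  the auxiliary string `θ'`, `w` and `E` -/
  prep : Circuit (Fin zLen) (Fin n ⊕ Fin vLen) (Unit ⊕ (Fin n ⊕ Fin wLen)) (Fin eLen)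
  /-- computes the output if he aborts after the preparation phase -/
  onAbort : Circuit (Fin n ⊕ Fin wLen) (Fin eLen) Empty (Fin outLen)
  /-- gets `θ`, outputs the partition as a string `J` with `I_b = {i | J_i = b}` -/
  partition : Circuit ((Fin n ⊕ Fin wLen) ⊕ Fin n) (Fin eLen) (Fin n) (Fin memLen)
  /-- gets the two keys and the two masked strings, computes the output -/
  finish : Circuit ((Bool × Fin r) ⊕ (Bool × Fin l)) (Fin memLen) Empty (Fin outLen)

namespace DishonestBob

variable {n l r : ℕ}

/-- Running time: the sum over all circuits that are used. -/
def time (B : DishonestBob n l r) : ℕ :=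
  B.prep.time + B.onAbort.time + B.partition.time + B.finish.time

/-- For fixed input `z`, `σ` of the receiver: the joint state of `X`, `Θ`, the abort flag, `Θ'`,
`W`, `E` after the preparation phase, where `x` and `θ` are chosen uniformly by the sender. -/
def prepGiven (B : DishonestBob n l r) (z : Bits B.zLen) (σ : Op (Fin B.vLen))
    (x θ : Bits n) (abort : Bool) (θ' : Bits n) (w : Bits B.wLen) : Op (Fin B.eLen) :=
  ((1 / 2 : ℝ) ^ n * (1 / 2 : ℝ) ^ n) •
    B.prep.run z (bb84With x θ σ) (Sum.elim (fun _ => abort) (Sum.elim θ' w))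

/-- The classical registers `X`, `Θ`, `Z`, abort flag, `Θ'`, `W` after the preparation phase. -/
abbrev PrepReg (B : DishonestBob n l r) : Type :=
  Bits n × Bits n × Bits B.zLen × Bool × Bits n × Bits B.wLen

/-- The joint state of sender and receiver after the preparation phase. -/
def prepState (B : DishonestBob n l r) (inp : LegitInput l B.zLen B.vLen) :
    B.PrepReg → Op (Fin B.eLen) :=
  fun (x, θ, z, abort, θ', w) => inp.probZ z • B.prepGiven z (inp.state z) x θ abort θ' w

/-- The entropy conditions on a state `τ` of the registers after the preparation phase: for all fixed
values of `θ`, `θ'` and the classical information `(z, w)` that occur without abort, with `P` the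
distribution of `X` and `ρ^x` the state of `E` if `X = x`, both conditioned on these values. -/
def EntropyConditions (B : DishonestBob n l r) (β : ℝ) (τ : B.PrepReg → Op (Fin B.eLen)) : Prop :=
  ∀ (θ θ' : Bits n) (z : Bits B.zLen) (w : Bits B.wLen),
    let q : Bits n → ℝ := fun x => (τ (x, θ, z, false, θ', w)).trace.re
    let P : Bits n → ℝ := fun x => q x / ∑ x', q x'
    let ρ : Bits n → Op (Fin B.eLen) := fun x => (q x)⁻¹ • τ (x, θ, z, false, θ', w)
    0 < ∑ x, q x →
      (∀ (I : Finset (Fin n)) (x : Bits n), 0 < ∑ y : I → Bool, P (glue I y x) →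
        (hammingDist (I.restrict θ) (I.restrict θ') : ℝ) - β * n ≤ minEntropy (condDist P I x)) ∧
      ∃ (d : ℕ) (ψ : Bits n → (Bits B.eLen × Fin d) → ℂ),
        IsPointwisePurification P ρ ψ ∧ maxEntropy (mixture P ψ) ≤ β * n

/-- The output of the real protocol with an honest sender, jointly with the classical inputs `s`, `z`.
If the receiver does not abort he learns `θ`, announces the partition `(I_0, I_1)`, and gets random
`f_0`, `f_1` and `m_b = s_b ⊕ f_b(x|_{I_b})`. The sender has no output. -/
def realOut {ℓ : ℕ → ℕ} (H : HashFamily ℓ) (B : DishonestBob n (ℓ n) (H.keyLen n))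
    (inp : LegitInput (ℓ n) B.zLen B.vLen) :
    (Bool → Bits (ℓ n)) × Bits B.zLen → Op (Fin B.outLen) :=
  fun (s, z) => (inp.prob (s, z)).toReal •
    ∑ x : Bits n, ∑ θ : Bits n, ∑ θ' : Bits n, ∑ w : Bits B.wLen,
      (B.onAbort.run (Sum.elim θ' w) (B.prepGiven z (inp.state z) x θ true θ' w) Empty.elim +
        ∑ J : Bits n, ∑ κ ∈ Fintype.piFinset (fun _ : Bool => H.keys n),
          (((H.keys n).card : ℝ) ^ 2)⁻¹ •
            let part : Bool → Finset (Fin n) := fun b => Finset.univ.filter fun i => J i = b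
            let m : Bool → Bits (ℓ n) := fun b i =>
              xor (s b i) (H.hash n (κ b) (part b) ((part b).restrict x) i)
            B.finish.run (Sum.elim (Function.uncurry κ) (Function.uncurry m))
              (B.partition.run (Sum.elim (Sum.elim θ' w) θ)
                (B.prepGiven z (inp.state z) x θ false θ' w) J) Empty.elim)

end DishonestBob

/-- A family of dishonest receivers is `β`-benign if, for all legitimate inputs, the joint state after
the preparation phase is statistically indistinguishable from one with the entropy conditions. -/
def IsBenign {ℓ r : ℕ → ℕ} (β : ℝ) (B : ∀ n, DishonestBob n (ℓ n) (r n)) : Prop :=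
  ∀ inp : ∀ n, LegitInput (ℓ n) (B n).zLen (B n).vLen,
    ∃ τ : ∀ n, (B n).PrepReg → Op (Fin (B n).eLen),
      (∀ n, IsCQState (τ n)) ∧
      (∀ n, (B n).EntropyConditions β (τ n)) ∧
      Negligible fun n => traceDist ((B n).prepState (inp n)) (τ n)

/-! ### The ideal world -/

/-- The functionality of 1-out-of-2 oblivious transfer: on inputs `(s_0, s_1)` and `k` the sender
gets nothing and the receiver gets `s_k`. -/
def otFunctionality {l : ℕ} (s : Bool → Bits l) (k : Bool) : Unit × Bits l := ((), s k)

/-- A dishonest receiver in the ideal world: computes an input `k` for the functionality from his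
input `z`, `V'`, and then an output from the reply. -/
structure IdealBob (l zLen vLen outLen : ℕ) where
  memLen : ℕ
  query : Circuit (Fin zLen) (Fin vLen) Unit (Fin memLen)
  reply : Circuit (Fin l) (Fin memLen) Empty (Fin outLen)

namespace IdealBob

variable {l zLen vLen outLen : ℕ}

/-- Running time. -/
def time (S : IdealBob l zLen vLen outLen) : ℕ := S.query.time + S.reply.time

/-- The output of the ideal world, jointly with the classical inputs `s`, `z`. -/
def idealOut (S : IdealBob l zLen vLen outLen) (inp : LegitInput l zLen vLen) :
    (Bool → Bits l) × Bits zLen → Op (Fin outLen) :=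
  fun (s, z) => (inp.prob (s, z)).toReal •
    ∑ k : Bool, S.reply.run (otFunctionality s k).2 (S.query.run z (inp.state z) fun _ => k)
      Empty.elim

end IdealBob

/-- The protocol with hash functions from `H` securely implements oblivious transfer of strings of
length `ℓ n` against `β`-benign receivers, with ideal-world adversaries whose running time is
polynomial in that of the real-world adversary. -/
def SecureAgainstBenignBob {ℓ : ℕ → ℕ} (H : HashFamily ℓ) (β : ℝ) : Prop :=
  ∃ p : Polynomial ℕ,
    ∀ B : ∀ n, DishonestBob n (ℓ n) (H.keyLen n), IsBenign β B →
      ∃ S : ∀ n, IdealBob (ℓ n) (B n).zLen (B n).vLen (B n).outLen,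
        (∀ n, (S n).time ≤ p.eval (B n).time) ∧
        ∀ inp : ∀ n, LegitInput (ℓ n) (B n).zLen (B n).vLen,
          Negligible fun n => traceDist ((B n).realOut H (inp n)) ((S n).idealOut (inp n))

end QOT

end

noncomputable section

namespace QOT

open Matrix
open scoped ComplexOrder
set_option linter.unusedSectionVars false
set_option synthInstance.maxSize 2000
set_option synthInstance.maxHeartbeats 200000

/-! ### The trace norm -/

section TraceNorm

variable {ι κ : Type} [Fintype ι] [DecidableEq ι] [Fintype κ] [DecidableEq κ]

/-! The simulator plays Alice itself. It draws `x` and `θ`, runs Bob's preparation phase, gives him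
`θ` and reads his partition `(I_0, I_1)`. If at least `t = ⌈n/4⌉` of the positions where `θ` differs
from Bob's string `θ'` lie in `I_1` it queries `k = 0`, otherwise `k = 1`. With `s_k` it forms `m_k`
honestly, and it sends a uniformly random string as `m_(1-k)`. The abort branch is reproduced
exactly, so the two worlds differ only in `m_(1-k)`. What has to be shown is that `f_(1-k)` of the
bits of `x` in `I_(1-k)` is almost uniform given everything Bob holds.

Three facts give this. Averaged over `x`, the qubits sent are maximally mixed whatever `θ` is, so
`θ` is independent of `θ'`; by a Chernoff bound their distance is at least `(1/2 - ε) n` except with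
probability `exp (-2 ε² n)` (`sum_prepGiven_near_le`), and then at least `(1/4 - ε) n` of the
differences lie in `I_(1-k)` (`le_hammingDist_restrict_simChoice`). The benign condition turns this
into min-entropy `(1/4 - ε) n - β n` of the hashed bits given all other bits, and it bounds the rank
of the purified memory by `2^(β n)`. Privacy amplification then leaves an error of at most the
square root of `2^ℓ * 2^(β n) * 2^(-((1/4 - ε) n - β n))`, which is exponentially small for small
`ε` because `λ + 2 β < 1/4`.

The delicate point is that Bob obtains the partition by measuring `E` after learning `θ`, so the
part of the string that is hashed depends on the outcome. `privacyAmplification` therefore works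
with one Kraus operator `M` at a time. With `T = (Mᴴ M)^(1/2)` one has `‖M A Mᴴ‖₁² ≤ tr (Mᴴ M) * tr
(T A T A)` (`exists_sqrt_traceNorm_sq_le`); two-universality leaves only diagonal terms of the
second factor (`sum_collision_le`); and Cauchy–Schwarz over the outcomes uses that the traces of all
`Mᴴ M` add up to the dimension of the memory. The number of outcomes does not enter.

All this is done for the state `τ` with the entropy conditions. Passing to the real state costs four
times their trace distance (`traceDist_realOut_le`). Alice's input enters only through `z`, on which
Bob's state depends.

The other half of the proof builds the simulator as a circuit with running time. Circuits are
treated as instruments given by Kraus operators, and realizable instruments are closed under calls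
with copied classical wires (`Realizable.call`), discarding, and storing classical data in qubits.
Layers of three-qubit gates supply Alice's preparation, classical logic and controlled swaps;
`exists_simulator` puts them together. -/

theorem exists_diagonalization {A : Matrix ι ι ℂ} (hA : A.IsHermitian) :
    ∃ (U : Matrix ι ι ℂ) (a : ι → ℝ), Uᴴ * U = 1 ∧ U * Uᴴ = 1 ∧
      A = U * diagonal (fun i => (a i : ℂ)) * Uᴴ ∧ a = hA.eigenvalues := by
  refine ⟨hA.eigenvectorUnitary, hA.eigenvalues, ?_, ?_, ?_, rfl⟩
  · exact Matrix.UnitaryGroup.star_mul_self _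
  · exact Unitary.mul_star_self_of_mem hA.eigenvectorUnitary.2
  · conv_lhs => rw [hA.spectral_theorem, Unitary.conjStarAlgAut_apply]
    rfl

/-- The eigenvalues in `traceNorm` come with an arbitrary enumeration, so multisets are compared: `A
* Aᴴ` has the characteristic polynomial of the diagonal matrix with entries `a i ^ 2`, and the roots
determine the sum. -/
theorem traceNorm_of_diagonalization {A U : Matrix ι ι ℂ} {a : ι → ℝ} (hU : Uᴴ * U = 1)
    (h : A = U * diagonal (fun i => (a i : ℂ)) * Uᴴ) : traceNorm A = ∑ i, |a i| := by
  have hH := isHermitian_mul_conjTranspose_self A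
  have e : A * Aᴴ = U * (diagonal (fun i => ((a i ^ 2 : ℝ) : ℂ)) * Uᴴ) := by
    have hd : (diagonal (fun i => (a i : ℂ)))ᴴ = diagonal (fun i => (a i : ℂ)) := by
      rw [diagonal_conjTranspose]; congr 1; ext i; simp
    calc A * Aᴴ = U * diagonal (fun i => (a i : ℂ)) * (Uᴴ * U) *
          diagonal (fun i => (a i : ℂ)) * Uᴴ := by
          rw [h]; simp only [conjTranspose_mul, conjTranspose_conjTranspose, hd, Matrix.mul_assoc]
      _ = _ := by
          rw [hU, Matrix.mul_one, Matrix.mul_assoc U, diagonal_mul_diagonal, Matrix.mul_assoc]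
          congr; ext i; push_cast; ring
  have hc : (A * Aᴴ).charpoly.roots =
      Multiset.map (fun i => ((a i ^ 2 : ℝ) : ℂ)) Finset.univ.val := by
    rw [e, charpoly_mul_comm, Matrix.mul_assoc, hU, Matrix.mul_one, charpoly_diagonal,
      ← Polynomial.roots_multiset_prod_X_sub_C
        (Multiset.map (fun i => ((a i ^ 2 : ℝ) : ℂ)) Finset.univ.val), Multiset.map_map]
    rfl
  rw [hH.roots_charpoly_eq_eigenvalues] at hc
  have := congrArg (fun m => (Multiset.map (fun z : ℂ => √z.re) m).sum) hc
  simp only [Multiset.map_map, Function.comp_def] at this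
  simpa [traceNorm, Real.sqrt_sq_eq_abs, ← Complex.ofReal_pow] using this

theorem traceNorm_nonneg (A : Matrix ι ι ℂ) : 0 ≤ traceNorm A :=
  Finset.sum_nonneg fun _ _ => Real.sqrt_nonneg _

theorem posSemidef_re_diag_nonneg {A : Matrix ι ι ℂ} (hA : A.PosSemidef) (i : ι) :
    0 ≤ (A i i).re := (Complex.le_def.1 (hA.diag_nonneg (i := i))).1

theorem trace_re_nonneg {A : Matrix ι ι ℂ} (hA : A.PosSemidef) : 0 ≤ A.trace.re :=
  (Complex.le_def.1 hA.trace_nonneg).1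

theorem posSemidef_trace_eq_re {A : Matrix ι ι ℂ} (hA : A.PosSemidef) :
    A.trace = (A.trace.re : ℂ) := by
  have := (Complex.le_def.1 hA.trace_nonneg).2
  exact Complex.ext (by simp) (by simpa using this.symm)

/-- The trace norm of a difference of positive operators is at most the sum of their traces. -/
theorem traceNorm_sub_le {P Q : Matrix ι ι ℂ} (hP : P.PosSemidef) (hQ : Q.PosSemidef) :
    traceNorm (P - Q) ≤ P.trace.re + Q.trace.re := by
  obtain ⟨U, a, hU, hU', h, -⟩ := exists_diagonalization (hP.isHermitian.sub hQ.isHermitian)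
  rw [traceNorm_of_diagonalization hU h]
  have hd : Uᴴ * (P - Q) * U = diagonal (fun i => (a i : ℂ)) := by
    rw [h]
    calc Uᴴ * (U * diagonal (fun i => (a i : ℂ)) * Uᴴ) * U
        = (Uᴴ * U) * diagonal (fun i => (a i : ℂ)) * (Uᴴ * U) := by simp only [Matrix.mul_assoc]
      _ = _ := by rw [hU]; simp
  have ht : ∀ B : Matrix ι ι ℂ, B.trace.re = ∑ i, ((Uᴴ * B * U) i i).re := fun B => by
    have : (Uᴴ * B * U).trace = B.trace := by
      rw [Matrix.mul_assoc, trace_mul_comm, Matrix.mul_assoc, hU', Matrix.mul_one]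
    rw [← this, trace, Complex.re_sum]; rfl
  rw [ht P, ht Q, ← Finset.sum_add_distrib]
  refine Finset.sum_le_sum fun i _ => ?_
  have h1 := posSemidef_re_diag_nonneg (hP.conjTranspose_mul_mul_same U) i
  have h2 := posSemidef_re_diag_nonneg (hQ.conjTranspose_mul_mul_same U) i
  -- In the eigenbasis each eigenvalue is a difference of two nonnegative diagonal entries, so its
  -- absolute value is at most their sum.
  have h3 : a i = ((Uᴴ * P * U) i i).re - ((Uᴴ * Q * U) i i).re := by
    have := congrFun (congrFun hd i) i
    rw [Matrix.mul_sub, Matrix.sub_mul, Matrix.sub_apply, diagonal_apply_eq] at this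
    simpa using (congrArg Complex.re this).symm
  rw [abs_le]; constructor <;> linarith

/-- The Jordan decomposition. -/
theorem exists_posSemidef_sub {A : Matrix ι ι ℂ} (hA : A.IsHermitian) :
    ∃ P Q : Matrix ι ι ℂ, P.PosSemidef ∧ Q.PosSemidef ∧ A = P - Q ∧
      traceNorm A = P.trace.re + Q.trace.re := by
  obtain ⟨U, a, hU, hU', h, -⟩ := exists_diagonalization hA
  have key : ∀ b : ι → ℝ, (U * diagonal (fun i => (b i : ℂ)) * Uᴴ).trace.re = ∑ i, b i := fun b => by
    rw [Matrix.mul_assoc, trace_mul_comm, Matrix.mul_assoc, hU, Matrix.mul_one, trace_diagonal]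
    simp
  refine ⟨U * diagonal (fun i => ((max (a i) 0 : ℝ) : ℂ)) * Uᴴ,
    U * diagonal (fun i => ((max (-a i) 0 : ℝ) : ℂ)) * Uᴴ, ?_, ?_, ?_, ?_⟩
  · exact (posSemidef_diagonal_iff.2 fun i => by
      exact_mod_cast le_max_right _ _).mul_mul_conjTranspose_same U
  · exact (posSemidef_diagonal_iff.2 fun i => by
      exact_mod_cast le_max_right _ _).mul_mul_conjTranspose_same U
  · rw [← Matrix.sub_mul, ← Matrix.mul_sub, diagonal_sub, h]
    congr; ext i
    rw [← Complex.ofReal_sub, max_zero_sub_max_neg_zero_eq_self]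
  · rw [traceNorm_of_diagonalization hU h, key, key, ← Finset.sum_add_distrib]
    refine Finset.sum_congr rfl fun i _ => ?_
    rcases le_total 0 (a i) with h0 | h0
    · rw [abs_of_nonneg h0, max_eq_left h0, max_eq_right (by linarith), add_zero]
    · rw [abs_of_nonpos h0, max_eq_right h0, max_eq_left (by linarith), zero_add]

theorem traceNorm_le_of_eq_sub {A P Q : Matrix ι ι ℂ} (hP : P.PosSemidef) (hQ : Q.PosSemidef)
    (h : A = P - Q) : traceNorm A ≤ P.trace.re + Q.trace.re := h ▸ traceNorm_sub_le hP hQ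

theorem traceNorm_posSemidef_le {A : Matrix ι ι ℂ} (hA : A.PosSemidef) :
    traceNorm A ≤ A.trace.re := by
  simpa using traceNorm_sub_le hA PosSemidef.zero

@[simp] theorem traceNorm_zero : traceNorm (0 : Matrix ι ι ℂ) = 0 :=
  le_antisymm (by simpa using traceNorm_posSemidef_le (ι := ι) PosSemidef.zero) (traceNorm_nonneg _)

/-- The Jordan parts of `A` and `B` add up to a decomposition of `A + B` into positive operators; it
need not be orthogonal for `traceNorm_sub_le` to apply. -/
theorem traceNorm_add_le {A B : Matrix ι ι ℂ} (hA : A.IsHermitian) (hB : B.IsHermitian) :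
    traceNorm (A + B) ≤ traceNorm A + traceNorm B := by
  obtain ⟨P, Q, hP, hQ, h, e⟩ := exists_posSemidef_sub hA
  obtain ⟨P', Q', hP', hQ', h', e'⟩ := exists_posSemidef_sub hB
  refine (traceNorm_le_of_eq_sub (hP.add hP') (hQ.add hQ') (by rw [h, h']; abel)).trans ?_
  rw [trace_add, trace_add, Complex.add_re, Complex.add_re, e, e']; linarith

theorem isHermitian_sum {α : Type} (s : Finset α) {A : α → Matrix ι ι ℂ}
    (hA : ∀ i ∈ s, (A i).IsHermitian) : (∑ i ∈ s, A i).IsHermitian := by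
  rw [IsHermitian, conjTranspose_sum]; exact Finset.sum_congr rfl fun i hi => hA i hi

theorem traceNorm_sum_le {α : Type} (s : Finset α) {A : α → Matrix ι ι ℂ}
    (hA : ∀ i ∈ s, (A i).IsHermitian) : traceNorm (∑ i ∈ s, A i) ≤ ∑ i ∈ s, traceNorm (A i) := by
  classical
  induction s using Finset.induction_on with
  | empty => simp
  | insert a s ha ih =>
    rw [Finset.sum_insert ha, Finset.sum_insert ha]
    refine (traceNorm_add_le (hA a (Finset.mem_insert_self _ _)) (isHermitian_sum _ fun i hi =>
      hA i (Finset.mem_insert_of_mem hi))).trans ?_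
    gcongr
    exact ih fun i hi => hA i (Finset.mem_insert_of_mem hi)

theorem traceNorm_smul_le {A : Matrix ι ι ℂ} (hA : A.IsHermitian) {r : ℝ} (hr : 0 ≤ r) :
    traceNorm (r • A) ≤ r * traceNorm A := by
  obtain ⟨P, Q, hP, hQ, h, e⟩ := exists_posSemidef_sub hA
  refine (traceNorm_le_of_eq_sub (hP.smul hr) (hQ.smul hr) (by rw [h, smul_sub])).trans ?_
  rw [e, trace_smul, trace_smul]; simp; linarith

theorem traceNorm_neg {A : Matrix ι ι ℂ} (hA : A.IsHermitian) : traceNorm (-A) ≤ traceNorm A := by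
  obtain ⟨P, Q, hP, hQ, h, e⟩ := exists_posSemidef_sub hA
  refine (traceNorm_le_of_eq_sub hQ hP (by rw [h]; abel)).trans ?_
  rw [e]; linarith

/-- A positive, linear, trace nonincreasing family of maps does not increase the trace norm. -/
theorem sum_traceNorm_map_le {α : Type} (s : Finset α)
    (F : α → Matrix ι ι ℂ → Matrix κ κ ℂ) (hsub : ∀ c A B, F c (A - B) = F c A - F c B)
    (hpos : ∀ c A, A.PosSemidef → (F c A).PosSemidef)
    (htr : ∀ A, A.PosSemidef → ∑ c ∈ s, (F c A).trace.re ≤ A.trace.re)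
    {A : Matrix ι ι ℂ} (hA : A.IsHermitian) : ∑ c ∈ s, traceNorm (F c A) ≤ traceNorm A := by
  obtain ⟨P, Q, hP, hQ, h, e⟩ := exists_posSemidef_sub hA
  calc ∑ c ∈ s, traceNorm (F c A) ≤ ∑ c ∈ s, ((F c P).trace.re + (F c Q).trace.re) :=
        Finset.sum_le_sum fun c _ => traceNorm_le_of_eq_sub (hpos c P hP) (hpos c Q hQ)
          (by rw [h, hsub])
    _ ≤ _ := by rw [Finset.sum_add_distrib, e]; exact add_le_add (htr P hP) (htr Q hQ)

end TraceNorm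

/-! ### Privacy amplification against a measured quantum memory -/

section PrivacyAmplification

variable {m D : Type} [Fintype m] [DecidableEq m] [Fintype D] [DecidableEq D]

/-- `V` is a partial isometry and `S` a reflection, so `L = Vᴴ S V` is a contraction. Concretely, `L
Lᴴ` and the positive operator `Vᴴ S Q S V`, with `Q` the projection off the range of `V`, add up to
`Vᴴ V`; its diagonal entries bound the squared row norms. -/
theorem sum_norm_sq_row_le_one {V : Matrix m D ℂ} {S : Matrix m m ℂ} {e : D → ℂ} (hS : Sᴴ = S)
    (hSS : S * S = 1) (hV : Vᴴ * V = diagonal e) (hVe : V * diagonal e = V) (he : ∀ i, (e i).re ≤ 1)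
    (i : D) : ∑ j, ‖(Vᴴ * S * V) i j‖ ^ 2 ≤ 1 := by
  set L := Vᴴ * S * V with hL
  set Q := 1 - V * Vᴴ with hQ
  have hQH : Qᴴ = Q := by simp [hQ]
  have hQQ : Q * Q = Q := by
    have : V * Vᴴ * (V * Vᴴ) = V * Vᴴ := by
      calc V * Vᴴ * (V * Vᴴ) = V * (Vᴴ * V) * Vᴴ := by simp only [Matrix.mul_assoc]
        _ = _ := by rw [hV, hVe]
    rw [hQ, Matrix.sub_mul, Matrix.mul_sub, Matrix.mul_sub, this]; simp
  have h1 : L * Lᴴ + (Q * S * V)ᴴ * (Q * S * V) = diagonal e := by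
    calc L * Lᴴ + (Q * S * V)ᴴ * (Q * S * V)
        = Vᴴ * S * (V * Vᴴ) * S * V + Vᴴ * S * (Q * Q) * S * V := by
          simp only [hL, conjTranspose_mul, conjTranspose_conjTranspose, hS, hQH, Matrix.mul_assoc]
      _ = Vᴴ * (S * S) * V := by
          rw [hQQ, hQ]
          simp only [Matrix.mul_sub, Matrix.sub_mul, Matrix.mul_one, Matrix.mul_assoc]
          abel
      _ = _ := by rw [hSS, Matrix.mul_one, hV]
  have h2 := congrArg Complex.re (congrFun (congrFun h1 i) i)
  have h3 := posSemidef_re_diag_nonneg (posSemidef_conjTranspose_mul_self (Q * S * V)) i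
  have h4 : ((L * Lᴴ) i i).re = ∑ j, ‖L i j‖ ^ 2 := by
    rw [mul_apply, Complex.re_sum]
    refine Finset.sum_congr rfl fun j _ => ?_
    rw [conjTranspose_apply, Complex.star_def, Complex.mul_conj, Complex.normSq_eq_norm_sq,
      Complex.ofReal_re]
  rw [Matrix.add_apply, Complex.add_re, h4, diagonal_apply_eq] at h2
  linarith [he i]

/-- Cauchy–Schwarz with weights `t i * t j`. The factor with `L` is controlled by `t i * t j ≤ (t i
^ 2 + t j ^ 2) / 2`, where symmetry turns the row bound into a column bound. -/
theorem sq_sum_mul_le_of_row_le_one {t : D → ℝ} (ht : ∀ i, 0 ≤ t i) {L A : D → D → ℝ}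
    (hL : ∀ i j, L i j = L j i) (h1 : ∀ i, ∑ j, L i j ^ 2 ≤ 1) :
    (∑ i, ∑ j, L i j * A i j * (t i * t j)) ^ 2 ≤
      (∑ i, t i ^ 2) * ∑ i, ∑ j, A i j ^ 2 * (t i * t j) := by
  have hcs := Finset.sum_mul_sq_le_sq_mul_sq (Finset.univ : Finset (D × D))
    (fun q => L q.1 q.2 * √(t q.1 * t q.2)) (fun q => A q.1 q.2 * √(t q.1 * t q.2))
  have hs : ∀ i j, √(t i * t j) ^ 2 = t i * t j := fun i j =>
    Real.sq_sqrt (mul_nonneg (ht i) (ht j))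
  have e1 : ∑ q : D × D, L q.1 q.2 * √(t q.1 * t q.2) * (A q.1 q.2 * √(t q.1 * t q.2)) =
      ∑ i, ∑ j, L i j * A i j * (t i * t j) := by
    rw [Fintype.sum_prod_type]
    refine Finset.sum_congr rfl fun i _ => Finset.sum_congr rfl fun j _ => ?_
    calc _ = L i j * A i j * √(t i * t j) ^ 2 := by ring
      _ = _ := by rw [hs]
  have e2 : ∀ B : D → D → ℝ, ∑ q : D × D, (B q.1 q.2 * √(t q.1 * t q.2)) ^ 2 =
      ∑ i, ∑ j, B i j ^ 2 * (t i * t j) := fun B => by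
    rw [Fintype.sum_prod_type]
    refine Finset.sum_congr rfl fun i _ => Finset.sum_congr rfl fun j _ => ?_
    rw [mul_pow, hs]
  rw [e1, e2, e2] at hcs
  refine hcs.trans (mul_le_mul_of_nonneg_right ?_ (Finset.sum_nonneg fun i _ =>
    Finset.sum_nonneg fun j _ => mul_nonneg (sq_nonneg _) (mul_nonneg (ht i) (ht j))))
  have h2 : ∑ i, ∑ j, L i j ^ 2 * (t i * t j) ≤
      ∑ i, ∑ j, (L i j ^ 2 * t i ^ 2 / 2 + L i j ^ 2 * t j ^ 2 / 2) := by
    refine Finset.sum_le_sum fun i _ => Finset.sum_le_sum fun j _ => ?_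
    nlinarith [sq_nonneg (t i - t j), sq_nonneg (L i j)]
  have h3 : ∑ i, ∑ j, L i j ^ 2 * t i ^ 2 / 2 ≤ (∑ i, t i ^ 2) / 2 := by
    rw [Finset.sum_div]
    refine Finset.sum_le_sum fun i _ => ?_
    rw [← Finset.sum_div, ← Finset.sum_mul]
    nlinarith [h1 i, sq_nonneg (t i)]
  have h4 : ∑ i, ∑ j, L i j ^ 2 * t j ^ 2 / 2 = ∑ i, ∑ j, L i j ^ 2 * t i ^ 2 / 2 := by
    rw [Finset.sum_comm]
    exact Finset.sum_congr rfl fun i _ => Finset.sum_congr rfl fun j _ => by rw [hL]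
  simp only [Finset.sum_add_distrib] at h2
  linarith

/-- `S` is the sign of `B`; the eigenvalue zero gets sign `1`, so that `S` squares to the identity.
-/
theorem exists_sign {B : Matrix m m ℂ} (hB : B.IsHermitian) :
    ∃ S : Matrix m m ℂ, Sᴴ = S ∧ S * S = 1 ∧ (S * B).trace.re = traceNorm B := by
  obtain ⟨U, b, hU, hU', h, -⟩ := exists_diagonalization hB
  let s : m → ℝ := fun i => if 0 ≤ b i then 1 else -1
  have hconj : ∀ u v : m → ℂ, (U * diagonal u * Uᴴ) * (U * diagonal v * Uᴴ) =
      U * diagonal (fun i => u i * v i) * Uᴴ := fun u v => by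
    calc (U * diagonal u * Uᴴ) * (U * diagonal v * Uᴴ)
        = U * diagonal u * (Uᴴ * U) * diagonal v * Uᴴ := by simp only [Matrix.mul_assoc]
      _ = _ := by rw [hU, Matrix.mul_one, Matrix.mul_assoc U, diagonal_mul_diagonal]
  refine ⟨U * diagonal (fun i => (s i : ℂ)) * Uᴴ, ?_, ?_, ?_⟩
  · simp only [conjTranspose_mul, conjTranspose_conjTranspose, diagonal_conjTranspose,
      Matrix.mul_assoc]
    congr; ext i; simp
  · rw [hconj]
    have : (fun i => (s i : ℂ) * s i) = fun _ => 1 := by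
      ext i; simp only [s]; split_ifs <;> simp
    rw [this, diagonal_one, Matrix.mul_one, hU']
  · rw [traceNorm_of_diagonalization hU h]
    conv_lhs => rw [h, hconj]
    rw [Matrix.mul_assoc, trace_mul_comm, Matrix.mul_assoc, hU, Matrix.mul_one, trace_diagonal,
      Complex.re_sum]
    refine Finset.sum_congr rfl fun i _ => ?_
    rw [← Complex.ofReal_mul, Complex.ofReal_re]
    simp only [s]
    split_ifs with h0
    · rw [one_mul, abs_of_nonneg h0]
    · rw [neg_one_mul, abs_of_neg (not_le.1 h0)]

/-- The trace norm of `M A Mᴴ` is bounded by a Hilbert-Schmidt norm of `A` weighted with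
`T = (Mᴴ M)^(1/2)`. -/
theorem exists_sqrt_traceNorm_sq_le (M : Matrix m D ℂ) :
    ∃ T : Matrix D D ℂ, Tᴴ = T ∧ T * T = Mᴴ * M ∧ ∀ A : Matrix D D ℂ, A.IsHermitian →
      traceNorm (M * A * Mᴴ) ^ 2 ≤ (Mᴴ * M).trace.re * (T * A * T * A).trace.re := by
  have hN := posSemidef_conjTranspose_mul_self M
  obtain ⟨W, ν, hW, hW', h, hν⟩ := exists_diagonalization hN.isHermitian
  have hν0 : ∀ i, 0 ≤ ν i := fun i => hν ▸ hN.eigenvalues_nonneg i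
  let t : D → ℝ := fun i => √(ν i)
  have ht0 : ∀ i, 0 ≤ t i := fun i => Real.sqrt_nonneg _
  have htt : ∀ i, t i * t i = ν i := fun i => Real.mul_self_sqrt (hν0 i)
  let dt : Matrix D D ℂ := diagonal fun i => (t i : ℂ)
  have hdtH : dtᴴ = dt := by
    simp only [dt, diagonal_conjTranspose]; congr; ext i; simp
  refine ⟨W * dt * Wᴴ, ?_, ?_, fun A hA => ?_⟩
  · simp only [conjTranspose_mul, conjTranspose_conjTranspose, hdtH, Matrix.mul_assoc]
  · calc W * dt * Wᴴ * (W * dt * Wᴴ) = W * (dt * (Wᴴ * W) * dt) * Wᴴ := by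
          simp only [Matrix.mul_assoc]
      _ = _ := by
          rw [hW, Matrix.mul_one, h]
          simp only [dt, diagonal_mul_diagonal, ← Complex.ofReal_mul, htt]
  set M' := M * W with hM'
  have hMM : M'ᴴ * M' = diagonal fun i => (ν i : ℂ) := by
    calc M'ᴴ * M' = Wᴴ * (Mᴴ * M) * W := by
          simp only [hM', conjTranspose_mul, Matrix.mul_assoc]
      _ = (Wᴴ * W) * diagonal (fun i => (ν i : ℂ)) * (Wᴴ * W) := by
          rw [h]; simp only [Matrix.mul_assoc]
      _ = _ := by rw [hW]; simp
  -- The squared norm of column `i` of `M'` is `ν i`, so nothing is lost by inverting `t` only where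
  -- it is nonzero.
  have hcol : ∀ i, t i = 0 → ∀ a, M' a i = 0 := fun i hi a => by
    have h1 := congrFun (congrFun hMM i) i
    rw [mul_apply, diagonal_apply_eq, ← htt, hi] at h1
    have h2 : ∑ a, ‖M' a i‖ ^ 2 = 0 := by
      have := congrArg Complex.re h1
      rw [Complex.re_sum] at this
      simpa [conjTranspose_apply, Complex.conj_mul', ← Complex.ofReal_pow] using this
    have h3 := (Finset.sum_eq_zero_iff_of_nonneg fun a _ => by positivity).1 h2 a (Finset.mem_univ _)
    simpa using h3
  -- As `0⁻¹ = 0`, this is the pseudo-inverse of `dt`, and `M' = V * dt` is a polar decomposition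
  -- with a partial isometry `V` even if `Mᴴ M` is singular.
  let di : Matrix D D ℂ := diagonal fun i => ((t i)⁻¹ : ℂ)
  have hdiH : diᴴ = di := by
    simp only [di, diagonal_conjTranspose]; congr; ext i; simp
  let e : D → ℂ := fun i => if t i = 0 then 0 else 1
  set V := M' * di with hVdef
  have hVt : V * dt = M' := by
    ext a i
    simp only [hVdef, di, dt, mul_diagonal]
    by_cases hi : t i = 0
    · simp [hcol i hi a]
    · exact inv_mul_cancel_right₀ (by exact_mod_cast hi) _
  have hVV : Vᴴ * V = diagonal e := by
    calc Vᴴ * V = di * (M'ᴴ * M') * di := by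
          simp only [hVdef, conjTranspose_mul, hdiH, Matrix.mul_assoc]
      _ = _ := by
          rw [hMM]
          simp only [di, diagonal_mul_diagonal, e]
          congr; ext i
          rw [← htt]
          by_cases hi : t i = 0
          · simp [hi]
          · have : (t i : ℂ) ≠ 0 := by exact_mod_cast hi
            simp only [hi, if_false]; push_cast; field_simp
  have hVe : V * diagonal e = V := by
    ext a i
    simp only [hVdef, di, mul_diagonal, e]
    split_ifs with hi <;> simp [hi]
  set A' := Wᴴ * A * W with hA'
  have hA'H : A'ᴴ = A' := by
    simp only [hA', conjTranspose_mul, conjTranspose_conjTranspose, hA.eq, Matrix.mul_assoc]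
  have hB : M * A * Mᴴ = V * (dt * A' * dt) * Vᴴ := by
    calc M * A * Mᴴ = M * (W * Wᴴ) * A * (W * Wᴴ) * Mᴴ := by rw [hW']; simp
      _ = M' * A' * M'ᴴ := by
          simp only [hM', hA', conjTranspose_mul, Matrix.mul_assoc]
      _ = _ := by
          rw [← hVt]; simp only [conjTranspose_mul, hdtH, Matrix.mul_assoc]
  have hBH : (M * A * Mᴴ).IsHermitian := isHermitian_mul_mul_conjTranspose M hA
  obtain ⟨S, hS, hSS, hSB⟩ := exists_sign hBH
  set L := Vᴴ * S * V with hL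
  have hLH : Lᴴ = L := by
    simp only [hL, conjTranspose_mul, conjTranspose_conjTranspose, hS, Matrix.mul_assoc]
  have hnL : ∀ i j, ‖L i j‖ = ‖L j i‖ := fun i j => by
    rw [← congrFun (congrFun hLH i) j, conjTranspose_apply, norm_star]
  have hrow := sum_norm_sq_row_le_one hS hSS hVV hVe
    (fun i => by simp only [e]; split_ifs <;> simp)
  -- The trace norm is the trace of `S V dt A' dt Vᴴ`; by cyclicity `V` is absorbed into the
  -- contraction `L`.
  have h1 : traceNorm (M * A * Mᴴ) ≤ ∑ i, ∑ j, ‖L i j‖ * ‖A' j i‖ * (t i * t j) := by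
    have h2 : (S * (M * A * Mᴴ)).trace = ∑ i, ∑ j, L i j * (t j * A' j i * t i) := by
      have : (S * (M * A * Mᴴ)).trace = (L * (dt * A' * dt)).trace := by
        rw [hB, ← Matrix.mul_assoc, trace_mul_comm, hL]; simp only [Matrix.mul_assoc]
      rw [this, trace]
      refine Finset.sum_congr rfl fun i _ => ?_
      rw [diag_apply, mul_apply]
      refine Finset.sum_congr rfl fun j _ => ?_
      simp [dt]
    rw [← hSB, h2]
    refine (Complex.re_le_norm _).trans ((norm_sum_le _ _).trans (Finset.sum_le_sum fun i _ =>
      (norm_sum_le _ _).trans (Finset.sum_le_sum fun j _ => le_of_eq ?_)))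
    rw [norm_mul, norm_mul, norm_mul, Complex.norm_of_nonneg (ht0 i), Complex.norm_of_nonneg (ht0 j)]
    ring
  have h3 : (W * dt * Wᴴ * A * (W * dt * Wᴴ) * A).trace.re =
      ∑ i, ∑ j, ‖A' j i‖ ^ 2 * (t i * t j) := by
    have : (W * dt * Wᴴ * A * (W * dt * Wᴴ) * A).trace = ((dt * A') * (dt * A')).trace := by
      have e : W * dt * Wᴴ * A * (W * dt * Wᴴ) * A = W * (dt * Wᴴ * A * (W * dt * Wᴴ) * A) := by
        simp only [Matrix.mul_assoc]
      rw [e, trace_mul_comm, hA']; simp only [Matrix.mul_assoc]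
    rw [this, trace, Complex.re_sum]
    refine Finset.sum_congr rfl fun i _ => ?_
    rw [diag_apply, mul_apply, Complex.re_sum]
    refine Finset.sum_congr rfl fun j _ => ?_
    have hx : A' i j = star (A' j i) := by
      rw [← conjTranspose_apply, hA'H]
    simp only [dt, diagonal_mul, hx]
    have : (t i : ℂ) * star (A' j i) * (t j * A' j i) =
        ((‖A' j i‖ ^ 2 * (t i * t j) : ℝ) : ℂ) := by
      have := Complex.conj_mul' (A' j i)
      push_cast
      rw [← this, Complex.star_def]; ring
    rw [this, Complex.ofReal_re]
  have h5 : (Mᴴ * M).trace.re = ∑ i, t i ^ 2 := by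
    rw [h, Matrix.mul_assoc, trace_mul_comm, Matrix.mul_assoc, hW, Matrix.mul_one, trace_diagonal,
      Complex.re_sum]
    exact Finset.sum_congr rfl fun i _ => by rw [Complex.ofReal_re, sq, htt]
  rw [h3, h5]
  exact (pow_le_pow_left₀ (traceNorm_nonneg _) h1 2).trans
    (sq_sum_mul_le_of_row_le_one ht0 hnL hrow)

theorem vecMulVec_star_isHermitian (χ : D → ℂ) : (vecMulVec χ (star χ)).IsHermitian :=
  (posSemidef_vecMulVec_self_star χ).isHermitian

theorem isHermitian_real_smul {A : Matrix D D ℂ} (hA : A.IsHermitian) (r : ℝ) :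
    (r • A).IsHermitian := by
  rw [IsHermitian, conjTranspose_smul, hA.eq, star_trivial]

/-- A quadratic form in the coefficients with a nonnegative kernel; this sign is what allows the
off-diagonal terms to be dropped after averaging over the hash functions. -/
theorem trace_weighted_eq {Y : Type} [Fintype Y] {T : Matrix D D ℂ} (hT : Tᴴ = T)
    (χ : Y → D → ℂ) (c : Y → ℝ) :
    (T * (∑ y, c y • vecMulVec (χ y) (star (χ y))) * T *
      (∑ y, c y • vecMulVec (χ y) (star (χ y)))).trace.re =
      ∑ y, ∑ y', c y * c y' * ‖star (χ y) ⬝ᵥ (T *ᵥ χ y')‖ ^ 2 := by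
  have h : ∀ y y', (T * vecMulVec (χ y) (star (χ y)) * (T * vecMulVec (χ y') (star (χ y')))).trace =
      ((‖star (χ y) ⬝ᵥ (T *ᵥ χ y')‖ ^ 2 : ℝ) : ℂ) := fun y y' => by
    rw [mul_vecMulVec, mul_vecMulVec, vecMulVec_mul_vecMulVec, trace_vecMulVec]
    have e : (T *ᵥ χ y) ⬝ᵥ star (χ y') = star (star (χ y) ⬝ᵥ (T *ᵥ χ y')) := by
      rw [star_dotProduct, star_mulVec, hT, star_star, dotProduct_comm, ← dotProduct_mulVec]
    rw [dotProduct_smul, smul_eq_mul, e, Complex.star_def, Complex.mul_conj']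
    push_cast; rfl
  rw [Matrix.mul_assoc (T * _) T]
  simp only [Matrix.mul_sum, Matrix.sum_mul, Matrix.mul_smul, Matrix.smul_mul, trace_sum,
    trace_smul, h, Complex.re_sum]
  rw [Finset.sum_comm]
  refine Finset.sum_congr rfl fun i _ => ?_
  rw [Complex.real_smul, Complex.re_ofReal_mul, Complex.re_sum, Finset.mul_sum]
  refine Finset.sum_congr rfl fun j _ => ?_
  rw [Complex.real_smul, ← Complex.ofReal_mul, Complex.ofReal_re]
  ring

/-- `⟨χ|T|χ⟩² ≤ ⟨χ|χ⟩ ⟨χ|T²|χ⟩`. -/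
theorem norm_sq_dotProduct_le {T : Matrix D D ℂ} (hT : Tᴴ = T) (χ : D → ℂ) :
    ‖star χ ⬝ᵥ (T *ᵥ χ)‖ ^ 2 ≤ (star χ ⬝ᵥ χ).re * (star χ ⬝ᵥ ((T * T) *ᵥ χ)).re := by
  have h := norm_inner_le_norm (𝕜 := ℂ) (WithLp.toLp 2 χ : EuclideanSpace ℂ D)
    (WithLp.toLp 2 (T *ᵥ χ))
  have e1 : ∀ v : D → ℂ, ‖(WithLp.toLp 2 v : EuclideanSpace ℂ D)‖ ^ 2 = (star v ⬝ᵥ v).re := fun v => by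
    rw [@norm_sq_eq_re_inner ℂ, EuclideanSpace.inner_eq_star_dotProduct, dotProduct_comm]; rfl
  have e2 : (star χ ⬝ᵥ ((T * T) *ᵥ χ)) = star (T *ᵥ χ) ⬝ᵥ (T *ᵥ χ) := by
    rw [star_mulVec, hT, ← mulVec_mulVec, dotProduct_mulVec]
  rw [EuclideanSpace.inner_eq_star_dotProduct, dotProduct_comm] at h
  rw [e2, ← e1, ← e1, ← mul_pow]
  exact pow_le_pow_left₀ (norm_nonneg _) h 2

/-- Summed over `v`, the product of the centred indicators is the collision indicator minus `1 /
|V|`. Two-universality makes its sum over the keys nonpositive for `y ≠ y'`, so only the diagonal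
survives. -/
theorem sum_collision_le {K V Y : Type} [Fintype Y] [DecidableEq Y] [Fintype V] [DecidableEq V]
    [Nonempty V] (keys : Finset K) (f : K → Y → V)
    (hf : ∀ y y', y ≠ y' → (keys.filter fun κ => f κ y = f κ y').card * Fintype.card V ≤ keys.card)
    (G : Y → Y → ℝ) (hG : ∀ y y', 0 ≤ G y y') :
    ∑ κ ∈ keys, ∑ v : V, ∑ y, ∑ y',
      ((if f κ y = v then 1 else 0) - (Fintype.card V : ℝ)⁻¹) *
        ((if f κ y' = v then 1 else 0) - (Fintype.card V : ℝ)⁻¹) * G y y' ≤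
      keys.card * ∑ y, G y y := by
  set N : ℝ := (Fintype.card V : ℝ) with hN
  have hN0 : 0 < N := by rw [hN]; exact_mod_cast Fintype.card_pos
  have h1 : ∀ κ y y', ∑ v : V, ((if f κ y = v then 1 else 0) - N⁻¹) *
      ((if f κ y' = v then 1 else 0) - N⁻¹) = (if f κ y = f κ y' then 1 else 0) - N⁻¹ := by
    intro κ y y'
    have : ∀ v : V, ((if f κ y = v then 1 else 0) - N⁻¹) * ((if f κ y' = v then 1 else 0) - N⁻¹) =
        (if f κ y = v then (if f κ y' = v then 1 else 0) else 0) - N⁻¹ * (if f κ y = v then 1 else 0)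
          - N⁻¹ * (if f κ y' = v then 1 else 0) + N⁻¹ * N⁻¹ := fun v => by
      split_ifs <;> ring
    simp only [this, Finset.sum_add_distrib, Finset.sum_sub_distrib, ← Finset.mul_sum,
      Finset.sum_ite_eq, Finset.mem_univ, if_true, Finset.sum_const, Finset.card_univ,
      nsmul_eq_mul, ← hN]
    simp only [eq_comm (a := f κ y')]
    field_simp
    ring
  have h2 : ∀ y y', ∑ κ ∈ keys, ((if f κ y = f κ y' then 1 else 0) - N⁻¹) ≤
      keys.card * (if y = y' then 1 else 0) := by
    intro y y'
    rw [Finset.sum_sub_distrib, Finset.sum_const, nsmul_eq_mul, Finset.sum_boole]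
    split_ifs with hy
    · subst hy
      have : 0 ≤ (keys.card : ℝ) * N⁻¹ := by positivity
      simp; linarith
    · have := hf y y' hy
      have h' : ((keys.filter fun κ => f κ y = f κ y').card : ℝ) * N ≤ keys.card := by
        rw [hN]; exact_mod_cast this
      rw [mul_zero, sub_nonpos, ← div_eq_mul_inv, le_div_iff₀ hN0]
      exact h'
  calc _ = ∑ y, ∑ y', (∑ κ ∈ keys, ((if f κ y = f κ y' then 1 else 0) - N⁻¹)) * G y y' := by
        have : ∀ κ ∈ keys, ∑ v : V, ∑ y, ∑ y', ((if f κ y = v then 1 else 0) - N⁻¹) *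
            ((if f κ y' = v then 1 else 0) - N⁻¹) * G y y' =
            ∑ y, ∑ y', ((if f κ y = f κ y' then 1 else 0) - N⁻¹) * G y y' := fun κ _ => by
          rw [Finset.sum_comm]
          refine Finset.sum_congr rfl fun y _ => ?_
          rw [Finset.sum_comm]
          refine Finset.sum_congr rfl fun y' _ => ?_
          rw [← Finset.sum_mul, h1]
        rw [Finset.sum_congr rfl this, Finset.sum_comm]
        refine Finset.sum_congr rfl fun y _ => ?_
        rw [Finset.sum_comm]
        exact Finset.sum_congr rfl fun y' _ => by rw [Finset.sum_mul]
    _ ≤ ∑ y, ∑ y', (keys.card * (if y = y' then 1 else 0) : ℝ) * G y y' :=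
        Finset.sum_le_sum fun y _ => Finset.sum_le_sum fun y' _ =>
          mul_le_mul_of_nonneg_right (h2 y y') (hG y y')
    _ = _ := by
        rw [Finset.mul_sum]
        refine Finset.sum_congr rfl fun y _ => ?_
        simp

theorem sum_sqrt_le {α : Type} (s : Finset α) (X : α → ℝ) (hX : ∀ a ∈ s, 0 ≤ X a) :
    ∑ a ∈ s, √(X a) ≤ √(s.card * ∑ a ∈ s, X a) := by
  refine Real.le_sqrt_of_sq_le ?_
  refine (sq_sum_le_card_mul_sum_sq (s := s) (f := fun a => √(X a))).trans (le_of_eq ?_)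
  congr 1
  exact Finset.sum_congr rfl fun a ha => Real.sq_sqrt (hX a ha)

/-- Hashing with a two-universal family when the quantum memory has been subjected to the
operation `M`. -/
theorem privacyAmplification_single {K V Y : Type} [Fintype Y] [DecidableEq Y] [Fintype V]
    [DecidableEq V] [Nonempty V] (keys : Finset K) (f : K → Y → V)
    (hf : ∀ y y', y ≠ y' → (keys.filter fun κ => f κ y = f κ y').card * Fintype.card V ≤ keys.card)
    (χ : Y → D → ℂ) (M : Matrix m D ℂ) :
    ∑ κ ∈ keys, ∑ v : V, traceNorm (M * (∑ y, ((if f κ y = v then 1 else 0) -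
        (Fintype.card V : ℝ)⁻¹) • vecMulVec (χ y) (star (χ y))) * Mᴴ) ≤
      keys.card * (√(Fintype.card V) * √((Mᴴ * M).trace.re *
        ∑ y, (star (χ y) ⬝ᵥ χ y).re * (star (χ y) ⬝ᵥ ((Mᴴ * M) *ᵥ χ y)).re)) := by
  obtain ⟨T, hT, hTT, hM⟩ := exists_sqrt_traceNorm_sq_le M
  have htr : 0 ≤ (Mᴴ * M).trace.re := trace_re_nonneg (posSemidef_conjTranspose_mul_self M)
  set N : ℝ := (Fintype.card V : ℝ) with hN
  let G : Y → Y → ℝ := fun y y' => ‖star (χ y) ⬝ᵥ (T *ᵥ χ y')‖ ^ 2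
  let c : K → V → Y → ℝ := fun κ v y => (if f κ y = v then 1 else 0) - N⁻¹
  let X : K → V → ℝ := fun κ v => ∑ y, ∑ y', c κ v y * c κ v y' * G y y'
  have hA : ∀ κ v, (∑ y, c κ v y • vecMulVec (χ y) (star (χ y))).IsHermitian := fun κ v =>
    isHermitian_sum _ fun y _ => isHermitian_real_smul (vecMulVec_star_isHermitian _) _
  have h1 : ∀ κ v, traceNorm (M * (∑ y, c κ v y • vecMulVec (χ y) (star (χ y))) * Mᴴ) ≤
      √((Mᴴ * M).trace.re * X κ v) := fun κ v => by
    refine Real.le_sqrt_of_sq_le ((hM _ (hA κ v)).trans (le_of_eq ?_))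
    rw [trace_weighted_eq hT]
  have h2 : ∑ κ ∈ keys, ∑ v, X κ v ≤ keys.card * ∑ y, G y y :=
    sum_collision_le keys f hf G fun _ _ => by positivity
  -- On the diagonal the square is traded for the weight of `y` times the joint weight of `y` and
  -- the outcome `M`.
  have h3 : ∑ y, G y y ≤ ∑ y, (star (χ y) ⬝ᵥ χ y).re * (star (χ y) ⬝ᵥ ((Mᴴ * M) *ᵥ χ y)).re :=
    Finset.sum_le_sum fun y _ => by rw [← hTT]; exact norm_sq_dotProduct_le hT _
  -- The coefficients `c` take both signs; nonnegativity comes from the squared trace norm which the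
  -- expression dominates.
  have hX : ∀ κ v, 0 ≤ (Mᴴ * M).trace.re * X κ v := fun κ v => by
    have := hM _ (hA κ v)
    rw [trace_weighted_eq hT] at this
    exact (sq_nonneg _).trans this
  calc _ ≤ ∑ q ∈ keys ×ˢ (Finset.univ : Finset V), √((Mᴴ * M).trace.re * X q.1 q.2) := by
        rw [Finset.sum_product]
        exact Finset.sum_le_sum fun κ _ => Finset.sum_le_sum fun v _ => h1 κ v
    _ ≤ √((keys ×ˢ (Finset.univ : Finset V)).card *
          ∑ q ∈ keys ×ˢ (Finset.univ : Finset V), (Mᴴ * M).trace.re * X q.1 q.2) :=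
        sum_sqrt_le _ _ fun q _ => hX _ _
    _ ≤ √((keys.card : ℝ) ^ 2 * (N * ((Mᴴ * M).trace.re * ∑ y, (star (χ y) ⬝ᵥ χ y).re *
          (star (χ y) ⬝ᵥ ((Mᴴ * M) *ᵥ χ y)).re))) := by
        refine Real.sqrt_le_sqrt ?_
        rw [Finset.card_product, Finset.card_univ, ← Finset.mul_sum, Finset.sum_product]
        push_cast
        rw [← hN]
        calc _ = (keys.card * N * (Mᴴ * M).trace.re) * ∑ κ ∈ keys, ∑ v, X κ v := by ring
          _ ≤ (keys.card * N * (Mᴴ * M).trace.re) * (keys.card * ∑ y, (star (χ y) ⬝ᵥ χ y).re *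
                (star (χ y) ⬝ᵥ ((Mᴴ * M) *ᵥ χ y)).re) := by
              refine mul_le_mul_of_nonneg_left (h2.trans ?_) (by positivity)
              exact mul_le_mul_of_nonneg_left h3 (by positivity)
          _ = _ := by ring
    _ = _ := by
        rw [Real.sqrt_mul (by positivity), Real.sqrt_sq (by positivity), Real.sqrt_mul (by positivity)]

end PrivacyAmplification

/-! ### Privacy amplification when the measurement outcome selects the hashed part -/

section PrivacyAmplification

variable {m D : Type} [Fintype m] [DecidableEq m] [Fintype D] [DecidableEq D]

theorem star_dotProduct_self_re_nonneg (v : D → ℂ) : 0 ≤ (star v ⬝ᵥ v).re :=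
  (Complex.le_def.1 (dotProduct_star_self_nonneg v)).1

theorem star_dotProduct_gram (M : Matrix m D ℂ) (χ : D → ℂ) :
    star χ ⬝ᵥ ((Mᴴ * M) *ᵥ χ) = star (M *ᵥ χ) ⬝ᵥ (M *ᵥ χ) := by
  rw [star_mulVec, ← mulVec_mulVec, dotProduct_mulVec]

/-- Privacy amplification if the part of the string that is hashed may depend on the outcome `j` of
a measurement of the quantum memory, given by the operators `M j`. -/
theorem privacyAmplification {X K V J : Type} {Y C : J → Type} [Fintype X] [Fintype J]
    [∀ j, Fintype (Y j)] [∀ j, DecidableEq (Y j)] [∀ j, Fintype (C j)] [Fintype V] [DecidableEq V]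
    [Nonempty V] (keys : Finset K) (f : ∀ j, K → Y j → V)
    (hf : ∀ j y y', y ≠ y' →
      (keys.filter fun κ => f j κ y = f j κ y').card * Fintype.card V ≤ keys.card)
    (e : ∀ j, Y j × C j ≃ X) (χ : X → D → ℂ) (M : J → Matrix m D ℂ)
    (hM : ∑ j, (M j)ᴴ * M j = 1) {ε : ℝ} (hε : 0 ≤ ε)
    (hχ : ∀ j y c, (star (χ (e j (y, c))) ⬝ᵥ χ (e j (y, c))).re ≤
      ε * ∑ y', (star (χ (e j (y', c))) ⬝ᵥ χ (e j (y', c))).re) :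
    ∑ j, ∑ κ ∈ keys, ∑ c, ∑ v : V, traceNorm (M j * (∑ y, ((if f j κ y = v then 1 else 0) -
        (Fintype.card V : ℝ)⁻¹) • vecMulVec (χ (e j (y, c))) (star (χ (e j (y, c))))) * (M j)ᴴ) ≤
      keys.card * (√(Fintype.card V * Fintype.card D * ε) *
        ∑ x, (star (χ x) ⬝ᵥ χ x).re) := by
  set p : X → ℝ := fun x => (star (χ x) ⬝ᵥ χ x).re with hp
  let a : J → X → ℝ := fun j x => (star (χ x) ⬝ᵥ (((M j)ᴴ * M j) *ᵥ χ x)).re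
  have hp0 : ∀ x, 0 ≤ p x := fun x => star_dotProduct_self_re_nonneg _
  have ha0 : ∀ j x, 0 ≤ a j x := fun j x => by
    simp only [a, star_dotProduct_gram]; exact star_dotProduct_self_re_nonneg _
  have ht0 : ∀ j, 0 ≤ ((M j)ᴴ * M j).trace.re := fun j =>
    trace_re_nonneg (posSemidef_conjTranspose_mul_self _)
  have hsa : ∀ x, ∑ j, a j x = p x := fun x => by
    simp only [a, hp]
    rw [← Complex.re_sum, ← dotProduct_sum, ← sum_mulVec, hM, one_mulVec]
  -- The whole cost of the memory: the traces of the POVM elements add up to its dimension, however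
  -- many outcomes there are.
  have hst : ∑ j, ((M j)ᴴ * M j).trace.re = Fintype.card D := by
    rw [← Complex.re_sum, ← trace_sum, hM, trace_one]; simp
  have hsplit : ∀ (j) (g : X → ℝ), ∑ c, ∑ y, g (e j (y, c)) = ∑ x, g x := fun j g => by
    rw [← (e j).sum_comp, Fintype.sum_prod_type, Finset.sum_comm]
  let u : (Σ j, C j) → ℝ := fun q => ((M q.1)ᴴ * M q.1).trace.re * (ε * ∑ y, p (e q.1 (y, q.2)))
  let w : (Σ j, C j) → ℝ := fun q => ∑ y, a q.1 (e q.1 (y, q.2))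
  have hu0 : ∀ q, 0 ≤ u q := fun q =>
    mul_nonneg (ht0 _) (mul_nonneg hε (Finset.sum_nonneg fun _ _ => hp0 _))
  have hw0 : ∀ q, 0 ≤ w q := fun q => Finset.sum_nonneg fun _ _ => ha0 _ _
  have h1 : ∀ j c, ∑ κ ∈ keys, ∑ v : V, traceNorm (M j * (∑ y, ((if f j κ y = v then 1 else 0) -
        (Fintype.card V : ℝ)⁻¹) • vecMulVec (χ (e j (y, c))) (star (χ (e j (y, c))))) * (M j)ᴴ) ≤
      keys.card * (√(Fintype.card V) * (√(u ⟨j, c⟩) * √(w ⟨j, c⟩))) := fun j c => by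
    refine (privacyAmplification_single keys (f j) (hf j) (fun y => χ (e j (y, c))) (M j)).trans ?_
    rw [← Real.sqrt_mul (hu0 _)]
    refine mul_le_mul_of_nonneg_left (mul_le_mul_of_nonneg_left (Real.sqrt_le_sqrt ?_)
      (Real.sqrt_nonneg _)) (Nat.cast_nonneg _)
    change _ ≤ (((M j)ᴴ * M j).trace.re * (ε * ∑ y, p (e j (y, c)))) * ∑ y, a j (e j (y, c))
    rw [mul_assoc]
    refine mul_le_mul_of_nonneg_left ?_ (ht0 j)
    rw [Finset.mul_sum]
    exact Finset.sum_le_sum fun y _ => mul_le_mul_of_nonneg_right (hχ j y c) (ha0 j _)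
  have hw : ∑ q, w q = ∑ x, p x := by
    rw [Fintype.sum_sigma]
    simp only [w]
    rw [Finset.sum_congr rfl fun j _ => hsplit j (a j), Finset.sum_comm]
    exact Finset.sum_congr rfl fun x _ => hsa x
  have hu : ∑ q, u q = Fintype.card D * ε * ∑ x, p x := by
    rw [Fintype.sum_sigma]
    simp only [u]
    have : ∀ j, ∑ c, ((M j)ᴴ * M j).trace.re * (ε * ∑ y, p (e j (y, c))) =
        ((M j)ᴴ * M j).trace.re * (ε * ∑ x, p x) := fun j => by
      rw [← Finset.mul_sum, ← Finset.mul_sum, hsplit j p]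
    rw [Finset.sum_congr rfl fun j _ => this j, ← Finset.sum_mul, hst]; ring
  calc _ = ∑ q : Σ j, C j, ∑ κ ∈ keys, ∑ v : V, traceNorm (M q.1 * (∑ y,
          ((if f q.1 κ y = v then 1 else 0) - (Fintype.card V : ℝ)⁻¹) •
            vecMulVec (χ (e q.1 (y, q.2))) (star (χ (e q.1 (y, q.2))))) * (M q.1)ᴴ) := by
        rw [Fintype.sum_sigma]
        exact Finset.sum_congr rfl fun j _ => Finset.sum_comm
    _ ≤ ∑ q, keys.card * (√(Fintype.card V) * (√(u q) * √(w q))) :=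
        Finset.sum_le_sum fun q _ => h1 q.1 q.2
    _ = keys.card * (√(Fintype.card V) * ∑ q, √(u q) * √(w q)) := by
        rw [← Finset.mul_sum, ← Finset.mul_sum]
    -- Cauchy–Schwarz over the outcomes `j` and the values `c` of the unhashed bits together.
    _ ≤ keys.card * (√(Fintype.card V) * (√(∑ q, u q) * √(∑ q, w q))) := by
        gcongr
        exact Real.sum_sqrt_mul_sqrt_le _ hu0 hw0
    _ = _ := by
        have hP : 0 ≤ ∑ x, p x := Finset.sum_nonneg fun x _ => hp0 x
        rw [hu, hw, mul_assoc (Fintype.card V : ℝ), Real.sqrt_mul (by positivity) (∑ x, p x),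
          mul_assoc √(_ * ε), Real.mul_self_sqrt hP, ← mul_assoc √(Fintype.card V : ℝ),
          ← Real.sqrt_mul (by positivity)]

end PrivacyAmplification

/-! ### Restriction to the support of a mixture -/

section Support

variable {X ι : Type} [Fintype X] [Fintype ι] [DecidableEq ι]

/-- The vectors of a mixture of rank `D` can be written as `B φ` with an isometry `B` on a space of
dimension `D`. -/
theorem exists_isometry_of_mixture {P : X → ℝ} (hP : ∀ x, 0 ≤ P x) (ψ : X → ι → ℂ) :
    ∃ (D : Type) (_ : Fintype D) (_ : DecidableEq D) (B : Matrix ι D ℂ) (φ : X → D → ℂ),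
      Fintype.card D = (mixture P ψ).rank ∧ Bᴴ * B = 1 ∧ ∀ x, P x ≠ 0 → ψ x = B *ᵥ φ x := by
  have hpos : (mixture P ψ).PosSemidef := posSemidef_sum _ fun x _ =>
    (posSemidef_vecMulVec_self_star (ψ x)).smul (hP x)
  obtain ⟨U, lam, hU, hU', h, hlam⟩ := exists_diagonalization hpos.isHermitian
  refine ⟨{i // lam i ≠ 0}, inferInstance, inferInstance, U.submatrix id Subtype.val,
    fun x i => (Uᴴ *ᵥ ψ x) i, ?_, ?_, fun x hx => ?_⟩
  · rw [hpos.isHermitian.rank_eq_card_non_zero_eigs, ← hlam]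
  · ext i j
    have := congrFun (congrFun hU i.1) j.1
    rw [mul_apply] at this ⊢
    simpa [one_apply, Subtype.ext_iff] using this
  -- The diagonal entry at a kernel vector is a sum of terms `P x * ‖·‖ ^ 2` equal to zero, so
  -- vectors of positive weight have no component along the kernel.
  · have hz : ∀ i, lam i = 0 → (Uᴴ *ᵥ ψ x) i = 0 := fun i hi => by
      have h1 : Uᴴ * mixture P ψ * U = diagonal fun i => (lam i : ℂ) := by
        rw [h]
        calc _ = (Uᴴ * U) * diagonal (fun i => (lam i : ℂ)) * (Uᴴ * U) := by
              simp only [Matrix.mul_assoc]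
          _ = _ := by rw [hU]; simp
      have h2 : Uᴴ * mixture P ψ * U =
          ∑ x, P x • vecMulVec (Uᴴ *ᵥ ψ x) (star (Uᴴ *ᵥ ψ x)) := by
        rw [mixture, Matrix.mul_sum, Matrix.sum_mul]
        refine Finset.sum_congr rfl fun x _ => ?_
        rw [Matrix.mul_smul, Matrix.smul_mul, mul_vecMulVec, vecMulVec_mul, star_mulVec,
          conjTranspose_conjTranspose]
      have h3 := congrArg Complex.re (congrFun (congrFun (h2.symm.trans h1) i) i)
      rw [diagonal_apply_eq, hi, Matrix.sum_apply, Complex.re_sum] at h3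
      have h4 : ∀ x, ((P x • vecMulVec (Uᴴ *ᵥ ψ x) (star (Uᴴ *ᵥ ψ x))) i i).re =
          P x * ‖(Uᴴ *ᵥ ψ x) i‖ ^ 2 := fun x => by
        rw [Matrix.smul_apply, vecMulVec_apply, Pi.star_apply, Complex.star_def, Complex.mul_conj',
          Complex.real_smul, Complex.re_ofReal_mul, ← Complex.ofReal_pow, Complex.ofReal_re]
      simp only [h4, Complex.ofReal_zero, Complex.zero_re] at h3
      have := (Finset.sum_eq_zero_iff_of_nonneg fun x _ =>
        mul_nonneg (hP x) (sq_nonneg _)).1 h3 x (Finset.mem_univ _)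
      simpa [hx] using this
    have h5 : ψ x = U *ᵥ (Uᴴ *ᵥ ψ x) := by rw [mulVec_mulVec, hU', one_mulVec]
    conv_lhs => rw [h5]
    ext k
    change ∑ i, U k i * (Uᴴ *ᵥ ψ x) i = ∑ i : {i // lam i ≠ 0}, U k i.1 * (Uᴴ *ᵥ ψ x) i.1
    rw [← Finset.sum_subtype (Finset.univ.filter fun i => lam i ≠ 0) (by simp)
      (fun i => U k i * (Uᴴ *ᵥ ψ x) i), Finset.sum_filter]
    refine Finset.sum_congr rfl fun i _ => ?_
    split_ifs with hi
    · rfl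
    · rw [hz i (not_not.1 hi), mul_zero]

end Support

/-! ### Kraus operators of circuits -/

section Lift

variable {W R W' : Type} [Fintype W] [DecidableEq W] [Fintype R] [DecidableEq R] [Fintype W']
  [DecidableEq W']

/-- Assignments of the wires `W'` as pairs of assignments of `W` and `R`. -/
def splitEquiv (f : W ⊕ R ≃ W') : (W' → Bool) ≃ (W → Bool) × (R → Bool) :=
  (Equiv.arrowCongr f.symm (Equiv.refl Bool)).trans (Equiv.sumArrowEquivProdArrow W R Bool)

@[simp] theorem splitEquiv_fst (f : W ⊕ R ≃ W') (s : W' → Bool) (i : W) :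
    (splitEquiv f s).1 i = s (f (Sum.inl i)) := rfl

@[simp] theorem splitEquiv_snd (f : W ⊕ R ≃ W') (s : W' → Bool) (i : R) :
    (splitEquiv f s).2 i = s (f (Sum.inr i)) := rfl

/-- The operator `A ⊗ 1` on the wires `W' ≃ W ⊕ R`. -/
def liftOp (f : W ⊕ R ≃ W') (A : Op W) : Op W' :=
  Matrix.of fun s t =>
    if (splitEquiv f s).2 = (splitEquiv f t).2 then A (splitEquiv f s).1 (splitEquiv f t).1 else 0

theorem liftOp_mul (f : W ⊕ R ≃ W') (A B : Op W) : liftOp f (A * B) = liftOp f A * liftOp f B := by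
  ext s t
  rw [mul_apply, ← (splitEquiv f).symm.sum_comp, Fintype.sum_prod_type]
  simp only [liftOp, of_apply, Equiv.apply_symm_apply]
  by_cases h : (splitEquiv f s).2 = (splitEquiv f t).2
  · simp [h, mul_apply]
  · rw [if_neg h]
    symm
    refine Finset.sum_eq_zero fun u _ => Finset.sum_eq_zero fun v _ => ?_
    by_cases h1 : (splitEquiv f s).2 = v
    · rw [if_neg (c := v = _) (fun h2 => h (h1.trans h2)), mul_zero]
    · rw [if_neg h1, zero_mul]

@[simp] theorem liftOp_one (f : W ⊕ R ≃ W') : liftOp f (1 : Op W) = 1 := by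
  ext s t
  simp only [liftOp, of_apply, one_apply]
  by_cases h : s = t
  · simp [h]
  · rw [if_neg h]
    split_ifs with h1 h2
    · exact absurd ((splitEquiv f).injective (Prod.ext h2 h1)) h
    · rfl
    · rfl

theorem liftOp_conjTranspose (f : W ⊕ R ≃ W') (A : Op W) : (liftOp f A)ᴴ = liftOp f Aᴴ := by
  ext s t
  simp only [liftOp, of_apply, conjTranspose_apply]
  by_cases h : (splitEquiv f s).2 = (splitEquiv f t).2
  · rw [if_pos h, if_pos h.symm]
  · rw [if_neg h, if_neg (Ne.symm h), star_zero]

theorem Gate.toOp_eq_liftOp (g : Gate W) :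
    g.toOp = liftOp (Equiv.sumCompl fun i => i ∈ g.supp)
      (g.unitary : Matrix (g.supp → Bool) (g.supp → Bool) ℂ) := by
  ext s t
  simp only [Gate.toOp, liftOp, of_apply]
  refine if_congr ?_ rfl rfl
  rw [funext_iff, Subtype.forall]
  rfl

theorem Gate.conjTranspose_mul_toOp (g : Gate W) : g.toOpᴴ * g.toOp = 1 := by
  rw [g.toOp_eq_liftOp, liftOp_conjTranspose, ← liftOp_mul]
  have : (g.unitary : Matrix (g.supp → Bool) (g.supp → Bool) ℂ)ᴴ * g.unitary = 1 :=
    Matrix.UnitaryGroup.star_mul_self g.unitary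
  rw [this, liftOp_one]

theorem gatesOp_unitary (gs : List (Gate W)) : (gatesOp gs)ᴴ * gatesOp gs = 1 := by
  induction gs with
  | nil => simp [gatesOp]
  | cons g gs ih =>
    calc (gatesOp gs * g.toOp)ᴴ * (gatesOp gs * g.toOp)
        = g.toOpᴴ * ((gatesOp gs)ᴴ * gatesOp gs) * g.toOp := by
          simp only [conjTranspose_mul, Matrix.mul_assoc]
      _ = 1 := by rw [ih, Matrix.mul_one, g.conjTranspose_mul_toOp]

theorem gatesOp_append (gs hs : List (Gate W)) : gatesOp (gs ++ hs) = gatesOp hs * gatesOp gs := by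
  induction gs with
  | nil => simp [gatesOp]
  | cons g gs ih => simp only [List.cons_append, gatesOp, ih, Matrix.mul_assoc]

theorem submatrix_mem_unitaryGroup {α β : Type} [Fintype α] [DecidableEq α] [Fintype β]
    [DecidableEq β] (e : α ≃ β) (U : Matrix.unitaryGroup β ℂ) :
    (U : Matrix β β ℂ).submatrix e e ∈ Matrix.unitaryGroup α ℂ := by
  rw [mem_unitaryGroup_iff', star_eq_conjTranspose, conjTranspose_submatrix, submatrix_mul_equiv]
  have : (U : Matrix β β ℂ)ᴴ * U = 1 := Matrix.UnitaryGroup.star_mul_self U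
  rw [this, submatrix_one_equiv]

/-- A finset and its image under an embedding. -/
def mapEquiv {α β : Type} (s : Finset α) (f : α ↪ β) : s ≃ s.map f :=
  Equiv.ofBijective (fun i => ⟨f i, Finset.mem_map_of_mem f i.2⟩) ⟨fun i j h =>
    Subtype.ext (f.injective (congrArg Subtype.val h)), fun j => by
      obtain ⟨i, hi, h⟩ := Finset.mem_map.1 j.2
      exact ⟨⟨i, hi⟩, Subtype.ext h⟩⟩

/-- The gate acting on the wires `W` of `W' ≃ W ⊕ R`. -/
def Gate.lift (f : W ⊕ R ≃ W') (g : Gate W) : Gate W' where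
  supp := g.supp.map (Function.Embedding.inl.trans f.toEmbedding)
  card_le := by rw [Finset.card_map]; exact g.card_le
  unitary := ⟨_, submatrix_mem_unitaryGroup (Equiv.arrowCongr (mapEquiv g.supp
    (Function.Embedding.inl.trans f.toEmbedding)).symm (Equiv.refl Bool)) g.unitary⟩

theorem Gate.lift_toOp (f : W ⊕ R ≃ W') (g : Gate W) : (g.lift f).toOp = liftOp f g.toOp := by
  ext s t
  have hmem : ∀ i : W, f (Sum.inl i) ∈ (g.lift f).supp ↔ i ∈ g.supp := fun i => by
    simp [Gate.lift]
  have hmem' : ∀ r : R, f (Sum.inr r) ∉ (g.lift f).supp := fun r => by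
    simp [Gate.lift]
  have hiff : (∀ i, i ∉ (g.lift f).supp → s i = t i) ↔
      (splitEquiv f s).2 = (splitEquiv f t).2 ∧
        ∀ i, i ∉ g.supp → (splitEquiv f s).1 i = (splitEquiv f t).1 i := by
    constructor
    · exact fun h => ⟨funext fun r => h _ (hmem' r), fun i hi => h _ fun h' => hi ((hmem i).1 h')⟩
    · rintro ⟨h1, h2⟩ i hi
      obtain ⟨j, rfl⟩ := f.surjective i
      rcases j with j | j
      · exact h2 j fun h' => hi ((hmem j).2 h')
      · exact congrFun h1 j
  simp only [liftOp, Gate.toOp, of_apply, ite_and, hiff]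
  rfl

theorem gatesOp_lift (f : W ⊕ R ≃ W') (gs : List (Gate W)) :
    gatesOp (gs.map (Gate.lift f)) = liftOp f (gatesOp gs) := by
  induction gs with
  | nil => simp [gatesOp]
  | cons g gs ih => rw [List.map_cons, gatesOp, ih, g.lift_toOp, ← liftOp_mul]; rfl

end Lift

/-! ### Instruments of circuits on arbitrary wire types -/

section Kraus

variable {CI QI CO QO A G W : Type} [Fintype CI] [DecidableEq CI] [Fintype QI] [DecidableEq QI]
  [Fintype CO] [DecidableEq CO] [Fintype QO] [DecidableEq QO]
  [Fintype A] [DecidableEq A] [Fintype G] [DecidableEq G] [Fintype W] [DecidableEq W]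

/-- The assignment of the wires `W` given by assignments of three parts. -/
def joinBits (e : CI ⊕ (QI ⊕ A) ≃ W) (x : CI → Bool) (q : QI → Bool) (a : A → Bool) : W → Bool :=
  Sum.elim x (Sum.elim q a) ∘ e.symm

/-- The Kraus operator with classical outcome `c` and garbage `g` of the unitary `U`. -/
def wireKraus (U : Op W) (ein : CI ⊕ (QI ⊕ A) ≃ W) (eout : CO ⊕ (QO ⊕ G) ≃ W) (x : CI → Bool)
    (c : CO → Bool) (g : G → Bool) : Matrix (QO → Bool) (QI → Bool) ℂ :=
  Matrix.of fun q q' => U (joinBits eout c q g) (joinBits ein x q' fun _ => false)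

/-- The instrument given by the Kraus operators `wireKraus`. -/
def wireRun (U : Op W) (ein : CI ⊕ (QI ⊕ A) ≃ W) (eout : CO ⊕ (QO ⊕ G) ≃ W) (x : CI → Bool)
    (ρ : Op QI) (c : CO → Bool) : Op QO :=
  ∑ g : G → Bool, wireKraus U ein eout x c g * ρ * (wireKraus U ein eout x c g)ᴴ

theorem joinBits_injective (e : CI ⊕ (QI ⊕ A) ≃ W) {x x' : CI → Bool} {q q' : QI → Bool}
    {a a' : A → Bool} (h : joinBits e x q a = joinBits e x' q' a') : x = x' ∧ q = q' ∧ a = a' := by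
  have h' : Sum.elim x (Sum.elim q a) = Sum.elim x' (Sum.elim q' a') := by
    have := congrArg (· ∘ e) h
    simpa [joinBits, Function.comp_assoc] using this
  refine ⟨?_, ?_, ?_⟩
  · funext i; exact congrFun h' (Sum.inl i)
  · funext i; exact congrFun h' (Sum.inr (Sum.inl i))
  · funext i; exact congrFun h' (Sum.inr (Sum.inr i))

/-- `joinBits` as a bijection. -/
def joinEquiv (e : CI ⊕ (QI ⊕ A) ≃ W) :
    (CI → Bool) × (QI → Bool) × (A → Bool) ≃ (W → Bool) where
  toFun p := joinBits e p.1 p.2.1 p.2.2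
  invFun s := (fun i => s (e (Sum.inl i)), fun i => s (e (Sum.inr (Sum.inl i))),
    fun i => s (e (Sum.inr (Sum.inr i))))
  left_inv p := by simp [joinBits]
  right_inv s := by
    funext w
    obtain ⟨i, rfl⟩ := e.surjective w
    rcases i with i | i | i <;> simp [joinBits]

theorem sum_joinBits {M : Type} [AddCommMonoid M] (e : CI ⊕ (QI ⊕ A) ≃ W) (F : (W → Bool) → M) :
    ∑ s, F s = ∑ x, ∑ q, ∑ a, F (joinBits e x q a) := by
  rw [← (joinEquiv e).sum_comp, Fintype.sum_prod_type]
  exact Finset.sum_congr rfl fun x _ => Fintype.sum_prod_type _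

/-- The columns of `U` with input `x` and all ancillas zero are orthonormal, while `c`, `g` and the
output index together run over all rows. -/
theorem sum_wireKraus (U : Op W) (hU : Uᴴ * U = 1) (ein : CI ⊕ (QI ⊕ A) ≃ W)
    (eout : CO ⊕ (QO ⊕ G) ≃ W) (x : CI → Bool) :
    ∑ c, ∑ g, (wireKraus U ein eout x c g)ᴴ * wireKraus U ein eout x c g = 1 := by
  ext q q'
  have h := congrFun (congrFun hU (joinBits ein x q fun _ => false)) (joinBits ein x q' fun _ => false)
  rw [mul_apply, sum_joinBits eout] at h
  have e1 : (1 : Op W) (joinBits ein x q fun _ => false) (joinBits ein x q' fun _ => false) =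
      (1 : Op QI) q q' := by
    simp only [one_apply]
    refine if_congr ⟨fun h => (joinBits_injective ein h).2.1, fun h => by rw [h]⟩ rfl rfl
  rw [← e1, ← h]
  simp only [Matrix.sum_apply, mul_apply, wireKraus, conjTranspose_apply, of_apply]
  exact Finset.sum_congr rfl fun c _ => Finset.sum_comm

/-- The isometry `|q⟩ ↦ |x, q, 0⟩`, followed by the gates and by fixing the output bits `c` and `g`,
is the Kraus operator. Positivity, linearity and trace preservation of circuits are read off from
this form. -/
theorem Circuit.run_eq_wireRun (C : Circuit CI QI CO QO) (x : CI → Bool) (ρ : Op QI)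
    (c : CO → Bool) :
    C.run x ρ c = wireRun (gatesOp C.gates) (Equiv.refl _) C.layout.symm x ρ c := by
  ext q q'
  have hinit : ∀ a b, C.initial x ρ a b = ∑ p, ∑ p',
      (if a = joinBits (Equiv.refl _) x p (fun _ => false) then 1 else 0) * ρ p p' *
        (if b = joinBits (Equiv.refl _) x p' (fun _ => false) then 1 else 0) := by
    intro a b
    obtain ⟨⟨xa, qa, aa⟩, rfl⟩ := (joinEquiv (Equiv.refl _)).surjective a
    obtain ⟨⟨xb, qb, ab⟩, rfl⟩ := (joinEquiv (Equiv.refl _)).surjective b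
    have hinj : ∀ (x y : CI → Bool) (q r : QI → Bool) (a b : Fin C.anc → Bool),
        joinBits (Equiv.refl _) x q a = joinBits (Equiv.refl _) y r b ↔ x = y ∧ q = r ∧ a = b :=
      fun x y q r a b => ⟨joinBits_injective _, by rintro ⟨rfl, rfl, rfl⟩; rfl⟩
    simp only [joinEquiv, Equiv.coe_fn_mk, hinj]
    have e1 : C.initial x ρ (joinBits (Equiv.refl _) xa qa aa) (joinBits (Equiv.refl _) xb qb ab) =
        if xa = x ∧ xb = x ∧ aa = (fun _ => false) ∧ ab = (fun _ => false) then ρ qa qb else 0 := by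
      simp only [Circuit.initial, of_apply, joinBits, funext_iff]
      rfl
    rw [e1]
    by_cases h1 : xa = x <;> by_cases h2 : xb = x <;> by_cases h3 : aa = (fun _ => false) <;>
      by_cases h4 : ab = (fun _ => false) <;> simp [h1, h2, h3, h4]
  set E : Matrix (CI ⊕ (QI ⊕ Fin C.anc) → Bool) (QI → Bool) ℂ := Matrix.of fun a p =>
    if a = joinBits (Equiv.refl _) x p (fun _ => false) then (1 : ℂ) else 0 with hE
  have hin : C.initial x ρ = E * ρ * Eᴴ := by
    ext a b
    rw [hinit, mul_apply]
    simp only [hE, mul_apply, conjTranspose_apply, of_apply, Finset.sum_mul]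
    rw [Finset.sum_comm]
    refine Finset.sum_congr rfl fun p _ => Finset.sum_congr rfl fun p' _ => ?_
    split_ifs <;> simp
  rw [Circuit.run, of_apply, wireRun, Matrix.sum_apply]
  refine Finset.sum_congr rfl fun g _ => ?_
  rw [Circuit.final, hin]
  have hK : wireKraus (gatesOp C.gates) (Equiv.refl _) C.layout.symm x c g =
      (gatesOp C.gates * E).submatrix (fun q => Sum.elim c (Sum.elim q g) ∘ C.layout) id := by
    ext q q'
    rw [submatrix_apply, mul_apply]
    simp only [hE, of_apply, mul_ite, mul_one, mul_zero, Finset.sum_ite_eq', Finset.mem_univ,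
      if_true]
    rfl
  have e2 : gatesOp C.gates * (E * ρ * Eᴴ) * (gatesOp C.gates)ᴴ =
      (gatesOp C.gates * E) * ρ * (gatesOp C.gates * E)ᴴ := by
    simp only [conjTranspose_mul, Matrix.mul_assoc]
  rw [hK, e2]
  rfl

/-- Frees later constructions from the fixed shape of `Circuit`: gates may be written on any
convenient wire type, with inputs and outputs named by two separate bijections. -/
theorem exists_circuit (ein : CI ⊕ (QI ⊕ A) ≃ W) (eout : CO ⊕ (QO ⊕ G) ≃ W) (gs : List (Gate W)) :
    ∃ C : Circuit CI QI CO QO, C.time = Fintype.card W + gs.length ∧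
      ∀ x ρ c, C.run x ρ c = wireRun (gatesOp gs) ein eout x ρ c := by
  let a := Fintype.equivFin A
  let b := Fintype.equivFin G
  let w : CI ⊕ (QI ⊕ Fin (Fintype.card A)) ≃ W :=
    (Equiv.sumCongr (Equiv.refl _) (Equiv.sumCongr (Equiv.refl _) a.symm)).trans ein
  let v : CO ⊕ (QO ⊕ Fin (Fintype.card G)) ≃ W :=
    (Equiv.sumCongr (Equiv.refl _) (Equiv.sumCongr (Equiv.refl _) b.symm)).trans eout
  -- With no spectator wires, lifting a gate is just renaming.
  let f : W ⊕ Empty ≃ CI ⊕ (QI ⊕ Fin (Fintype.card A)) := (Equiv.sumEmpty W Empty).trans w.symm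
  refine ⟨⟨Fintype.card A, Fintype.card G, w.trans v.symm, gs.map (Gate.lift f)⟩, ?_, ?_⟩
  · simp only [Circuit.time, List.length_map]
    rw [Fintype.card_congr w]
  · intro x ρ c
    rw [Circuit.run_eq_wireRun, wireRun, wireRun,
      ← (Equiv.arrowCongr b (Equiv.refl Bool)).sum_comp]
    have hK : ∀ g : G → Bool, wireKraus (gatesOp (gs.map (Gate.lift f))) (Equiv.refl _)
        (w.trans v.symm).symm x c (Equiv.arrowCongr b (Equiv.refl Bool) g) =
        wireKraus (gatesOp gs) ein eout x c g := fun g => by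
      ext q q'
      rw [gatesOp_lift]
      simp only [wireKraus, liftOp, of_apply]
      rw [if_pos (Subsingleton.elim _ _)]
      congr 1
      · funext i
        change Sum.elim c (Sum.elim q (g ∘ b.symm)) (v.symm (w (w.symm i))) =
          Sum.elim c (Sum.elim q g) (eout.symm i)
        rw [Equiv.apply_symm_apply]
        change Sum.elim c (Sum.elim q (g ∘ b.symm)) (Sum.map id (Sum.map id b) (eout.symm i)) = _
        rcases eout.symm i with j | j | j <;> simp
      · funext i
        change Sum.elim x (Sum.elim q' fun _ => false) (Sum.map id (Sum.map id a) (ein.symm i)) =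
          Sum.elim x (Sum.elim q' fun _ => false) (ein.symm i)
        rcases ein.symm i with j | j | j <;> simp
    exact Finset.sum_congr rfl fun g _ => by rw [← hK]

end Kraus

/-! ### Copying classical wires -/

section Copy

variable {W : Type} [Fintype W] [DecidableEq W]

/-- The action of a CNOT gate on basis states. -/
def cnotMap (a b : W) (t : W → Bool) : W → Bool := Function.update t b (xor (t b) (t a))

theorem cnotMap_involutive {a b : W} (h : a ≠ b) : Function.Involutive (cnotMap a b) := fun t => by
  funext i
  by_cases hi : i = b
  · subst hi; simp [cnotMap, h]
  · simp [cnotMap, hi]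

theorem perm_unitary {α : Type} [Fintype α] [DecidableEq α] (π : Equiv.Perm α) :
    (Matrix.of fun s t => if s = π t then (1 : ℂ) else 0) ∈ Matrix.unitaryGroup α ℂ := by
  rw [mem_unitaryGroup_iff', star_eq_conjTranspose]
  ext s t
  simp only [mul_apply, conjTranspose_apply, of_apply, one_apply]
  simp [apply_ite star, eq_comm]

/-- The CNOT gate with control `a` and target `b`. -/
def cnotGate (a b : W) (h : a ≠ b) : Gate W where
  supp := {a, b}
  card_le := Finset.card_le_two.trans (by norm_num)
  unitary := ⟨_, perm_unitary (Function.Involutive.toPerm (cnotMap ⟨a, by simp⟩ ⟨b, by simp⟩)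
    (cnotMap_involutive (W := ({a, b} : Finset W)) (a := ⟨a, by simp⟩) (b := ⟨b, by simp⟩)
      fun h' => h (congrArg Subtype.val h')))⟩

theorem cnotGate_toOp (a b : W) (h : a ≠ b) :
    (cnotGate a b h).toOp = Matrix.of fun s t => if s = cnotMap a b t then 1 else 0 := by
  ext s t
  have key : s = cnotMap a b t ↔ (∀ i, i ∉ ({a, b} : Finset W) → s i = t i) ∧
      ({a, b} : Finset W).restrict s = cnotMap (W := ({a, b} : Finset W)) ⟨a, by simp⟩ ⟨b, by simp⟩
        (({a, b} : Finset W).restrict t) := by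
    refine ⟨fun h1 => ?_, fun ⟨h1, h2⟩ => ?_⟩
    · subst h1
      refine ⟨fun i hi => ?_, ?_⟩
      · have hib : i ≠ b := fun h' => hi (by simp [h'])
        simp [cnotMap, hib]
      · funext i
        simp only [Finset.restrict, cnotMap, Function.update_apply, Subtype.ext_iff]
    · funext i
      by_cases hi : i ∈ ({a, b} : Finset W)
      · have h3 := congrFun h2 ⟨i, hi⟩
        simp only [Finset.restrict, cnotMap, Function.update_apply, Subtype.mk.injEq] at h3 ⊢
        exact h3
      · have hib : i ≠ b := fun h' => hi (by simp [h'])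
        simp [cnotMap, hib, h1 i hi]
  simp only [of_apply, key, ite_and]
  rfl

variable {C A : Type} [Fintype C] [DecidableEq C] [Fintype A] [DecidableEq A]

/-- The gates that copy the wires `σ c` to `c`. -/
def copyGates (σ : C → W) (l : List C) : List (Gate (W ⊕ (C ⊕ A))) :=
  l.map fun c => cnotGate (Sum.inl (σ c)) (Sum.inr (Sum.inl c)) (by simp)

/-- The action of `copyGates` on basis states. -/
def copyMap (σ : C → W) (l : List C) (t : W ⊕ (C ⊕ A) → Bool) : W ⊕ (C ⊕ A) → Bool :=
  Sum.elim (fun w => t (Sum.inl w)) (Sum.elim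
    (fun c => xor (t (Sum.inr (Sum.inl c))) (decide (c ∈ l) && t (Sum.inl (σ c))))
    fun a => t (Sum.inr (Sum.inr a)))

theorem copyMap_cons (σ : C → W) {c : C} {l : List C} (hc : c ∉ l) (t : W ⊕ (C ⊕ A) → Bool) :
    copyMap σ l (cnotMap (Sum.inl (σ c)) (Sum.inr (Sum.inl c)) t) = copyMap σ (c :: l) t := by
  funext i
  rcases i with i | i | i
  · simp [copyMap, cnotMap]
  · by_cases hi : i = c
    · subst hi; simp [copyMap, cnotMap, hc]
    · simp [copyMap, cnotMap, hi]
  · simp [copyMap, cnotMap]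

theorem gatesOp_copyGates (σ : C → W) {l : List C} (hl : l.Nodup) :
    gatesOp (copyGates (A := A) σ l) = Matrix.of fun s t => if s = copyMap σ l t then 1 else 0 := by
  induction l with
  | nil =>
    ext s t
    have : copyMap (A := A) σ [] t = t := by
      funext i; rcases i with i | i | i <;> simp [copyMap]
    simp [copyGates, gatesOp, this, one_apply]
  | cons c l ih =>
    rw [List.nodup_cons] at hl
    ext s t
    change (gatesOp (copyGates (A := A) σ l) * _) s t = _
    rw [ih hl.2, cnotGate_toOp, mul_apply]
    simp only [of_apply, mul_ite, mul_one, mul_zero, Finset.sum_ite_eq', Finset.mem_univ, if_true,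
      copyMap_cons σ hl.1]

end Copy

/-! ### Instruments and their composition -/

theorem mul_mul_conjTranspose_apply {α β γ δ : Type} [Fintype β] [Fintype δ] (K : Matrix α β ℂ)
    (ρ : Matrix β δ ℂ) (L : Matrix γ δ ℂ) (s : α) (t : γ) :
    (K * ρ * Lᴴ) s t = ∑ j, (∑ i, K s i * ρ i j) * star (L t j) := by
  simp only [mul_apply, conjTranspose_apply]


/-- A map from a classical and a quantum input to the unnormalized states of a quantum output
for every value of a classical output. -/
abbrev Instrument (CI QI CO QO : Type) : Type := (CI → Bool) → Op QI → (CO → Bool) → Op QO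

section Instrument

variable {CI QI CO QO : Type} [Fintype CI] [DecidableEq CI] [Fintype QI] [DecidableEq QI]
  [Fintype CO] [DecidableEq CO] [Fintype QO] [DecidableEq QO]

/-- The instrument is implemented by a circuit with running time at most `t`. -/
def Realizable (t : ℕ) (T : Instrument CI QI CO QO) : Prop :=
  ∃ C : Circuit CI QI CO QO, C.time ≤ t ∧ ∀ x ρ c, C.run x ρ c = T x ρ c

theorem Circuit.realizable (C : Circuit CI QI CO QO) : Realizable C.time C.run :=
  ⟨C, le_rfl, fun _ _ _ => rfl⟩

theorem Realizable.mono {t t' : ℕ} {T : Instrument CI QI CO QO} (h : Realizable t T) (ht : t ≤ t') :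
    Realizable t' T := by
  obtain ⟨C, h1, h2⟩ := h; exact ⟨C, h1.trans ht, h2⟩

/-- The Kraus operators of a circuit. -/
def Circuit.kraus (C : Circuit CI QI CO QO) (x : CI → Bool) (c : CO → Bool)
    (g : Fin C.garbage → Bool) : Matrix (QO → Bool) (QI → Bool) ℂ :=
  wireKraus (gatesOp C.gates) (Equiv.refl _) C.layout.symm x c g

theorem Circuit.run_eq (C : Circuit CI QI CO QO) (x : CI → Bool) (ρ : Op QI) (c : CO → Bool) :
    C.run x ρ c = ∑ g, C.kraus x c g * ρ * (C.kraus x c g)ᴴ := C.run_eq_wireRun x ρ c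

theorem Circuit.sum_kraus (C : Circuit CI QI CO QO) (x : CI → Bool) :
    ∑ c, ∑ g, (C.kraus x c g)ᴴ * C.kraus x c g = 1 := sum_wireKraus _ (gatesOp_unitary _) _ _ x

theorem Circuit.run_sub (C : Circuit CI QI CO QO) (x : CI → Bool) (ρ σ : Op QI) (c : CO → Bool) :
    C.run x (ρ - σ) c = C.run x ρ c - C.run x σ c := by
  simp only [C.run_eq, Matrix.mul_sub, Matrix.sub_mul, Finset.sum_sub_distrib]

theorem Circuit.run_smul (C : Circuit CI QI CO QO) (x : CI → Bool) (r : ℂ) (ρ : Op QI)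
    (c : CO → Bool) : C.run x (r • ρ) c = r • C.run x ρ c := by
  simp only [C.run_eq, Matrix.mul_smul, Matrix.smul_mul, Finset.smul_sum]

theorem Circuit.run_real_smul (C : Circuit CI QI CO QO) (x : CI → Bool) (r : ℝ) (ρ : Op QI)
    (c : CO → Bool) : C.run x (r • ρ) c = r • C.run x ρ c := by
  simp only [C.run_eq, Matrix.mul_smul, Matrix.smul_mul, Finset.smul_sum]

theorem Circuit.run_zero (C : Circuit CI QI CO QO) (x : CI → Bool) (c : CO → Bool) :
    C.run x 0 c = 0 := by
  simp [C.run_eq]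

theorem Circuit.run_sum {α : Type} (C : Circuit CI QI CO QO) (x : CI → Bool) (s : Finset α)
    (ρ : α → Op QI) (c : CO → Bool) : C.run x (∑ i ∈ s, ρ i) c = ∑ i ∈ s, C.run x (ρ i) c := by
  simp only [C.run_eq, Matrix.mul_sum, Matrix.sum_mul]
  exact Finset.sum_comm

theorem Circuit.run_posSemidef (C : Circuit CI QI CO QO) (x : CI → Bool) {ρ : Op QI}
    (hρ : ρ.PosSemidef) (c : CO → Bool) : (C.run x ρ c).PosSemidef := by
  rw [C.run_eq]
  exact posSemidef_sum _ fun g _ => hρ.mul_mul_conjTranspose_same _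

theorem Circuit.run_isHermitian (C : Circuit CI QI CO QO) (x : CI → Bool) {ρ : Op QI}
    (hρ : ρ.IsHermitian) (c : CO → Bool) : (C.run x ρ c).IsHermitian := by
  rw [C.run_eq]
  exact isHermitian_sum _ fun g _ => isHermitian_mul_mul_conjTranspose _ hρ

theorem Circuit.sum_trace_run (C : Circuit CI QI CO QO) (x : CI → Bool) (ρ : Op QI) :
    ∑ c, (C.run x ρ c).trace = ρ.trace := by
  have : ∀ c, (C.run x ρ c).trace = ((∑ g, (C.kraus x c g)ᴴ * C.kraus x c g) * ρ).trace := fun c => by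
    rw [C.run_eq, trace_sum, Matrix.sum_mul, trace_sum]
    exact Finset.sum_congr rfl fun g _ => by rw [trace_mul_comm, Matrix.mul_assoc]
  rw [Finset.sum_congr rfl fun c _ => this c, ← trace_sum, ← Matrix.sum_mul, C.sum_kraus,
    Matrix.one_mul]

variable {M QM C2 Q2 CO2 QO2 QB : Type} [Fintype M] [DecidableEq M] [Fintype QM] [DecidableEq QM]
  [Fintype C2] [DecidableEq C2] [Fintype Q2] [DecidableEq Q2] [Fintype CO2] [DecidableEq CO2]
  [Fintype QO2] [DecidableEq QO2] [Fintype QB] [DecidableEq QB]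

/-- The block of `ρ` with the values `b`, `b'` of the wires `QB`. -/
def block (e : QM ≃ Q2 ⊕ QB) (ρ : Op QM) (b b' : QB → Bool) : Op Q2 :=
  ρ.submatrix (fun q => Sum.elim q b ∘ e) (fun q => Sum.elim q b' ∘ e)

/-- Run `T1`, keep its classical output, and apply `T2` to the wires `Q2` of its quantum output,
the classical input of `T2` being copied from the classical output of `T1`. -/
def callInstr (T1 : Instrument CI QI M QM) (T2 : Instrument C2 Q2 CO2 QO2) (sel : C2 → M)
    (e : QM ≃ Q2 ⊕ QB) : Instrument CI QI (M ⊕ CO2) (QO2 ⊕ QB) :=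
  fun x ρ c => Matrix.of fun s t =>
    T2 (fun i => c (Sum.inl (sel i)))
      (block e (T1 x ρ fun i => c (Sum.inl i)) (fun i => s (Sum.inr i)) (fun i => t (Sum.inr i)))
      (fun i => c (Sum.inr i)) (fun i => s (Sum.inl i)) (fun i => t (Sum.inl i))

/-- A permutation of direct sums. -/
def callShuffle (C2 Q2 A2 M QB G1 : Type) :
    (C2 ⊕ (Q2 ⊕ A2)) ⊕ (M ⊕ (QB ⊕ G1)) ≃ (M ⊕ ((Q2 ⊕ QB) ⊕ G1)) ⊕ (C2 ⊕ A2) where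
  toFun
    | Sum.inl (Sum.inl c) => Sum.inr (Sum.inl c)
    | Sum.inl (Sum.inr (Sum.inl q)) => Sum.inl (Sum.inr (Sum.inl (Sum.inl q)))
    | Sum.inl (Sum.inr (Sum.inr a)) => Sum.inr (Sum.inr a)
    | Sum.inr (Sum.inl m) => Sum.inl (Sum.inl m)
    | Sum.inr (Sum.inr (Sum.inl b)) => Sum.inl (Sum.inr (Sum.inl (Sum.inr b)))
    | Sum.inr (Sum.inr (Sum.inr g)) => Sum.inl (Sum.inr (Sum.inr g))
  invFun
    | Sum.inr (Sum.inl c) => Sum.inl (Sum.inl c)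
    | Sum.inl (Sum.inr (Sum.inl (Sum.inl q))) => Sum.inl (Sum.inr (Sum.inl q))
    | Sum.inr (Sum.inr a) => Sum.inl (Sum.inr (Sum.inr a))
    | Sum.inl (Sum.inl m) => Sum.inr (Sum.inl m)
    | Sum.inl (Sum.inr (Sum.inl (Sum.inr b))) => Sum.inr (Sum.inr (Sum.inl b))
    | Sum.inl (Sum.inr (Sum.inr g)) => Sum.inr (Sum.inr (Sum.inr g))
  left_inv := by rintro ((c | q | a) | (m | b | g)) <;> rfl
  right_inv := by rintro ((m | (q | b) | g) | (c | a)) <;> rfl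

/-- A permutation of direct sums. -/
def outShuffle (M CO2 QO2 QB G1 G2 : Type) :
    (M ⊕ CO2) ⊕ ((QO2 ⊕ QB) ⊕ (G1 ⊕ G2)) ≃ (CO2 ⊕ (QO2 ⊕ G2)) ⊕ (M ⊕ (QB ⊕ G1)) where
  toFun
    | Sum.inl (Sum.inl m) => Sum.inr (Sum.inl m)
    | Sum.inl (Sum.inr c) => Sum.inl (Sum.inl c)
    | Sum.inr (Sum.inl (Sum.inl q)) => Sum.inl (Sum.inr (Sum.inl q))
    | Sum.inr (Sum.inl (Sum.inr b)) => Sum.inr (Sum.inr (Sum.inl b))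
    | Sum.inr (Sum.inr (Sum.inl g)) => Sum.inr (Sum.inr (Sum.inr g))
    | Sum.inr (Sum.inr (Sum.inr g)) => Sum.inl (Sum.inr (Sum.inr g))
  invFun
    | Sum.inr (Sum.inl m) => Sum.inl (Sum.inl m)
    | Sum.inl (Sum.inl c) => Sum.inl (Sum.inr c)
    | Sum.inl (Sum.inr (Sum.inl q)) => Sum.inr (Sum.inl (Sum.inl q))
    | Sum.inr (Sum.inr (Sum.inl b)) => Sum.inr (Sum.inl (Sum.inr b))
    | Sum.inr (Sum.inr (Sum.inr g)) => Sum.inr (Sum.inr (Sum.inl g))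
    | Sum.inl (Sum.inr (Sum.inr g)) => Sum.inr (Sum.inr (Sum.inr g))
  left_inv := by rintro ((m | c) | ((q | b) | (g | g))) <;> rfl
  right_inv := by rintro ((c | q | g) | (m | b | g)) <;> rfl

section CallWires

variable {A1 A2 G1 G2 W1 W2 : Type} [Fintype A1] [DecidableEq A1] [Fintype A2] [DecidableEq A2]
  [Fintype G1] [DecidableEq G1] [Fintype G2] [DecidableEq G2] [Fintype W1] [DecidableEq W1]
  [Fintype W2] [DecidableEq W2]

/-- The wires of the second circuit inside those of the composed circuit. -/
def callInner (in2 : C2 ⊕ (Q2 ⊕ A2) ≃ W2) (out1 : M ⊕ (QM ⊕ G1) ≃ W1) (e : QM ≃ Q2 ⊕ QB) :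
    W2 ⊕ (M ⊕ (QB ⊕ G1)) ≃ W1 ⊕ (C2 ⊕ A2) :=
  ((Equiv.sumCongr in2.symm (Equiv.refl _)).trans (callShuffle C2 Q2 A2 M QB G1)).trans
    (Equiv.sumCongr ((Equiv.sumCongr (Equiv.refl _) (Equiv.sumCongr e.symm (Equiv.refl _))).trans out1)
      (Equiv.refl _))

/-- The input wires of the composed circuit. -/
def callIn (in1 : CI ⊕ (QI ⊕ A1) ≃ W1) (C2 A2 : Type) :
    CI ⊕ (QI ⊕ (A1 ⊕ (C2 ⊕ A2))) ≃ W1 ⊕ (C2 ⊕ A2) :=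
  ((Equiv.sumCongr (Equiv.refl _) (Equiv.sumAssoc QI A1 _).symm).trans
    (Equiv.sumAssoc CI (QI ⊕ A1) _).symm).trans (Equiv.sumCongr in1 (Equiv.refl _))

/-- The output wires of the composed circuit. -/
def callOut (in2 : C2 ⊕ (Q2 ⊕ A2) ≃ W2) (out1 : M ⊕ (QM ⊕ G1) ≃ W1) (e : QM ≃ Q2 ⊕ QB)
    (out2 : CO2 ⊕ (QO2 ⊕ G2) ≃ W2) :
    (M ⊕ CO2) ⊕ ((QO2 ⊕ QB) ⊕ (G1 ⊕ G2)) ≃ W1 ⊕ (C2 ⊕ A2) :=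
  ((outShuffle M CO2 QO2 QB G1 G2).trans (Equiv.sumCongr out2 (Equiv.refl _))).trans
    (callInner in2 out1 e)

/-- Deferred measurement. The classical wires `M` are copied by CNOTs to fresh inputs of the second
circuit and are not changed afterwards, so their final value fixes the copies; `QB` and the first
garbage are spectators. Of the sum over intermediate basis states only the one over `Q2` survives,
and this is a matrix product. -/
theorem wireKraus_call (in1 : CI ⊕ (QI ⊕ A1) ≃ W1) (out1 : M ⊕ (QM ⊕ G1) ≃ W1)
    (in2 : C2 ⊕ (Q2 ⊕ A2) ≃ W2) (out2 : CO2 ⊕ (QO2 ⊕ G2) ≃ W2) (sel : C2 → M)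
    (e : QM ≃ Q2 ⊕ QB) (gs1 : List (Gate W1)) (gs2 : List (Gate W2)) (x : CI → Bool)
    (c : M ⊕ CO2 → Bool) (g : G1 ⊕ G2 → Bool) (s : QO2 ⊕ QB → Bool) (q : QI → Bool) :
    wireKraus (gatesOp (gs1.map (Gate.lift (Equiv.refl _)) ++
        (copyGates (A := A2) (fun c => out1 (Sum.inl (sel c))) Finset.univ.toList ++
          gs2.map (Gate.lift (callInner in2 out1 e)))))
        (callIn in1 C2 A2) (callOut in2 out1 e out2) x c g s q =
      (wireKraus (gatesOp gs2) in2 out2 (fun i => c (Sum.inl (sel i)))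
        (fun i => c (Sum.inr i)) (fun i => g (Sum.inr i)) *
        (wireKraus (gatesOp gs1) in1 out1 x (fun i => c (Sum.inl i))
          (fun i => g (Sum.inl i))).submatrix (fun q => Sum.elim q (fun i => s (Sum.inr i)) ∘ e) id)
        (fun i => s (Sum.inl i)) q := by
  set m : M → Bool := fun i => c (Sum.inl i) with hm
  set b : QB → Bool := fun i => s (Sum.inr i) with hb
  set g1 : G1 → Bool := fun i => g (Sum.inl i) with hg1
  set out2s := joinBits out2 (fun i => c (Sum.inr i)) (fun i => s (Sum.inl i))
    (fun i => g (Sum.inr i)) with hout2s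
  set in1s := joinBits in1 x q fun _ => false with hin1s
  -- The row index as seen by the second circuit: its own output bits, and the spectators `M`, `QB`,
  -- `G1`.
  have hout : splitEquiv (callInner in2 out1 e) (joinBits (callOut in2 out1 e out2) c s g) =
      (out2s, Sum.elim m (Sum.elim b g1)) := by
    have h : ∀ y, joinBits (callOut in2 out1 e out2) c s g (callInner in2 out1 e y) =
        Sum.elim c (Sum.elim s g) ((outShuffle M CO2 QO2 QB G1 G2).symm
          (Sum.map out2.symm id y)) := fun y => by
      change Sum.elim c (Sum.elim s g) ((outShuffle M CO2 QO2 QB G1 G2).symm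
          (Sum.map out2.symm id ((callInner in2 out1 e).symm (callInner in2 out1 e y)))) = _
      rw [Equiv.symm_apply_apply]
    refine Prod.ext (funext fun i => ?_) (funext fun i => ?_)
    · rw [splitEquiv_fst, h]
      simp only [hout2s, joinBits, Function.comp_apply, Sum.map_inl]
      generalize out2.symm i = j
      rcases j with j | j | j <;> rfl
    · rw [splitEquiv_snd, h]
      rcases i with j | j | j <;> rfl
  have hin : splitEquiv (Equiv.refl _) (joinBits (callIn in1 C2 A2) x q fun _ => false) =
      (in1s, fun _ => false) := by
    have h : ∀ y, joinBits (callIn in1 C2 A2) x q (fun _ => false) y =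
        Sum.elim x (Sum.elim q fun _ => false) (Sum.map id (Equiv.sumAssoc QI A1 (C2 ⊕ A2))
          (Equiv.sumAssoc CI (QI ⊕ A1) _ (Sum.map in1.symm id y))) := fun y => rfl
    refine Prod.ext (funext fun i => ?_) (funext fun i => ?_)
    · rw [splitEquiv_fst, Equiv.refl_apply, h]
      simp only [hin1s, joinBits, Function.comp_apply, Sum.map_inl]
      generalize in1.symm i = j
      rcases j with j | j | j <;> rfl
    · rw [splitEquiv_snd]
      rfl
  -- An intermediate state as seen by the first circuit once the copying is undone. The fresh wires
  -- are zero exactly if `c2` is the copy of `m` and `a2` vanishes.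
  have hfin : ∀ (c2 : C2 → Bool) (q2 : Q2 → Bool) (a2 : A2 → Bool),
      splitEquiv (Equiv.refl _) (copyMap (fun c => out1 (Sum.inl (sel c))) Finset.univ.toList
        ((splitEquiv (callInner in2 out1 e)).symm (joinBits in2 c2 q2 a2,
          Sum.elim m (Sum.elim b g1)))) =
      (joinBits out1 m (Sum.elim q2 b ∘ e) g1,
        Sum.elim (fun i => xor (c2 i) (m (sel i))) a2) := by
    intro c2 q2 a2
    have h : ∀ y, (splitEquiv (callInner in2 out1 e)).symm (joinBits in2 c2 q2 a2,
          Sum.elim m (Sum.elim b g1)) y =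
        Sum.elim (joinBits in2 c2 q2 a2) (Sum.elim m (Sum.elim b g1))
          (Sum.map in2 id ((callShuffle C2 Q2 A2 M QB G1).symm
            (Sum.map (fun w => Sum.map id (Sum.map e id) (out1.symm w)) id y))) := fun y => rfl
    have hW : ∀ w, (splitEquiv (callInner in2 out1 e)).symm (joinBits in2 c2 q2 a2,
          Sum.elim m (Sum.elim b g1)) (Sum.inl w) = joinBits out1 m (Sum.elim q2 b ∘ e) g1 w :=
      fun w => by
        rw [h]
        simp only [joinBits, Function.comp_apply, Sum.map_inl]
        generalize out1.symm w = j
        rcases j with j | j | j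
        · rfl
        · simp only [Sum.map_inr, Sum.map_inl, Sum.elim_inr, Sum.elim_inl, Function.comp_apply]
          generalize e j = k
          rcases k with k | k
          · simp [callShuffle]
          · rfl
        · rfl
    refine Prod.ext (funext fun i => ?_) (funext fun i => ?_)
    · exact hW i
    · rcases i with i | i
      · simp only [splitEquiv_snd, Equiv.refl_apply, copyMap, Sum.elim_inr, Sum.elim_inl, hW,
          Finset.mem_toList, Finset.mem_univ, decide_true, Bool.true_and]
        congr 1
        · rw [h]; simp [callShuffle, joinBits]
        · simp [joinBits]
      · simp only [splitEquiv_snd, Equiv.refl_apply, copyMap, Sum.elim_inr]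
        rw [h]; simp [callShuffle, joinBits]
  have hinv : ∀ t, copyMap (A := A2) (fun c => out1 (Sum.inl (sel c))) Finset.univ.toList
      (copyMap (fun c => out1 (Sum.inl (sel c))) Finset.univ.toList t) = t := fun t => by
    funext i
    rcases i with i | i | i <;> simp [copyMap]
  have hC : ∀ (B : Op (W1 ⊕ (C2 ⊕ A2))) (v w : W1 ⊕ (C2 ⊕ A2) → Bool),
      (gatesOp (copyGates (A := A2) (fun c => out1 (Sum.inl (sel c))) Finset.univ.toList) * B) v w =
      B (copyMap (fun c => out1 (Sum.inl (sel c))) Finset.univ.toList v) w := fun B v w => by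
    rw [gatesOp_copyGates _ (Finset.nodup_toList _), mul_apply, Finset.sum_eq_single
      (copyMap (fun c => out1 (Sum.inl (sel c))) Finset.univ.toList v)]
    · rw [of_apply, hinv, if_pos rfl, one_mul]
    · intro t _ ht
      rw [of_apply, if_neg, zero_mul]
      rintro rfl
      exact ht (hinv t).symm
    · exact fun h => absurd (Finset.mem_univ _) h
  have hL : ∀ (r : M ⊕ (QB ⊕ G1) → Bool) (u : W2 → Bool),
      liftOp (callInner in2 out1 e) (gatesOp gs2) (joinBits (callOut in2 out1 e out2) c s g)
        ((splitEquiv (callInner in2 out1 e)).symm (u, r)) =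
      if r = Sum.elim m (Sum.elim b g1) then gatesOp gs2 out2s u else 0 := fun r u => by
    rw [liftOp, of_apply, Equiv.apply_symm_apply, hout]
    exact if_congr eq_comm rfl rfl
  rw [gatesOp_append, gatesOp_append, gatesOp_lift, gatesOp_lift]
  rw [wireKraus, of_apply, Matrix.mul_assoc, mul_apply,
    ← (splitEquiv (callInner in2 out1 e)).symm.sum_comp, Fintype.sum_prod_type]
  simp only [hL, hC, ite_mul, zero_mul, Finset.sum_ite_eq', Finset.mem_univ, if_true]
  rw [sum_joinBits in2]
  have hR : ∀ (c2 : C2 → Bool) (q2 : Q2 → Bool) (a2 : A2 → Bool),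
      liftOp (Equiv.refl _) (gatesOp gs1) (copyMap (fun c => out1 (Sum.inl (sel c)))
        Finset.univ.toList ((splitEquiv (callInner in2 out1 e)).symm (joinBits in2 c2 q2 a2,
          Sum.elim m (Sum.elim b g1)))) (joinBits (callIn in1 C2 A2) x q fun _ => false) =
      if (Sum.elim (fun i => xor (c2 i) (m (sel i))) a2 = fun _ => false) then
        gatesOp gs1 (joinBits out1 m (Sum.elim q2 b ∘ e) g1) in1s else 0 := fun c2 q2 a2 => by
    rw [liftOp, of_apply, hfin, hin]
  simp only [hR]
  have hz : ∀ (c2 : C2 → Bool) (a2 : A2 → Bool),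
      (Sum.elim (fun i => xor (c2 i) (m (sel i))) a2 = fun _ => false) ↔
        c2 = (fun i => m (sel i)) ∧ a2 = fun _ => false := fun c2 a2 => by
    simp only [funext_iff, Sum.forall, Sum.elim_inl, Sum.elim_inr, bne_eq_false_iff_eq]
  simp only [hz, ite_and, mul_ite, mul_zero]
  rw [Finset.sum_eq_single (fun i => m (sel i))]
  · rw [mul_apply]
    refine Finset.sum_congr rfl fun q2 _ => ?_
    simp only [if_true, Finset.sum_ite_eq', Finset.mem_univ]
    rfl
  · intro c2 _ hc2
    exact Finset.sum_eq_zero fun q2 _ => Finset.sum_eq_zero fun a2 _ => if_neg hc2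
  · exact fun h => absurd (Finset.mem_univ _) h

end CallWires

/-- Each classical input of the second circuit counts once as a wire and once as a CNOT gate; this
is the reason for the factor `2`. -/
theorem Realizable.call {t1 t2 : ℕ} {T1 : Instrument CI QI M QM} {T2 : Instrument C2 Q2 CO2 QO2}
    (h1 : Realizable t1 T1) (h2 : Realizable t2 T2) (sel : C2 → M) (e : QM ≃ Q2 ⊕ QB) :
    Realizable (t1 + 2 * t2) (callInstr T1 T2 sel e) := by
  obtain ⟨B1, ht1, hT1⟩ := h1
  obtain ⟨B2, ht2, hT2⟩ := h2
  obtain ⟨B, ht, hT⟩ := exists_circuit (callIn (Equiv.refl _) C2 (Fin B2.anc))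
    (callOut (Equiv.refl _) B1.layout.symm e B2.layout.symm)
    (B1.gates.map (Gate.lift (Equiv.refl _)) ++
      (copyGates (A := Fin B2.anc) (fun c => B1.layout.symm (Sum.inl (sel c))) Finset.univ.toList ++
        B2.gates.map (Gate.lift (callInner (Equiv.refl _) B1.layout.symm e))))
  refine ⟨B, ?_, fun x ρ c => ?_⟩
  · rw [ht]
    simp only [List.length_append, List.length_map, copyGates, Finset.length_toList,
      Finset.card_univ, Fintype.card_sum]
    simp only [Circuit.time, Fintype.card_sum] at ht1 ht2
    omega
  · rw [hT]
    ext s t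
    rw [wireRun, Matrix.sum_apply, callInstr, of_apply, ← hT2, B2.run_eq, Matrix.sum_apply]
    have hb : ∀ b b', block e (T1 x ρ fun i => c (Sum.inl i)) b b' =
        ∑ g1, (B1.kraus x (fun i => c (Sum.inl i)) g1).submatrix (fun q => Sum.elim q b ∘ e) id * ρ *
          ((B1.kraus x (fun i => c (Sum.inl i)) g1).submatrix (fun q => Sum.elim q b' ∘ e) id)ᴴ :=
      fun b b' => by
        rw [← hT1, B1.run_eq]
        ext q q'
        simp only [block, submatrix_apply, Matrix.sum_apply]
        refine Finset.sum_congr rfl fun g _ => ?_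
        simp only [mul_mul_conjTranspose_apply, submatrix_apply, id]
    rw [← (Equiv.sumArrowEquivProdArrow _ _ _).symm.sum_comp, Fintype.sum_prod_type, Finset.sum_comm]
    refine Finset.sum_congr rfl fun g2 _ => ?_
    rw [hb, Matrix.mul_sum, Matrix.sum_mul, Matrix.sum_apply]
    refine Finset.sum_congr rfl fun g1 _ => ?_
    have hL : ∀ (K2 : Matrix (QO2 → Bool) (Q2 → Bool) ℂ) (P Q : Matrix (Q2 → Bool) (QI → Bool) ℂ),
        K2 * (P * ρ * Qᴴ) * K2ᴴ = (K2 * P) * ρ * (K2 * Q)ᴴ := fun K2 P Q => by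
      simp only [conjTranspose_mul, Matrix.mul_assoc]
    rw [hL, mul_mul_conjTranspose_apply, mul_mul_conjTranspose_apply]
    simp only [wireKraus_call]
    rfl

end Instrument

/-! ### Discarding outputs, and moving classical data to and from qubits -/

section Instrument

variable {CI QI CO QO CO' QO' D : Type} [Fintype CI] [DecidableEq CI] [Fintype QI] [DecidableEq QI]
  [Fintype CO] [DecidableEq CO] [Fintype QO] [DecidableEq QO] [Fintype CO'] [DecidableEq CO']
  [Fintype QO'] [DecidableEq QO'] [Fintype D] [DecidableEq D]

theorem Realizable.congr {t : ℕ} {T T' : Instrument CI QI CO QO} (h : Realizable t T)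
    (hT : ∀ x ρ c, T x ρ c = T' x ρ c) : Realizable t T' := by
  obtain ⟨C, h1, h2⟩ := h; exact ⟨C, h1, fun x ρ c => (h2 x ρ c).trans (hT x ρ c)⟩

theorem Realizable.smul {t : ℕ} {T : Instrument CI QI CO QO} (h : Realizable t T) (x : CI → Bool)
    (r : ℂ) (ρ : Op QI) (c : CO → Bool) : T x (r • ρ) c = r • T x ρ c := by
  obtain ⟨C, -, h2⟩ := h; simp only [← h2, C.run_smul]

/-- A permutation of direct sums. -/
def discardCShuffle (CO' D QO G : Type) : CO' ⊕ (QO ⊕ (D ⊕ G)) ≃ (CO' ⊕ D) ⊕ (QO ⊕ G) where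
  toFun
    | Sum.inl c => Sum.inl (Sum.inl c)
    | Sum.inr (Sum.inl q) => Sum.inr (Sum.inl q)
    | Sum.inr (Sum.inr (Sum.inl d)) => Sum.inl (Sum.inr d)
    | Sum.inr (Sum.inr (Sum.inr g)) => Sum.inr (Sum.inr g)
  invFun
    | Sum.inl (Sum.inl c) => Sum.inl c
    | Sum.inr (Sum.inl q) => Sum.inr (Sum.inl q)
    | Sum.inl (Sum.inr d) => Sum.inr (Sum.inr (Sum.inl d))
    | Sum.inr (Sum.inr g) => Sum.inr (Sum.inr (Sum.inr g))
  left_inv := by rintro (c | q | d | g) <;> rfl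
  right_inv := by rintro ((c | d) | q | g) <;> rfl

/-- Discard a part of the classical output. -/
theorem Realizable.discardC {t : ℕ} {T : Instrument CI QI CO QO} (h : Realizable t T)
    (e : CO ≃ CO' ⊕ D) :
    Realizable t (fun x ρ c => ∑ d, T x ρ (Sum.elim c d ∘ e) : Instrument CI QI CO' QO) := by
  obtain ⟨B, ht, hT⟩ := h
  obtain ⟨C, hC, hr⟩ := exists_circuit (Equiv.refl _) (((discardCShuffle CO' D QO _).trans
    (Equiv.sumCongr e.symm (Equiv.refl _))).trans B.layout.symm) B.gates
  refine ⟨C, hC.le.trans ht, fun x ρ c => ?_⟩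
  rw [hr, wireRun, ← (Equiv.sumArrowEquivProdArrow _ _ _).symm.sum_comp, Fintype.sum_prod_type]
  refine Finset.sum_congr rfl fun d _ => ?_
  rw [← hT, B.run_eq]
  have hK : ∀ g, wireKraus (gatesOp B.gates) (Equiv.refl _) (((discardCShuffle CO' D QO _).trans
      (Equiv.sumCongr e.symm (Equiv.refl _))).trans B.layout.symm) x c
      ((Equiv.sumArrowEquivProdArrow _ _ _).symm (d, g)) = B.kraus x (Sum.elim c d ∘ e) g := fun g => by
    ext q q'
    simp only [wireKraus, Circuit.kraus, of_apply]
    congr 1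
    funext w
    change Sum.elim c (Sum.elim q (Sum.elim d g)) ((discardCShuffle CO' D QO _).symm
      (Sum.map e id (B.layout w))) = Sum.elim (Sum.elim c d ∘ e) (Sum.elim q g) (B.layout w)
    generalize B.layout w = k
    rcases k with k | k | k
    · simp only [Sum.map_inl, Sum.elim_inl, Function.comp_apply]
      rcases e k with j | j <;> rfl
    · rfl
    · rfl
  exact Finset.sum_congr rfl fun g _ => by rw [hK]

/-- A permutation of direct sums. -/
def discardQShuffle (CO QO' D G : Type) : CO ⊕ (QO' ⊕ (D ⊕ G)) ≃ CO ⊕ ((QO' ⊕ D) ⊕ G) :=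
  Equiv.sumCongr (Equiv.refl _) (Equiv.sumAssoc QO' D G).symm

/-- The partial trace over the wires `D`. -/
def ptrace (e : QO ≃ QO' ⊕ D) (ρ : Op QO) : Op QO' := ∑ d, block e ρ d d

/-- Discard a part of the quantum output. -/
theorem Realizable.discardQ {t : ℕ} {T : Instrument CI QI CO QO} (h : Realizable t T)
    (e : QO ≃ QO' ⊕ D) :
    Realizable t (fun x ρ c => ptrace e (T x ρ c) : Instrument CI QI CO QO') := by
  obtain ⟨B, ht, hT⟩ := h
  obtain ⟨C, hC, hr⟩ := exists_circuit (Equiv.refl _) (((discardQShuffle CO QO' D _).trans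
    (Equiv.sumCongr (Equiv.refl _) (Equiv.sumCongr e.symm (Equiv.refl _)))).trans B.layout.symm) B.gates
  refine ⟨C, hC.le.trans ht, fun x ρ c => ?_⟩
  rw [hr, wireRun, ← (Equiv.sumArrowEquivProdArrow _ _ _).symm.sum_comp, Fintype.sum_prod_type]
  change _ = ∑ d, block e (T x ρ c) d d
  refine Finset.sum_congr rfl fun d _ => ?_
  rw [← hT, B.run_eq]
  have hK : ∀ g, wireKraus (gatesOp B.gates) (Equiv.refl _) (((discardQShuffle CO QO' D _).trans
    (Equiv.sumCongr (Equiv.refl _) (Equiv.sumCongr e.symm (Equiv.refl _)))).trans B.layout.symm) x c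
      ((Equiv.sumArrowEquivProdArrow _ _ _).symm (d, g)) =
      (B.kraus x c g).submatrix (fun q => Sum.elim q d ∘ e) id := fun g => by
    ext q q'
    simp only [wireKraus, Circuit.kraus, of_apply, submatrix_apply, id]
    congr 1
    funext w
    change Sum.elim c (Sum.elim q (Sum.elim d g)) (Sum.map id (Equiv.sumAssoc QO' D _)
      (Sum.map id (Sum.map e id) (B.layout w))) =
        Sum.elim c (Sum.elim (Sum.elim q d ∘ e) g) (B.layout w)
    generalize B.layout w = k
    rcases k with k | k | k
    · rfl
    · simp only [Sum.map_inl, Sum.map_inr, Sum.elim_inl, Sum.elim_inr, Function.comp_apply]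
      rcases e k with j | j <;> rfl
    · rfl
  ext q q'
  simp only [block, Matrix.sum_apply, submatrix_apply]
  refine Finset.sum_congr rfl fun g _ => ?_
  rw [hK]
  simp only [mul_mul_conjTranspose_apply, submatrix_apply, id]

/-- Rename the wires of a quantum register. -/
def relabel (e : QO ≃ QO') (ρ : Op QO) : Op QO' := ρ.submatrix (· ∘ e) (· ∘ e)

theorem Realizable.relabelQ {t : ℕ} {T : Instrument CI QI CO QO} (h : Realizable t T)
    (e : QO ≃ QO') : Realizable t (fun x ρ c => relabel e (T x ρ c) : Instrument CI QI CO QO') := by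
  refine (h.discardQ (e.trans (Equiv.sumEmpty QO' Empty).symm)).congr fun x ρ c => ?_
  change ∑ d : Empty → Bool, block _ _ d d = _
  rw [Fintype.sum_unique]
  rfl

/-- The state `∑ k, |k⟩⟨k| ⊗ ρ k`. -/
def diagOp (ρ : (D → Bool) → Op QI) : Op (D ⊕ QI) :=
  Matrix.of fun s t => if (fun i => s (Sum.inl i)) = fun i => t (Sum.inl i) then
    ρ (fun i => s (Sum.inl i)) (fun i => s (Sum.inr i)) (fun i => t (Sum.inr i)) else 0

/-- Prepare the basis state given by the classical input. -/
def basisInstr (D : Type) [Fintype D] [DecidableEq D] : Instrument D Empty Empty D :=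
  fun x ρ _ => Matrix.of fun s t => if s = x ∧ t = x then ρ Empty.elim Empty.elim else 0

theorem realizable_basisInstr : Realizable (Fintype.card D) (basisInstr D) := by
  obtain ⟨C, hC, hr⟩ := exists_circuit (CI := D) (QI := Empty) (A := Empty) (CO := Empty) (QO := D)
    (G := Empty) (W := D) ((Equiv.sumCongr (Equiv.refl D) (Equiv.sumEmpty Empty Empty)).trans
      (Equiv.sumEmpty D Empty)) ((Equiv.emptySum Empty (D ⊕ Empty)).trans (Equiv.sumEmpty D Empty)) []
  refine ⟨C, by rw [hC]; simp, fun x ρ c => ?_⟩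
  rw [hr, wireRun, Fintype.sum_unique]
  ext s t
  rw [mul_mul_conjTranspose_apply, Fintype.sum_unique, Fintype.sum_unique]
  have hj : ∀ (s : D → Bool) (g : Empty → Bool), joinBits ((Equiv.emptySum Empty (D ⊕ Empty)).trans
    (Equiv.sumEmpty D Empty)) c s g = s := fun s g => by funext i; simp [joinBits]
  have hj' : ∀ q, joinBits (A := Empty) ((Equiv.sumCongr (Equiv.refl D) (Equiv.sumEmpty Empty Empty)).trans
      (Equiv.sumEmpty D Empty)) x q (fun _ => false) = x := fun s => by funext i; simp [joinBits]
  simp only [wireKraus, of_apply, gatesOp, one_apply, hj, hj', basisInstr]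
  have hρ : ∀ i j, ρ i j = ρ Empty.elim Empty.elim := fun i j => by
    rw [Subsingleton.elim i Empty.elim, Subsingleton.elim j Empty.elim]
  by_cases h1 : s = x <;> by_cases h2 : t = x <;> simp [h1, h2]
  exact hρ _ _

/-- Store a part of the classical output in a quantum register. -/
theorem Realizable.toQuantum {t : ℕ} {T : Instrument CI QI (CO' ⊕ D) QO} (h : Realizable t T) :
    Realizable (t + 2 * Fintype.card D)
      (fun x ρ c => diagOp fun k => T x ρ (Sum.elim c k) : Instrument CI QI CO' (D ⊕ QO)) := by
  refine ((h.call realizable_basisInstr Sum.inr (Equiv.emptySum Empty QO).symm).discardC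
    (Equiv.sumAssoc CO' D Empty)).congr fun x ρ c => ?_
  ext s t
  rw [Matrix.sum_apply, ← (Equiv.sumArrowEquivProdArrow _ _ _).symm.sum_comp, Fintype.sum_prod_type]
  simp only [Fintype.sum_unique, callInstr, basisInstr, of_apply, diagOp]
  have e1 : ∀ (d : D → Bool) (z : Empty → Bool), (fun i : CO' ⊕ D => (Sum.elim c ((Equiv.sumArrowEquivProdArrow D Empty
      Bool).symm (d, z)) ∘ Equiv.sumAssoc CO' D Empty) (Sum.inl i)) = Sum.elim c d := fun d z => by
    funext i; rcases i with i | i <;> rfl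
  have e2 : ∀ (d : D → Bool) (z : Empty → Bool), (fun i : D => (Sum.elim c ((Equiv.sumArrowEquivProdArrow D Empty
      Bool).symm (d, z)) ∘ Equiv.sumAssoc CO' D Empty) (Sum.inl (Sum.inr i))) = d := fun d z => rfl
  simp only [e1, e2]
  rw [Finset.sum_eq_single (fun i => s (Sum.inl i))]
  · by_cases hst : (fun i => s (Sum.inl i)) = fun i => t (Sum.inl i)
    · rw [if_pos ⟨rfl, hst.symm⟩, if_pos hst]
      rfl
    · rw [if_neg fun h => hst h.2.symm, if_neg hst]
  · intro d _ hd
    exact if_neg fun h => hd h.1.symm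
  · exact fun h => absurd (Finset.mem_univ _) h

/-- A permutation of direct sums. -/
def fromQuantumShuffle (CI D QI A : Type) : CI ⊕ ((D ⊕ QI) ⊕ A) ≃ (CI ⊕ D) ⊕ (QI ⊕ A) where
  toFun
    | Sum.inl c => Sum.inl (Sum.inl c)
    | Sum.inr (Sum.inl (Sum.inl d)) => Sum.inl (Sum.inr d)
    | Sum.inr (Sum.inl (Sum.inr q)) => Sum.inr (Sum.inl q)
    | Sum.inr (Sum.inr a) => Sum.inr (Sum.inr a)
  invFun
    | Sum.inl (Sum.inl c) => Sum.inl c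
    | Sum.inl (Sum.inr d) => Sum.inr (Sum.inl (Sum.inl d))
    | Sum.inr (Sum.inl q) => Sum.inr (Sum.inl (Sum.inr q))
    | Sum.inr (Sum.inr a) => Sum.inr (Sum.inr a)
  left_inv := by rintro (c | (d | q) | a) <;> rfl
  right_inv := by rintro ((c | d) | q | a) <;> rfl

/-- Read a part of the classical input from a quantum register. -/
theorem Realizable.fromQuantum {t : ℕ} {T : Instrument (CI ⊕ D) QI CO QO} (h : Realizable t T)
    (e : D ⊕ QI ≃ QO') :
    ∃ C : Circuit CI QO' CO QO, C.time ≤ t ∧ ∀ x (ρ : (D → Bool) → Op QI) c,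
      C.run x (relabel e (diagOp ρ)) c = ∑ k, T (Sum.elim x k) (ρ k) c := by
  obtain ⟨B, ht, hT⟩ := h
  obtain ⟨C, hC, hr⟩ := exists_circuit ((Equiv.sumCongr (Equiv.refl CI)
    (Equiv.sumCongr e.symm (Equiv.refl _))).trans (fromQuantumShuffle CI D QI (Fin B.anc)))
    B.layout.symm B.gates
  refine ⟨C, hC.le.trans ht, fun x ρ c => ?_⟩
  rw [hr, wireRun]
  simp only [← hT, B.run_eq]
  rw [Finset.sum_comm]
  refine Finset.sum_congr rfl fun g _ => ?_
  have hK : ∀ (s : QO → Bool) (k : D → Bool) (q : QI → Bool), wireKraus (gatesOp B.gates)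
      ((Equiv.sumCongr (Equiv.refl CI) (Equiv.sumCongr e.symm (Equiv.refl _))).trans
        (fromQuantumShuffle CI D QI (Fin B.anc))) B.layout.symm x c g s (Sum.elim k q ∘ e.symm) =
      B.kraus (Sum.elim x k) c g s q := fun s k q => by
    simp only [wireKraus, Circuit.kraus, of_apply]
    congr 1
    funext w
    rcases w with (w | w) | w | w <;> simp [joinBits, fromQuantumShuffle]
  ext s t
  rw [Matrix.sum_apply]
  simp only [mul_mul_conjTranspose_apply]
  have hsum : ∀ F : (QO' → Bool) → ℂ, ∑ s, F s = ∑ k : D → Bool, ∑ q : QI → Bool,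
      F (Sum.elim k q ∘ e.symm) := fun F => by
    rw [← (Equiv.arrowCongr e (Equiv.refl Bool)).sum_comp,
      ← (Equiv.sumArrowEquivProdArrow D QI Bool).symm.sum_comp, Fintype.sum_prod_type]
    rfl
  have hd : ∀ (k k' : D → Bool) (q q' : QI → Bool), relabel e (diagOp ρ) (Sum.elim k q ∘ e.symm)
      (Sum.elim k' q' ∘ e.symm) = if k = k' then ρ k q q' else 0 := fun k k' q q' => by
    simp [relabel, diagOp, Function.comp_assoc]
    rfl
  rw [hsum]
  simp only [hsum (fun i => _ * _), hK, hd]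
  refine Finset.sum_congr rfl fun k _ => Finset.sum_congr rfl fun q _ => ?_
  congr 1
  rw [Finset.sum_eq_single k]
  · simp
  · intro k' _ hk'
    simp [hk']
  · exact fun h => absurd (Finset.mem_univ _) h

variable {M QM C2 N : Type} [Fintype M] [DecidableEq M] [Fintype QM] [DecidableEq QM]
  [Fintype C2] [DecidableEq C2] [Fintype N] [DecidableEq N]

/-- Apply a classical randomized function to copied wires of the classical output. -/
theorem Realizable.stepClassical {t1 t2 : ℕ} {T1 : Instrument CI QI M QM}
    {T2 : Instrument C2 Empty N Empty} (h1 : Realizable t1 T1) (h2 : Realizable t2 T2) (sel : C2 → M) :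
    Realizable (t1 + 2 * t2) (fun x ρ c =>
      (T2 (fun i => c (Sum.inl (sel i))) 1 (fun i => c (Sum.inr i)) Empty.elim Empty.elim) •
        T1 x ρ (fun i => c (Sum.inl i)) : Instrument CI QI (M ⊕ N) QM) := by
  refine ((h1.call h2 sel (Equiv.emptySum Empty QM).symm).relabelQ (Equiv.emptySum Empty QM)).congr
    fun x ρ c => ?_
  ext s t
  simp only [relabel, callInstr, submatrix_apply, of_apply, Matrix.smul_apply]
  have e1 : ∀ A : Op Empty, A = (A Empty.elim Empty.elim) • (1 : Op Empty) := fun A => by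
    ext i j
    rw [Subsingleton.elim i Empty.elim, Subsingleton.elim j Empty.elim]
    simp
  rw [e1 (block _ _ _ _), h2.smul, Matrix.smul_apply, smul_eq_mul, smul_eq_mul, mul_comm]
  congr 1
  congr 1 <;> exact Subsingleton.elim _ _

end Instrument

/-! ### Parallel gates -/

section Parallel

variable {ι W : Type} [Fintype ι] [DecidableEq ι] [Fintype W] [DecidableEq W]

/-- A unitary on all wires as a gate. -/
def fullGate (hW : Fintype.card W ≤ 3) (u : Matrix.unitaryGroup (W → Bool) ℂ) : Gate W where
  supp := Finset.univ
  card_le := hW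
  unitary := ⟨_, submatrix_mem_unitaryGroup
    (Equiv.arrowCongr (Equiv.subtypeUnivEquiv Finset.mem_univ) (Equiv.refl Bool)) u⟩

theorem fullGate_toOp (hW : Fintype.card W ≤ 3) (u : Matrix.unitaryGroup (W → Bool) ℂ) :
    (fullGate hW u).toOp = (u : Op W) := by
  ext s t
  have h : ∀ i, i ∉ (fullGate hW u).supp → s i = t i := fun i hi => absurd (Finset.mem_univ i) hi
  rw [Gate.toOp, of_apply, if_pos h]
  rfl

/-- The wires `{i} × W` among `ι × W`. -/
def parEquiv (i : ι) : W ⊕ ({j // j ≠ i} × W) ≃ ι × W where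
  toFun := Sum.elim (fun w => (i, w)) fun p => (p.1.1, p.2)
  invFun p := if h : p.1 = i then Sum.inl p.2 else Sum.inr (⟨p.1, h⟩, p.2)
  left_inv := by
    rintro (w | ⟨⟨j, hj⟩, w⟩)
    · simp
    · simp [hj]
  right_inv := by
    rintro ⟨j, w⟩
    by_cases h : j = i <;> simp [h]

/-- The gates `u i` on the wires `{i} × W`. -/
def parGates (hW : Fintype.card W ≤ 3) (u : ι → Matrix.unitaryGroup (W → Bool) ℂ) (l : List ι) :
    List (Gate (ι × W)) :=
  l.map fun i => (fullGate hW (u i)).lift (parEquiv i)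

/-- Gates on different blocks act on disjoint wires, so the matrix entry factorizes; blocks not in
the list have to agree. Induction on the list. -/
theorem gatesOp_parGates (hW : Fintype.card W ≤ 3) (u : ι → Matrix.unitaryGroup (W → Bool) ℂ)
    {l : List ι} (hl : l.Nodup) (s t : ι × W → Bool) :
    gatesOp (parGates hW u l) s t = if ∀ j, j ∉ l → ∀ w, s (j, w) = t (j, w) then
      (l.map fun i => (u i : Op W) (fun w => s (i, w)) (fun w => t (i, w))).prod else 0 := by
  induction l generalizing s t with
  | nil =>
    simp only [parGates, List.map_nil, gatesOp, one_apply, List.prod_nil]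
    refine if_congr ?_ rfl rfl
    simp [funext_iff]
  | cons i l ih =>
    rw [List.nodup_cons] at hl
    change (gatesOp (parGates hW u l) * ((fullGate hW (u i)).lift (parEquiv i)).toOp) s t = _
    rw [Gate.lift_toOp, fullGate_toOp, mul_apply, ← (splitEquiv (parEquiv i)).symm.sum_comp,
      Fintype.sum_prod_type]
    simp only [liftOp, of_apply, Equiv.apply_symm_apply, mul_ite, mul_zero, Finset.sum_ite_eq',
      Finset.mem_univ, if_true]
    set r := (splitEquiv (parEquiv i) t).2 with hr
    have hvi : ∀ a w, (splitEquiv (parEquiv i)).symm (a, r) (i, w) = a w := fun a w => by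
      have := congrFun (congrArg Prod.fst ((splitEquiv (parEquiv i)).apply_symm_apply (a, r))) w
      exact this
    have hvj : ∀ a j w, j ≠ i → (splitEquiv (parEquiv i)).symm (a, r) (j, w) = t (j, w) :=
      fun a j w hj => congrFun (congrArg Prod.snd
        ((splitEquiv (parEquiv i)).apply_symm_apply (a, r))) (⟨j, hj⟩, w)
    have hprod : ∀ a, (l.map fun j => (u j : Op W) (fun w => s (j, w))
        (fun w => (splitEquiv (parEquiv i)).symm (a, r) (j, w))).prod =
        (l.map fun j => (u j : Op W) (fun w => s (j, w)) (fun w => t (j, w))).prod := fun a => by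
      congr 1
      refine List.map_congr_left fun j hj => ?_
      have hji : j ≠ i := fun h => hl.1 (h ▸ hj)
      simp only [hvj a j _ hji]
    have hcond : ∀ a, (∀ j, j ∉ l → ∀ w, s (j, w) = (splitEquiv (parEquiv i)).symm (a, r) (j, w)) ↔
        (a = fun w => s (i, w)) ∧ ∀ j, j ∉ i :: l → ∀ w, s (j, w) = t (j, w) := fun a => by
      constructor
      · refine fun h => ⟨funext fun w => ?_, fun j hj w => ?_⟩
        · rw [h i hl.1 w, hvi]
        · rw [List.mem_cons, not_or] at hj
          rw [h j hj.2 w, hvj a j w hj.1]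
      · rintro ⟨rfl, h⟩ j hj w
        by_cases hji : j = i
        · subst hji; rw [hvi]
        · rw [hvj _ j w hji]; exact h j (by simp [hji, hj]) w
    simp only [ih hl.2, hprod, hcond, ite_and, ite_mul, zero_mul, Finset.sum_ite_eq',
      Finset.mem_univ, if_true, List.map_cons, List.prod_cons]
    split_ifs
    · rw [mul_comm]; rfl
    · rfl

theorem gatesOp_parGates_univ (hW : Fintype.card W ≤ 3)
    (u : ι → Matrix.unitaryGroup (W → Bool) ℂ) (s t : ι × W → Bool) :
    gatesOp (parGates hW u Finset.univ.toList) s t =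
      ∏ i, (u i : Op W) (fun w => s (i, w)) (fun w => t (i, w)) := by
  rw [gatesOp_parGates hW u (Finset.nodup_toList _), if_pos (by simp), Finset.prod_map_toList]

theorem gatesOp_parGates_perm (hW : Fintype.card W ≤ 3) (π : ι → Equiv.Perm (W → Bool))
    (s t : ι × W → Bool) :
    gatesOp (parGates hW (fun i => ⟨_, perm_unitary (π i)⟩) Finset.univ.toList) s t =
      if ∀ i, (fun w => s (i, w)) = π i (fun w => t (i, w)) then 1 else 0 := by
  rw [gatesOp_parGates_univ]
  simp only [of_apply]
  rw [Finset.prod_ite_zero]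
  simp

variable {CI QI CO QO A G : Type} [Fintype CI] [DecidableEq CI] [Fintype QI] [DecidableEq QI]
  [Fintype CO] [DecidableEq CO] [Fintype QO] [DecidableEq QO]
  [Fintype A] [DecidableEq A] [Fintype G] [DecidableEq G]

/-- At most three wires and one gate per block. -/
theorem realizable_parallel (hW : Fintype.card W ≤ 3) (u : ι → Matrix.unitaryGroup (W → Bool) ℂ)
    (ein : CI ⊕ (QI ⊕ A) ≃ ι × W) (eout : CO ⊕ (QO ⊕ G) ≃ ι × W) :
    Realizable (4 * Fintype.card ι)
      (wireRun (gatesOp (parGates hW u Finset.univ.toList)) ein eout) := by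
  obtain ⟨C, hC, hr⟩ := exists_circuit ein eout (parGates hW u Finset.univ.toList)
  refine ⟨C, ?_, hr⟩
  rw [hC, Fintype.card_prod, parGates, List.length_map, Finset.length_toList, Finset.card_univ]
  nlinarith [Nat.zero_le (Fintype.card ι)]

end Parallel

/-! ### Classical layers -/

section Classical

variable {ι : Type} [Fintype ι] [DecidableEq ι]

/-- Input wires of a layer of gates with two inputs. -/
def bitIn (ι : Type) : (ι ⊕ ι) ⊕ (Empty ⊕ ι) ≃ ι × Fin 3 where
  toFun
    | Sum.inl (Sum.inl i) => (i, 0)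
    | Sum.inl (Sum.inr i) => (i, 1)
    | Sum.inr (Sum.inr i) => (i, 2)
  invFun
    | (i, 0) => Sum.inl (Sum.inl i)
    | (i, 1) => Sum.inl (Sum.inr i)
    | (i, 2) => Sum.inr (Sum.inr i)
  left_inv := by rintro ((i | i) | (i | i)) <;> first | rfl | exact i.elim
  right_inv := by rintro ⟨i, k⟩; fin_cases k <;> rfl

/-- Output wires of a layer of gates with two inputs. -/
def bitOut (ι : Type) : ι ⊕ (Empty ⊕ (ι ⊕ ι)) ≃ ι × Fin 3 where
  toFun
    | Sum.inr (Sum.inr (Sum.inl i)) => (i, 0)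
    | Sum.inr (Sum.inr (Sum.inr i)) => (i, 1)
    | Sum.inl i => (i, 2)
  invFun
    | (i, 0) => Sum.inr (Sum.inr (Sum.inl i))
    | (i, 1) => Sum.inr (Sum.inr (Sum.inr i))
    | (i, 2) => Sum.inl i
  left_inv := by rintro (i | i | i | i) <;> first | rfl | exact i.elim
  right_inv := by rintro ⟨i, k⟩; fin_cases k <;> rfl

/-- The permutation of basis states that adds `g (s 0) (s 1)` to `s 2`. -/
def bitPerm (g : Bool → Bool → Bool) : Equiv.Perm (Fin 3 → Bool) :=
  Function.Involutive.toPerm (fun s => Function.update s 2 (xor (s 2) (g (s 0) (s 1)))) fun s => by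
    funext k; fin_cases k <;> simp

theorem bitPerm_zero (g : Bool → Bool → Bool) (s : Fin 3 → Bool) : bitPerm g s 0 = s 0 := rfl

theorem bitPerm_one (g : Bool → Bool → Bool) (s : Fin 3 → Bool) : bitPerm g s 1 = s 1 := rfl

theorem bitPerm_two (g : Bool → Bool → Bool) (s : Fin 3 → Bool) :
    bitPerm g s 2 = xor (s 2) (g (s 0) (s 1)) := rfl

/-- The instrument that evaluates a function. -/
def detInstr {CI CO : Type} [Fintype CO] [DecidableEq CO] (f : (CI → Bool) → CO → Bool) :
    Instrument CI Empty CO Empty :=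
  fun x ρ c => if c = f x then ρ else 0

/-- One reversible gate per position: the value is added to a fresh third wire, and the two inputs
become garbage. -/
theorem realizable_bitwise (g : ι → Bool → Bool → Bool) :
    Realizable (4 * Fintype.card ι)
      (detInstr fun (x : ι ⊕ ι → Bool) i => g i (x (Sum.inl i)) (x (Sum.inr i))) := by
  refine (realizable_parallel (by simp) (fun i => ⟨_, perm_unitary (bitPerm (g i))⟩)
    (bitIn ι) (bitOut ι)).congr fun x ρ c => ?_
  ext s t
  rw [wireRun, Matrix.sum_apply]
  simp only [mul_mul_conjTranspose_apply, Fintype.sum_unique, wireKraus, of_apply,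
    gatesOp_parGates_perm]
  have hc : ∀ (r : ι ⊕ ι → Bool) (q q' : Empty → Bool), (∀ i, (fun w => joinBits (bitOut ι) c q r (i, w)) =
      bitPerm (g i) (fun w => joinBits (bitIn ι) x q' (fun _ => false) (i, w))) ↔
      r = x ∧ c = fun i => g i (x (Sum.inl i)) (x (Sum.inr i)) := fun r q q' => by
    have h0 : ∀ i, joinBits (bitOut ι) c q r (i, 0) = r (Sum.inl i) := fun i => rfl
    have h1 : ∀ i, joinBits (bitOut ι) c q r (i, 1) = r (Sum.inr i) := fun i => rfl
    have h2 : ∀ i, joinBits (bitOut ι) c q r (i, 2) = c i := fun i => rfl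
    have k0 : ∀ i, joinBits (bitIn ι) x q' (fun _ => false) (i, 0) = x (Sum.inl i) := fun i => rfl
    have k1 : ∀ i, joinBits (bitIn ι) x q' (fun _ => false) (i, 1) = x (Sum.inr i) := fun i => rfl
    have k2 : ∀ i, joinBits (bitIn ι) x q' (fun _ => false) (i, 2) = false := fun i => rfl
    simp only [funext_iff, Fin.forall_fin_succ, Sum.forall, IsEmpty.forall_iff]
    simp [bitPerm_zero, bitPerm_one, bitPerm_two, h0, h1, h2, k0, k1, k2, forall_and, and_assoc]
  simp only [hc, ite_and, detInstr]
  by_cases hcx : c = fun i => g i (x (Sum.inl i)) (x (Sum.inr i))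
  · simp only [if_pos hcx]
    rw [Finset.sum_eq_single x]
    · simp
      congr 1 <;> exact Subsingleton.elim _ _
    · intro r _ hr; simp [hr]
    · exact fun h => absurd (Finset.mem_univ _) h
  · simp [if_neg hcx]

variable {CI CO C2 CO2 : Type} [Fintype CI] [DecidableEq CI] [Fintype CO] [DecidableEq CO]
  [Fintype C2] [DecidableEq C2] [Fintype CO2] [DecidableEq CO2]

theorem realizable_det_id : Realizable (Fintype.card CI) (detInstr fun x : CI → Bool => x) := by
  obtain ⟨C, hC, hr⟩ := exists_circuit (CI := CI) (QI := Empty) (A := Empty) (CO := CI) (QO := Empty)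
    (G := Empty) (W := CI) ((Equiv.sumCongr (Equiv.refl CI) (Equiv.sumEmpty Empty Empty)).trans
      (Equiv.sumEmpty CI Empty)) ((Equiv.sumCongr (Equiv.refl CI) (Equiv.sumEmpty Empty Empty)).trans
      (Equiv.sumEmpty CI Empty)) []
  refine ⟨C, by rw [hC]; simp, fun x ρ c => ?_⟩
  rw [hr, wireRun, Fintype.sum_unique]
  ext s t
  rw [mul_mul_conjTranspose_apply, Fintype.sum_unique, Fintype.sum_unique]
  have hj : ∀ (x : CI → Bool) (s g : Empty → Bool), joinBits ((Equiv.sumCongr (Equiv.refl CI)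
    (Equiv.sumEmpty Empty Empty)).trans (Equiv.sumEmpty CI Empty)) x s g = x :=
      fun x s g => by funext i; simp [joinBits]
  simp only [wireKraus, of_apply, gatesOp, one_apply, hj, detInstr]
  by_cases h1 : c = x
  · simp only [if_pos h1, one_mul, star_one, mul_one]
    congr 1 <;> exact Subsingleton.elim _ _
  · simp [h1]

theorem Realizable.detComp {t1 t2 : ℕ} {f : (CI → Bool) → CO → Bool} {g : (C2 → Bool) → CO2 → Bool}
    (h1 : Realizable t1 (detInstr f)) (h2 : Realizable t2 (detInstr g)) (sel : C2 → CO) :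
    Realizable (t1 + 2 * t2) (detInstr fun x => g fun i => f x (sel i)) := by
  refine ((h1.stepClassical h2 sel).discardC (Equiv.sumComm CO CO2)).congr fun x ρ c => ?_
  have e1 : ∀ d : CO → Bool, (fun i => (Sum.elim c d ∘ Equiv.sumComm CO CO2) (Sum.inl i)) = d :=
    fun d => rfl
  have e2 : ∀ d : CO → Bool, (fun i => (Sum.elim c d ∘ Equiv.sumComm CO CO2) (Sum.inr i)) = c :=
    fun d => rfl
  have e3 : ∀ d : CO → Bool, (fun i => (Sum.elim c d ∘ Equiv.sumComm CO CO2) (Sum.inl (sel i))) =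
    fun i => d (sel i) := fun d => rfl
  simp only [e1, e2, e3, detInstr]
  rw [Finset.sum_eq_single (f x)]
  · rw [if_pos rfl]
    split_ifs <;> simp
  · intro d _ hd; rw [if_neg hd, smul_zero]
  · exact fun h => absurd (Finset.mem_univ _) h

/-- Apply a layer of gates to the result of a function. -/
theorem Realizable.layer {t : ℕ} {f : (CI → Bool) → CO → Bool} (h : Realizable t (detInstr f))
    (a b : ι → CO) (g : ι → Bool → Bool → Bool) :
    Realizable (t + 8 * Fintype.card ι) (detInstr fun x i => g i (f x (a i)) (f x (b i))) :=
  (h.detComp (realizable_bitwise g) (Sum.elim a b)).mono (by omega)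

end Classical

/-! ### Preparation of random bits and of BB84 states -/

section Prepare

/-- Gates are arbitrary unitaries, so any unit vector on at most three qubits is prepared from `|0⟩`
by a single gate: it is extended to an orthonormal basis. -/
theorem exists_unitary_col {α : Type} [Fintype α] [DecidableEq α] (v : α → ℂ)
    (hv : ∑ i, ‖v i‖ ^ 2 = 1) (i0 : α) :
    ∃ U : Matrix.unitaryGroup α ℂ, ∀ i, (U : Matrix α α ℂ) i i0 = v i := by
  -- Only the value at `i0` is used, where a single unit vector is an orthonormal family.
  let w : α → EuclideanSpace ℂ α := fun _ => WithLp.toLp 2 v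
  have hw : Orthonormal ℂ (Set.domRestrict {i0} w) := by
    constructor
    · intro i
      have : ‖w i‖ ^ 2 = 1 := by rw [EuclideanSpace.norm_sq_eq]; exact hv
      exact (pow_eq_one_iff_of_nonneg (norm_nonneg _) two_ne_zero).1 this
    · intro i j hij
      exact absurd (Subtype.ext (i.2.trans j.2.symm)) hij
  obtain ⟨b, hb⟩ := hw.exists_orthonormalBasis_extension_of_card_eq (by simp)
  refine ⟨⟨(EuclideanSpace.basisFun α ℂ).toBasis.toMatrix b.toBasis, ?_⟩, fun i => ?_⟩
  · exact (EuclideanSpace.basisFun α ℂ).toMatrix_orthonormalBasis_mem_unitary b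
  · have : b i0 = w i0 := hb i0 rfl
    simp [Module.Basis.toMatrix_apply, this, w]

variable {ι : Type} [Fintype ι] [DecidableEq ι]

/-- Uniformly random bits. -/
theorem realizable_randomBits : Realizable (4 * Fintype.card ι)
    (fun _ ρ _ => ((1 / 2 : ℝ) ^ Fintype.card ι) • ρ : Instrument Empty Empty ι Empty) := by
  obtain ⟨U, hU⟩ := exists_unitary_col (α := Unit → Bool) (fun _ => ((√2)⁻¹ : ℝ))
    (by simp) (fun _ => false)
  let e : ι ≃ ι × Unit := (Equiv.prodPUnit ι).symm
  refine (realizable_parallel (CI := Empty) (QI := Empty) (A := ι) (CO := ι) (QO := Empty)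
    (G := Empty) (by simp) (fun _ => U)
    (((Equiv.emptySum Empty _).trans (Equiv.emptySum Empty _)).trans e)
    (((Equiv.sumCongr (Equiv.refl ι) (Equiv.sumEmpty Empty Empty)).trans
      (Equiv.sumEmpty ι Empty)).trans e)).congr fun x ρ c => ?_
  ext s t
  rw [wireRun, Fintype.sum_unique, mul_mul_conjTranspose_apply, Fintype.sum_unique,
    Fintype.sum_unique]
  have hin : ∀ (x q : Empty → Bool) (i : ι), (fun w => joinBits (((Equiv.emptySum Empty _).trans
    (Equiv.emptySum Empty _)).trans e) x q (fun _ => false) (i, w)) = fun _ => false :=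
      fun x q i => by funext w; simp [joinBits]
  simp only [wireKraus, of_apply, gatesOp_parGates_univ, hin, hU, Finset.prod_const,
    Finset.card_univ, Matrix.smul_apply, Complex.real_smul]
  rw [Subsingleton.elim s default, Subsingleton.elim t default]
  rw [← Complex.ofReal_pow, Complex.star_def, Complex.conj_ofReal]
  have : ((√2)⁻¹ ^ Fintype.card ι * (√2)⁻¹ ^ Fintype.card ι : ℝ) = (1 / 2) ^ Fintype.card ι := by
    rw [← mul_pow, ← mul_inv, Real.mul_self_sqrt (by norm_num), one_div]
  rw [← this]; push_cast
  have key : ∀ a a' b : ℂ, a' = a → b * a' * b = b * b * a := by rintro a _ b rfl; ring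
  exact key _ _ _ (congrArg₂ ρ (Subsingleton.elim _ _) (Subsingleton.elim _ _))

/-- Output wires of the preparation of BB84 states. -/
def bb84Out (ι : Type) : (ι ⊕ ι) ⊕ (ι ⊕ Empty) ≃ ι × Fin 3 where
  toFun
    | Sum.inl (Sum.inl i) => (i, 0)
    | Sum.inl (Sum.inr i) => (i, 1)
    | Sum.inr (Sum.inl i) => (i, 2)
  invFun
    | (i, 0) => Sum.inl (Sum.inl i)
    | (i, 1) => Sum.inl (Sum.inr i)
    | (i, 2) => Sum.inr (Sum.inl i)
  left_inv := by rintro ((i | i) | (i | i)) <;> first | rfl | exact i.elim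
  right_inv := by rintro ⟨i, k⟩; fin_cases k <;> rfl

/-- Normalization of the three-qubit vector `½ ∑ |b⟩ |t⟩ |b⟩_t`. Measuring its first two qubits
yields a uniform bit and basis and leaves the encoded qubit, so one gate per position performs
Alice's preparation. -/
theorem sum_norm_bb84Qubit :
    ∑ s : Fin 3 → Bool, ‖(1 / 2 : ℂ) * bb84Qubit (s 1) (s 0) (s 2)‖ ^ 2 = 1 := by
  have hu : (Finset.univ : Finset (Fin 3 → Bool)) = {![false, false, false], ![false, false, true],
      ![false, true, false], ![false, true, true], ![true, false, false], ![true, false, true],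
      ![true, true, false], ![true, true, true]} := by decide
  rw [hu]
  repeat rw [Finset.sum_insert (by decide)]
  rw [Finset.sum_singleton]
  have h : ((1 / 2 * |√2|⁻¹) ^ 2 : ℝ) = 1 / 8 := by
    rw [mul_pow, inv_pow, sq_abs, Real.sq_sqrt (by norm_num)]; norm_num
  simp [bb84Qubit]
  norm_num at h ⊢
  linarith

/-- Preparation of random BB84 states. -/
theorem realizable_bb84 (n : ℕ) : Realizable (4 * n)
    (fun _ ρ c => Matrix.of fun s t => ((1 / 2 : ℝ) ^ n * (1 / 2 : ℝ) ^ n) •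
      (bb84Ket (fun i => c (Sum.inl i)) (fun i => c (Sum.inr i)) s *
        star (bb84Ket (fun i => c (Sum.inl i)) (fun i => c (Sum.inr i)) t) *
          ρ Empty.elim Empty.elim) : Instrument Empty Empty (Fin n ⊕ Fin n) (Fin n)) := by
  obtain ⟨U, hU⟩ := exists_unitary_col _ sum_norm_bb84Qubit (fun _ => false)
  refine ((realizable_parallel (ι := Fin n) (CI := Empty) (QI := Empty) (A := Fin n × Fin 3)
    (by simp) (fun _ => U) ((Equiv.emptySum Empty _).trans (Equiv.emptySum Empty _))
    (bb84Out (Fin n))).mono (by simp)).congr fun x ρ c => ?_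
  ext s t
  rw [wireRun, Fintype.sum_unique, mul_mul_conjTranspose_apply, Fintype.sum_unique,
    Fintype.sum_unique]
  have hin : ∀ (x q : Empty → Bool) (i : Fin n), (fun w : Fin 3 => joinBits ((Equiv.emptySum Empty
    (Empty ⊕ Fin n × Fin 3)).trans (Equiv.emptySum Empty _)) x q (fun _ => false) (i, w)) =
      fun _ => false := fun x q i => by funext w; simp [joinBits]
  have h0 : ∀ s g i, joinBits (bb84Out (Fin n)) c s g (i, 0) = c (Sum.inl i) := fun _ _ i => rfl
  have h1 : ∀ s g i, joinBits (bb84Out (Fin n)) c s g (i, 1) = c (Sum.inr i) := fun _ _ i => rfl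
  have h2 : ∀ s g i, joinBits (bb84Out (Fin n)) c s g (i, 2) = s i := fun _ _ i => rfl
  simp only [wireKraus, of_apply, gatesOp_parGates_univ, hin, hU, h0, h1, h2,
    Finset.prod_mul_distrib, Finset.prod_const, Finset.card_univ, Fintype.card_fin]
  have hρ : ∀ i j, ρ i j = ρ Empty.elim Empty.elim := fun i j => by
    rw [Subsingleton.elim i Empty.elim, Subsingleton.elim j Empty.elim]
  have key : ∀ a a' : ℂ, a' = a → ((1 / 2) ^ n * ∏ x, bb84Qubit (c (Sum.inr x)) (c (Sum.inl x)) (s x)) * a' *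
      star ((1 / 2) ^ n * ∏ x, bb84Qubit (c (Sum.inr x)) (c (Sum.inl x)) (t x)) =
    ((1 / 2 : ℝ) ^ n * (1 / 2 : ℝ) ^ n) •
      (bb84Ket (fun i => c (Sum.inl i)) (fun i => c (Sum.inr i)) s *
          star (bb84Ket (fun i => c (Sum.inl i)) (fun i => c (Sum.inr i)) t) * a) := by
    rintro a _ rfl
    simp only [bb84Ket, Complex.real_smul, star_mul', star_pow]
    push_cast
    simp only [star_div₀, star_one, star_ofNat]
    ring
  exact key _ _ (hρ _ _)

end Prepare

/-! ### Controlled swaps -/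

section Swap

variable {Q R : Type} [Fintype Q] [DecidableEq Q] [Fintype R] [DecidableEq R]

/-- The product state `ρ ⊗ σ`. -/
def tensorOp (ρ : Op Q) (σ : Op R) : Op (Q ⊕ R) :=
  Matrix.of fun s t => ρ (fun i => s (Sum.inl i)) (fun i => t (Sum.inl i)) *
    σ (fun i => s (Sum.inr i)) (fun i => t (Sum.inr i))

/-- The state `|0⟩⟨0|`. -/
def zeroOp (R : Type) [Fintype R] [DecidableEq R] : Op R :=
  vecMulVec (Pi.single (fun _ => false) 1) (star (Pi.single (fun _ => false) 1))

theorem zeroOp_trace : (zeroOp R).trace = 1 := by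
  rw [zeroOp, trace_vecMulVec, ← Pi.single_star, single_dotProduct]; simp

/-- The controlled swap of two qubits as a permutation of basis states. -/
def swapPerm : Equiv.Perm (Fin 3 → Bool) :=
  Function.Involutive.toPerm (fun s => ![s 0, if s 0 then s 2 else s 1, if s 0 then s 1 else s 2])
    fun s => by funext k; fin_cases k <;> simp <;> split_ifs <;> rfl

variable {ι : Type} [Fintype ι] [DecidableEq ι]

/-- Input wires of `exists_split`. -/
def splitIn (ι : Type) : ι ⊕ (ι ⊕ ι) ≃ ι × Fin 3 where
  toFun
    | Sum.inl i => (i, 0)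
    | Sum.inr (Sum.inl i) => (i, 1)
    | Sum.inr (Sum.inr i) => (i, 2)
  invFun
    | (i, 0) => Sum.inl i
    | (i, 1) => Sum.inr (Sum.inl i)
    | (i, 2) => Sum.inr (Sum.inr i)
  left_inv := by rintro (i | i | i) <;> rfl
  right_inv := by rintro ⟨i, k⟩; fin_cases k <;> rfl

/-- Output wires of `exists_split`. -/
def splitOut (ι : Type) : Empty ⊕ ((ι ⊕ ι) ⊕ ι) ≃ ι × Fin 3 where
  toFun
    | Sum.inr (Sum.inr i) => (i, 0)
    | Sum.inr (Sum.inl (Sum.inl i)) => (i, 1)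
    | Sum.inr (Sum.inl (Sum.inr i)) => (i, 2)
  invFun
    | (i, 0) => Sum.inr (Sum.inr i)
    | (i, 1) => Sum.inr (Sum.inl (Sum.inl i))
    | (i, 2) => Sum.inr (Sum.inl (Sum.inr i))
  left_inv := by rintro (i | (i | i) | i) <;> first | rfl | exact i.elim
  right_inv := by rintro ⟨i, k⟩; fin_cases k <;> rfl

/-- Move a register to one of two places, depending on a classical control. -/
theorem exists_split : ∃ T : Instrument ι ι Empty (ι ⊕ ι), Realizable (4 * Fintype.card ι) T ∧
    (∀ ρ c, T (fun _ => false) ρ c = tensorOp ρ (zeroOp ι)) ∧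
      ∀ ρ c, T (fun _ => true) ρ c = tensorOp (zeroOp ι) ρ := by
  refine ⟨_, realizable_parallel (by simp) (fun _ => ⟨_, perm_unitary swapPerm⟩)
    (splitIn ι) (splitOut ι), fun ρ c => ?_, fun ρ c => ?_⟩
  all_goals
    ext s t
    rw [wireRun, Matrix.sum_apply]
    simp only [mul_mul_conjTranspose_apply, wireKraus, of_apply, gatesOp_parGates_perm]
  · have hc : ∀ (s : ι ⊕ ι → Bool) (g : ι → Bool) (q : ι → Bool),
        (∀ i, (fun w => joinBits (splitOut ι) c s g (i, w)) = swapPerm (fun w =>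
          joinBits (splitIn ι) (fun _ => false) q (fun _ => false) (i, w))) ↔
        (g = fun _ => false) ∧ (q = fun i => s (Sum.inl i)) ∧ (fun i => s (Sum.inr i)) = fun _ => false :=
      fun s g q =>
        ⟨fun h => ⟨funext fun i => congrFun (h i) 0, funext fun i => (congrFun (h i) 1).symm,
          funext fun i => congrFun (h i) 2⟩, by
          rintro ⟨rfl, rfl, h⟩ i
          funext w
          fin_cases w
          exacts [rfl, rfl, congrFun h i]⟩
    simp only [hc]
    rw [Finset.sum_eq_single fun _ => false]
    · simp only [tensorOp, zeroOp, of_apply, vecMulVec_apply, Pi.star_apply, Pi.single_apply,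
        true_and, ite_and, ite_mul, one_mul, zero_mul]
      split_ifs <;> simp
    · intro g _ hg; simp [hg]
    · exact fun h => absurd (Finset.mem_univ _) h
  · have hc : ∀ (s : ι ⊕ ι → Bool) (g : ι → Bool) (q : ι → Bool),
        (∀ i, (fun w => joinBits (splitOut ι) c s g (i, w)) = swapPerm (fun w =>
          joinBits (splitIn ι) (fun _ => true) q (fun _ => false) (i, w))) ↔
        (g = fun _ => true) ∧ (q = fun i => s (Sum.inr i)) ∧ (fun i => s (Sum.inl i)) = fun _ => false :=
      fun s g q =>
        ⟨fun h => ⟨funext fun i => congrFun (h i) 0, funext fun i => (congrFun (h i) 2).symm,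
          funext fun i => congrFun (h i) 1⟩, by
          rintro ⟨rfl, rfl, h⟩ i
          funext w
          fin_cases w
          exacts [rfl, congrFun h i, rfl]⟩
    simp only [hc]
    rw [Finset.sum_eq_single fun _ => true]
    · simp only [tensorOp, zeroOp, of_apply, vecMulVec_apply, Pi.star_apply, Pi.single_apply,
        true_and, ite_and, ite_mul, one_mul, zero_mul]
      split_ifs <;> simp
    · intro g _ hg; simp [hg]
    · exact fun h => absurd (Finset.mem_univ _) h

/-- Input wires of `exists_select`. -/
def selectIn (ι : Type) : ι ⊕ ((ι ⊕ ι) ⊕ Empty) ≃ ι × Fin 3 where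
  toFun
    | Sum.inl i => (i, 0)
    | Sum.inr (Sum.inl (Sum.inl i)) => (i, 1)
    | Sum.inr (Sum.inl (Sum.inr i)) => (i, 2)
  invFun
    | (i, 0) => Sum.inl i
    | (i, 1) => Sum.inr (Sum.inl (Sum.inl i))
    | (i, 2) => Sum.inr (Sum.inl (Sum.inr i))
  left_inv := by rintro (i | (i | i) | i) <;> first | rfl | exact i.elim
  right_inv := by rintro ⟨i, k⟩; fin_cases k <;> rfl

/-- Output wires of `exists_select`. -/
def selectOut (ι : Type) : Empty ⊕ (ι ⊕ (ι ⊕ ι)) ≃ ι × Fin 3 where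
  toFun
    | Sum.inr (Sum.inr (Sum.inl i)) => (i, 0)
    | Sum.inr (Sum.inl i) => (i, 1)
    | Sum.inr (Sum.inr (Sum.inr i)) => (i, 2)
  invFun
    | (i, 0) => Sum.inr (Sum.inr (Sum.inl i))
    | (i, 1) => Sum.inr (Sum.inl i)
    | (i, 2) => Sum.inr (Sum.inr (Sum.inr i))
  left_inv := by rintro (i | i | i | i) <;> first | rfl | exact i.elim
  right_inv := by rintro ⟨i, k⟩; fin_cases k <;> rfl

/-- Select one of two registers, depending on a classical control, and discard the other one. -/
theorem exists_select : ∃ T : Instrument ι (ι ⊕ ι) Empty ι, Realizable (4 * Fintype.card ι) T ∧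
    (∀ ρ σ c, T (fun _ => false) (tensorOp ρ σ) c = σ.trace • ρ) ∧
      ∀ ρ σ c, T (fun _ => true) (tensorOp ρ σ) c = ρ.trace • σ := by
  refine ⟨_, realizable_parallel (by simp) (fun _ => ⟨_, perm_unitary swapPerm⟩)
    (selectIn ι) (selectOut ι), fun ρ σ c => ?_, fun ρ σ c => ?_⟩
  all_goals
    ext s t
    rw [wireRun, Matrix.sum_apply]
    simp only [mul_mul_conjTranspose_apply, wireKraus, of_apply, gatesOp_parGates_perm]
    rw [← (Equiv.sumArrowEquivProdArrow ι ι Bool).symm.sum_comp, Fintype.sum_prod_type]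
  · have hc : ∀ (s : ι → Bool) (g r : ι → Bool) (q : ι ⊕ ι → Bool),
        (∀ i, (fun w => joinBits (selectOut ι) c s
          ((Equiv.sumArrowEquivProdArrow ι ι Bool).symm (g, r)) (i, w)) = swapPerm (fun w =>
          joinBits (selectIn ι) (fun _ => false) q (fun _ => false) (i, w))) ↔
        (g = fun _ => false) ∧ q = Sum.elim s r :=
      fun s g r q =>
        ⟨fun h => ⟨funext fun i => congrFun (h i) 0, funext fun j => j.casesOn
          (fun i => (congrFun (h i) 1).symm) fun i => (congrFun (h i) 2).symm⟩, by
          rintro ⟨rfl, rfl⟩ i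
          funext w
          fin_cases w <;> rfl⟩
    simp only [hc]
    rw [Finset.sum_eq_single fun _ => false]
    · simp [tensorOp, trace, Finset.mul_sum, mul_comm]
    · intro g _ hg; simp [hg]
    · exact fun h => absurd (Finset.mem_univ _) h
  · have hc : ∀ (s : ι → Bool) (g r : ι → Bool) (q : ι ⊕ ι → Bool),
        (∀ i, (fun w => joinBits (selectOut ι) c s
          ((Equiv.sumArrowEquivProdArrow ι ι Bool).symm (g, r)) (i, w)) = swapPerm (fun w =>
          joinBits (selectIn ι) (fun _ => true) q (fun _ => false) (i, w))) ↔
        (g = fun _ => true) ∧ q = Sum.elim r s :=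
      fun s g r q =>
        ⟨fun h => ⟨funext fun i => congrFun (h i) 0, funext fun j => j.casesOn
          (fun i => (congrFun (h i) 2).symm) fun i => (congrFun (h i) 1).symm⟩, by
          rintro ⟨rfl, rfl⟩ i
          funext w
          fin_cases w <;> rfl⟩
    simp only [hc]
    rw [Finset.sum_eq_single fun _ => true]
    · simp [tensorOp, trace, Finset.sum_mul]
    · intro g _ hg; simp [hg]
    · exact fun h => absurd (Finset.mem_univ _) h

end Swap

/-! ### Randomized classical functions -/

section Rand

variable {CI CO C2 N Ω ι : Type} [Fintype CI] [DecidableEq CI] [Fintype CO] [DecidableEq CO]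
  [Fintype C2] [DecidableEq C2] [Fintype N] [DecidableEq N] [Fintype Ω] [Fintype ι] [DecidableEq ι]

/-- The instrument that evaluates a function of the input and of a random `ω`. -/
def randInstr (p : Ω → ℝ) (F : (CI → Bool) → Ω → CO → Bool) : Instrument CI Empty CO Empty :=
  fun x ρ c => ∑ ω, if c = F x ω then p ω • ρ else 0

/-- The outcome `y` exhausts the total probability, so the other outcomes are positive operators of
trace zero. -/
theorem Circuit.run_eq_ite (C : Circuit CI Empty CO Empty) {x : CI → Bool} {y : CO → Bool}
    (h : C.run x 1 y = 1) (c : CO → Bool) : C.run x 1 c = if c = y then 1 else 0 := by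
  split_ifs with hc
  · rw [hc, h]
  · have hs := C.sum_trace_run x 1
    have h1 : (1 : Op Empty).trace = 1 := by simp
    rw [← Finset.add_sum_erase _ _ (Finset.mem_univ y), h, add_eq_left,
      Finset.sum_eq_zero_iff_of_nonneg] at hs
    · exact (C.run_posSemidef x PosSemidef.one c).trace_eq_zero_iff.1
        (hs c (Finset.mem_erase.2 ⟨hc, Finset.mem_univ _⟩))
    · exact fun c _ => (C.run_posSemidef x PosSemidef.one c).trace_nonneg

theorem realizable_rand_id :
    Realizable (Fintype.card CI) (randInstr (fun _ : Unit => 1) fun (x : CI → Bool) _ => x) :=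
  realizable_det_id.congr fun x ρ c => by simp [detInstr, randInstr]

theorem Realizable.randSample {t t2 : ℕ} {p : Ω → ℝ} {F : (CI → Bool) → Ω → CO → Bool}
    (h : Realizable t (randInstr p F)) {q : (N → Bool) → ℝ} {V : Instrument Empty Empty N Empty}
    (h2 : Realizable t2 V) (hV : ∀ c, V Empty.elim 1 c = q c • 1) :
    Realizable (t + 2 * t2) (randInstr (fun ω : Ω × (N → Bool) => p ω.1 * q ω.2)
      fun x ω => Sum.elim (F x ω.1) ω.2) := by
  refine (h.stepClassical h2 Empty.elim).congr fun x ρ c => ?_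
  rw [Subsingleton.elim (fun i : Empty => c (Sum.inl i.elim)) Empty.elim, hV]
  simp only [randInstr, Fintype.sum_prod_type, Finset.smul_sum]
  refine Finset.sum_congr rfl fun ω _ => ?_
  rw [Finset.sum_eq_single (fun i => c (Sum.inr i))]
  · by_cases hc : (fun i => c (Sum.inl i)) = F x ω
    · rw [if_pos hc, if_pos]
      · ext i j
        simp only [Matrix.smul_apply, one_apply_eq, Complex.real_smul, smul_eq_mul]
        push_cast
        ring
      · rw [← hc]; funext i; cases i <;> rfl
    · rw [if_neg hc, if_neg, smul_zero]
      intro h; apply hc; rw [h]; rfl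
  · intro c' _ hc'
    rw [if_neg]
    intro h; apply hc'; rw [h]; rfl
  · exact fun h => absurd (Finset.mem_univ _) h

/-- The behaviour of `V` is required only for `ω` of nonzero weight, because the hash circuit is
specified on valid keys only. -/
theorem Realizable.randStep {t t2 : ℕ} {p : Ω → ℝ} {F : (CI → Bool) → Ω → CO → Bool}
    (h : Realizable t (randInstr p F)) {V : Instrument C2 Empty N Empty}
    (h2 : Realizable t2 V) (sel : C2 → CO) (f : (CI → Bool) → Ω → N → Bool)
    (hV : ∀ x ω c, p ω ≠ 0 → V (fun i => F x ω (sel i)) 1 c = if c = f x ω then 1 else 0) :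
    Realizable (t + 2 * t2) (randInstr p fun x ω => Sum.elim (F x ω) (f x ω)) := by
  refine (h.stepClassical h2 sel).congr fun x ρ c => ?_
  simp only [randInstr, Finset.smul_sum]
  refine Finset.sum_congr rfl fun ω _ => ?_
  by_cases hp : p ω = 0
  · simp [hp]
  by_cases hc : (fun i => c (Sum.inl i)) = F x ω
  · have hs : (fun i => c (Sum.inl (sel i))) = fun i => F x ω (sel i) := by rw [← hc]
    rw [if_pos hc, hs, hV x ω _ hp]
    by_cases hc' : (fun i => c (Sum.inr i)) = f x ω
    · rw [if_pos hc', if_pos]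
      · simp
      · rw [← hc, ← hc']; funext i; cases i <;> rfl
    · rw [if_neg hc', if_neg]
      · simp
      · intro h; apply hc'; rw [h]; rfl
  · rw [if_neg hc, if_neg, smul_zero]
    intro h; apply hc; rw [h]; rfl

theorem Realizable.randLayer {t : ℕ} {p : Ω → ℝ} {F : (CI → Bool) → Ω → CO → Bool}
    (h : Realizable t (randInstr p F)) (a b : ι → CO) (g : ι → Bool → Bool → Bool) :
    Realizable (t + 8 * Fintype.card ι)
      (randInstr p fun x ω i => g i (F x ω (a i)) (F x ω (b i))) := by
  refine (((h.randStep (realizable_bitwise g) (Sum.elim a b)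
    (fun x ω i => g i (F x ω (a i)) (F x ω (b i))) fun x ω c _ => rfl).discardC
      (Equiv.sumComm CO ι)).mono (by omega)).congr fun x ρ c => ?_
  simp only [randInstr]
  rw [Finset.sum_comm]
  refine Finset.sum_congr rfl fun ω _ => ?_
  rw [Finset.sum_eq_single (F x ω)]
  · refine if_congr ⟨fun h => ?_, fun h => ?_⟩ rfl rfl
    · funext i; exact congrFun h (Sum.inr i)
    · subst h; funext i; cases i <;> rfl
  · intro d _ hd
    rw [if_neg]
    intro h; apply hd; funext i; exact congrFun h (Sum.inl i)
  · exact fun h => absurd (Finset.mem_univ _) h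

end Rand

/-! ### Counting -/

section Count

variable {CI CO ι : Type} [Fintype CI] [DecidableEq CI] [Fintype CO] [DecidableEq CO]
  [Fintype ι] [DecidableEq ι]

/-- Append the values of some gates to the output. -/
theorem Realizable.append {t : ℕ} {f : (CI → Bool) → CO → Bool} (h : Realizable t (detInstr f))
    (a b : ι → CO) (g : ι → Bool → Bool → Bool) :
    Realizable (t + 8 * Fintype.card ι)
      (detInstr fun x => Sum.elim (f x) fun i => g i (f x (a i)) (f x (b i))) := by
  refine ((h.stepClassical (realizable_bitwise g) (Sum.elim a b)).mono (by omega)).congr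
    fun x ρ c => ?_
  simp only [detInstr]
  have he : (c = Sum.elim (f x) fun i => g i (f x (a i)) (f x (b i))) ↔
      (fun i => c (Sum.inl i)) = f x ∧
        (fun i => c (Sum.inr i)) = fun i => g i (f x (a i)) (f x (b i)) := by
    constructor
    · rintro rfl; exact ⟨rfl, rfl⟩
    · rintro ⟨h1, h2⟩
      rw [← h1, ← Sum.elim_comp_inl_inr c]
      rw [← h1] at h2
      exact congrArg _ h2
  by_cases hc : (fun i => c (Sum.inl i)) = f x
  · have e : ∀ i, c (Sum.inl i) = f x i := fun i => congrFun hc i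
    simp only [he, e, true_and, if_true, Sum.elim_inl, Sum.elim_inr]
    split_ifs <;> simp
  · simp only [he, hc, false_and, if_false, smul_zero]

theorem card_filter_lt_succ {n k : ℕ} (hk : k < n) (x : Fin n → Bool) :
    (Finset.univ.filter fun i : Fin n => i.1 < k + 1 ∧ x i = true).card =
      (Finset.univ.filter fun i : Fin n => i.1 < k ∧ x i = true).card +
        if x ⟨k, hk⟩ then 1 else 0 := by
  have : (Finset.univ.filter fun i : Fin n => i.1 < k + 1 ∧ x i = true) =
      (Finset.univ.filter fun i : Fin n => i.1 < k ∧ x i = true) ∪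
        if x ⟨k, hk⟩ then {⟨k, hk⟩} else ∅ := by
    ext i
    rw [Finset.mem_union, Finset.mem_filter, Finset.mem_filter, Nat.lt_succ_iff_lt_or_eq]
    by_cases hi : i.1 = k
    · obtain rfl : i = ⟨k, hk⟩ := Fin.ext hi
      split_ifs with h <;> simp [h]
    · have : i ∉ (if x ⟨k, hk⟩ then {⟨k, hk⟩} else ∅ : Finset (Fin n)) := by
        split_ifs <;> simp [Fin.ext_iff, hi]
      simp [hi, this]
  rw [this, Finset.card_union_of_disjoint]
  · split_ifs <;> simp
  · split_ifs <;> simp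

/-- Count by dynamic programming; the wire `Sum.inl ()` is only there to be nonempty. -/
theorem realizable_count (n m k : ℕ) (hk : k ≤ n) :
    Realizable (n + 1 + 8 * (m + 1) + k * (8 * (n + 2 * m + 3)))
      (detInstr fun x : Unit ⊕ Fin n → Bool => Sum.elim x fun j : Fin (m + 1) =>
        decide ((j : ℕ) ≤ (Finset.univ.filter fun i : Fin n =>
          i.1 < k ∧ x (Sum.inr i) = true).card)) := by
  induction k with
  | zero =>
    refine ((realizable_det_id.append (ι := Fin (m + 1)) (fun _ => Sum.inl ())
      (fun _ => Sum.inl ()) fun j _ _ => decide (j.1 ≤ 0)).mono ?_).congr fun x ρ c => ?_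
    · simp; omega
    · simp
  | succ k ih =>
    -- With `N_k` the count over the first `k` bits: `j ≤ N_(k+1)` iff `j ≤ N_k`, or bit `k` is set
    -- and `j = 0` or `j - 1 ≤ N_k`. In `Fin` the predecessor of `0` wraps around, which the test `j
    -- = 0` makes harmless.
    refine ((((ih (by omega)).append (ι := Fin (m + 1)) (fun _ => Sum.inl (Sum.inr ⟨k, by omega⟩))
      (fun j => Sum.inr (j - 1)) fun j u v => u && (decide (j = 0) || v)).layer
        (ι := (Unit ⊕ Fin n) ⊕ Fin (m + 1)) (Sum.elim (fun i => Sum.inl (Sum.inl i)) Sum.inr)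
        Sum.inl fun _ u v => u || v).mono ?_).congr fun x ρ c => ?_
    · simp only [Fintype.card_sum, Fintype.card_fin, Fintype.card_unit]
      ring_nf; omega
    · refine if_congr (Eq.congr_right ?_) rfl rfl
      funext i
      rcases i with i | j
      · simp
      · have hj : (j = 0 ∨ 1 ≤ j.1) ∧ (1 ≤ j.1 → (j - 1).1 = j.1 - 1) := by
          rcases eq_or_ne j 0 with rfl | hj
          · simp
          · exact ⟨Or.inr (Nat.one_le_iff_ne_zero.2 fun h => hj (Fin.ext h)),
              fun _ => Fin.val_sub_one_of_ne_zero hj⟩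
        have h0 : j = 0 → j.1 = 0 := fun h => by rw [h]; rfl
        simp only [Sum.elim_inr, Sum.elim_inl, card_filter_lt_succ (by omega : k < n)]
        generalize (Finset.univ.filter fun i : Fin n => i.1 < k ∧ x (Sum.inr i) = true).card = N
        rw [Bool.eq_iff_iff]
        cases x (Sum.inr ⟨k, by omega⟩)
        · simp
        · simp
          omega

theorem realizable_threshold (n m : ℕ) :
    Realizable (n + 1 + 8 * (m + 1) + n * (8 * (n + 2 * m + 3)) + 8)
      (detInstr fun (x : Unit ⊕ Fin n → Bool) (_ : Unit) =>
        decide (m ≤ (Finset.univ.filter fun i : Fin n => x (Sum.inr i) = true).card)) := by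
  refine ((realizable_count n m n le_rfl).layer (fun _ : Unit => Sum.inr (Fin.last m))
    (fun _ => Sum.inr (Fin.last m)) fun _ u _ => u).congr fun x ρ c => ?_
  simp [detInstr]

end Count

/-! ### The classical part of the simulator -/

/-- The positions with `J i = b`. -/
abbrev part {n : ℕ} (J : Bits n) (b : Bool) : Finset (Fin n) := Finset.univ.filter fun i => J i = b

/-- The masks `f_b(x|_{I_b})`. -/
def hashMask {ℓ : ℕ → ℕ} (H : HashFamily ℓ) {n : ℕ} (κ : Bool → Bits (H.keyLen n)) (J x : Bits n)
    (b : Bool) : Bits (ℓ n) :=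
  H.hash n (κ b) (part J b) ((part J b).restrict x)

/-- The input of the simulator to the ideal functionality: `false` if at least `t` of the positions
where the two basis strings differ are in `I_1`. -/
def simChoice {n : ℕ} (t : ℕ) (θ θ' J : Bits n) : Bool :=
  !decide (t ≤ (Finset.univ.filter fun i : Fin n => (xor (θ i) (θ' i) && J i) = true).card)

/-- The classical data kept by the simulator: abort flag, indicator of `k`, keys, masks, random
string. -/
abbrev SimData (r l : ℕ) : Type :=
  Unit ⊕ (Bool ⊕ ((Bool × Fin r) ⊕ ((Bool × Fin l) ⊕ Fin l)))

/-- The values of the wires `SimData`. -/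
def simData {r l : ℕ} (a k : Bool) (κ : Bool → Bits r) (h : Bool → Bits l) (u : Bits l) :
    SimData r l → Bool :=
  Sum.elim (fun _ => a) (Sum.elim (fun b => b == k) (Sum.elim (fun p => κ p.1 p.2)
    (Sum.elim (fun p => h p.1 p.2) u)))

/-- The two keys as a function. -/
def keyPair {r : ℕ} (κ0 κ1 : Bits r) : Bool → Bits r := fun b => if b then κ1 else κ0

/-- The random choices of the simulator: two keys and a string. -/
abbrev SimCoins (r l : ℕ) : Type := ((Unit × Bits r) × Bits r) × Bits l

/-- The probability of a sampled key. -/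
def keyProb {ℓ : ℕ → ℕ} (H : HashFamily ℓ) (n : ℕ) (κ : Bits (H.keyLen n)) : ℝ :=
  if κ ∈ H.keys n then ((H.keys n).card : ℝ)⁻¹ else 0

section Classical

variable {ℓ : ℕ → ℕ} (H : HashFamily ℓ) {n : ℕ} {C2 : Type} [Fintype C2] [DecidableEq C2]

/-- All classical work between Bob's announcement and the query: sample two keys and a pad, compare
the bases, restrict to `I_1`, count against `t`, form both indicator strings, evaluate both hashes.
Every step appends its result to the wires, hence the long chains of `.inl`; the last layer keeps
what the reply phase needs. -/
theorem realizable_simClassical {th : ℕ} (t : ℕ)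
    (hs : ∃ C : Circuit Empty Empty (Fin (H.keyLen n)) Empty, C.time ≤ th ∧
      ∀ κ, C.run Empty.elim 1 κ = if κ ∈ H.keys n then ((H.keys n).card : ℝ)⁻¹ • 1 else 0)
    (hh : ∃ C : Circuit (Fin (H.keyLen n) ⊕ (Fin n ⊕ Fin n)) Empty (Fin (ℓ n)) Empty,
      C.time ≤ th ∧ ∀ κ ∈ H.keys n, ∀ (I : Finset (Fin n)) (x : Bits n),
        C.run (Sum.elim κ (Sum.elim (fun i => decide (i ∈ I)) x)) 1
          (H.hash n κ I (I.restrict x)) = 1)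
    (aa : C2) (ax aθ aθ' aJ : Fin n → C2) :
    Realizable (Fintype.card C2 + 8 * th + 8 * ℓ n + 40 * n +
        2 * (n + 1 + 8 * (t + 1) + n * (8 * (n + 2 * t + 3)) + 8) +
        (32 + 16 * H.keyLen n + 24 * ℓ n))
      (randInstr (fun ω : SimCoins (H.keyLen n) (ℓ n) =>
          1 * keyProb H n ω.1.1.2 * keyProb H n ω.1.2 * (1 / 2) ^ ℓ n)
        fun (c : C2 → Bool) ω => Sum.elim
          (fun _ : Unit => simChoice t (fun i => c (aθ i)) (fun i => c (aθ' i)) fun i => c (aJ i))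
          (simData (c aa)
            (simChoice t (fun i => c (aθ i)) (fun i => c (aθ' i)) fun i => c (aJ i))
            (keyPair ω.1.1.2 ω.1.2)
            (hashMask H (keyPair ω.1.1.2 ω.1.2) (fun i => c (aJ i)) fun i => c (ax i)) ω.2)) := by
  obtain ⟨Cs, hst, hsr⟩ := hs
  obtain ⟨Ch, hht, hhr⟩ := hh
  have h1 := ((realizable_rand_id (CI := C2)).randSample (Cs.realizable.mono hst)
    (q := keyProb H n) fun κ => by rw [hsr, keyProb]; split_ifs <;> simp).randSample
    (Cs.realizable.mono hst) (q := keyProb H n) fun κ => by rw [hsr, keyProb]; split_ifs <;> simp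
  have h2 := h1.randSample (realizable_randomBits (ι := Fin (ℓ n)))
    (q := fun _ => (1 / 2) ^ ℓ n) fun c => by rw [Fintype.card_fin]
  have h3 := h2.randStep (realizable_bitwise fun (_ : Fin n) u v => xor u v)
    (Sum.elim (fun i => .inl (.inl (.inl (aθ i)))) fun i => .inl (.inl (.inl (aθ' i))))
    (fun c ω i => xor (c (aθ i)) (c (aθ' i))) fun c ω d _ => rfl
  have h4 := h3.randStep (realizable_bitwise fun (_ : Fin n) u v => u && v)
    (Sum.elim (fun i => .inr i) fun i => .inl (.inl (.inl (.inl (aJ i)))))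
    (fun c ω i => xor (c (aθ i)) (c (aθ' i)) && c (aJ i)) fun c ω d _ => rfl
  have h5 := h4.randStep (realizable_threshold n t)
    (Sum.elim (fun _ => .inl (.inl (.inl (.inl (.inl aa))))) fun i => .inr i)
    (fun c ω _ => decide (t ≤ (Finset.univ.filter fun i : Fin n =>
      (xor (c (aθ i)) (c (aθ' i)) && c (aJ i)) = true).card)) fun c ω d _ => rfl
  -- Bit `(b, i)` tells whether `i` is in `I_b`; the hash circuit takes the set as an indicator
  -- string.
  have h6 := h5.randStep (realizable_bitwise fun (p : Bool × Fin n) u _ => decide (u = p.1))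
    (Sum.elim (fun p => .inl (.inl (.inl (.inl (.inl (.inl (aJ p.2)))))))
      fun p => .inl (.inl (.inl (.inl (.inl (.inl (aJ p.2)))))))
    (fun c ω p => decide (c (aJ p.2) = p.1)) fun c ω d _ => rfl
  have key : ∀ (b : Bool) (κ : Bool → Bits (H.keyLen n)) (J x : Bits n)
      (f : Fin (H.keyLen n) ⊕ (Fin n ⊕ Fin n) → Bool) d, κ b ∈ H.keys n →
      (∀ i, f (.inl i) = κ b i) → (∀ i, f (.inr (.inl i)) = decide (J i = b)) →
      (∀ i, f (.inr (.inr i)) = x i) →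
        Ch.run f 1 d = if d = hashMask H κ J x b then 1 else 0 := fun b κ J x f d hκ e1 e2 e3 => by
    refine Circuit.run_eq_ite _ ?_ d
    have : f = Sum.elim (κ b) (Sum.elim (fun i => decide (i ∈ part J b)) x) := by
      funext i
      rcases i with i | i | i
      · exact e1 i
      · rw [e2]; simp
      · exact e3 i
    rw [this]
    exact hhr _ hκ _ _
  have hp : ∀ ω : SimCoins (H.keyLen n) (ℓ n),
      1 * keyProb H n ω.1.1.2 * keyProb H n ω.1.2 * (1 / 2) ^ ℓ n ≠ 0 →
        ω.1.1.2 ∈ H.keys n ∧ ω.1.2 ∈ H.keys n := fun ω h => by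
    constructor <;> by_contra hc <;> simp [keyProb, hc] at h
  have h7 := h6.randStep (Ch.realizable.mono hht)
    (Sum.elim (fun i => .inl (.inl (.inl (.inl (.inl (.inl (.inr i)))))))
      (Sum.elim (fun i => .inr (false, i))
        fun i => .inl (.inl (.inl (.inl (.inl (.inl (.inl (ax i)))))))))
    (fun c ω => hashMask H (keyPair ω.1.1.2 ω.1.2) (fun i => c (aJ i)) (fun i => c (ax i)) false)
    fun c ω d hω => key _ _ _ _ _ d (hp ω hω).1 (fun _ => rfl) (fun _ => rfl) fun _ => rfl
  have h8 := h7.randStep (Ch.realizable.mono hht)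
    (Sum.elim (fun i => .inl (.inl (.inl (.inl (.inl (.inl (.inr i)))))))
      (Sum.elim (fun i => .inl (.inr (true, i)))
        fun i => .inl (.inl (.inl (.inl (.inl (.inl (.inl (.inl (ax i))))))))))
    (fun c ω => hashMask H (keyPair ω.1.1.2 ω.1.2) (fun i => c (aJ i)) (fun i => c (ax i)) true)
    fun c ω d hω => key _ _ _ _ _ d (hp ω hω).2 (fun _ => rfl) (fun _ => rfl) fun _ => rfl
  have h9 := h8.randLayer (ι := Unit ⊕ SimData (H.keyLen n) (ℓ n))
    (Sum.elim (fun _ => .inl (.inl (.inl (.inr ()))))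
      (Sum.elim (fun _ => .inl (.inl (.inl (.inl (.inl (.inl (.inl (.inl (.inl aa)))))))))
        (Sum.elim (fun _ => .inl (.inl (.inl (.inr ()))))
          (Sum.elim (fun p => .inl (.inl (.inl (.inl (.inl (.inl (if p.1 then .inl (.inr p.2)
            else .inl (.inl (.inr p.2)))))))))
            (Sum.elim (fun p => if p.1 then .inr p.2 else .inl (.inr p.2))
              fun i => .inl (.inl (.inl (.inl (.inl (.inl (.inr i)))))))))))
    (fun _ => .inl (.inl (.inl (.inr ()))))
    (Sum.elim (fun _ u _ => !u) (Sum.elim (fun _ u _ => u) (Sum.elim (fun b u _ => b == !u)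
      fun _ u _ => u)))
  refine (h9.mono ?_).congr fun c ρ d => Finset.sum_congr rfl fun ω _ =>
    if_congr (Eq.congr_right ?_) rfl rfl
  · simp only [Fintype.card_sum, Fintype.card_prod, Fintype.card_bool, Fintype.card_fin,
      Fintype.card_unit]
    omega
  · funext i
    rcases i with i | i | i | ⟨b, i⟩ | ⟨b, i⟩ | i
    · rfl
    · rfl
    · rfl
    · cases b <;> rfl
    · cases b <;> rfl
    · rfl

end Classical

/-! ### The quantum part of the simulator -/

section Quantum

variable {CI QI M QM C2 Q2 CO2 QO2 QB : Type} [Fintype CI] [DecidableEq CI] [Fintype QI]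
  [DecidableEq QI] [Fintype M] [DecidableEq M] [Fintype QM] [DecidableEq QM]
  [Fintype C2] [DecidableEq C2] [Fintype Q2] [DecidableEq Q2] [Fintype CO2] [DecidableEq CO2]
  [Fintype QO2] [DecidableEq QO2] [Fintype QB] [DecidableEq QB]

theorem realizable_id : Realizable (Fintype.card CI + Fintype.card QI)
    (fun x ρ c => if c = x then ρ else 0 : Instrument CI QI CI QI) := by
  let e : CI ⊕ (QI ⊕ Empty) ≃ CI ⊕ QI := Equiv.sumCongr (Equiv.refl CI) (Equiv.sumEmpty QI Empty)
  obtain ⟨C, hC, hr⟩ := exists_circuit (CI := CI) (QI := QI) (A := Empty) (CO := CI) (QO := QI)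
    (G := Empty) (W := CI ⊕ QI) e e []
  refine ⟨C, by rw [hC]; simp, fun x ρ c => ?_⟩
  rw [hr, wireRun, Fintype.sum_unique]
  have hj : ∀ (x : CI → Bool) (q : QI → Bool) (g : Empty → Bool), joinBits e x q g = Sum.elim x q :=
      fun x s g => by funext i; cases i <;> rfl
  have hK : ∀ g : Empty → Bool, wireKraus (gatesOp []) e e x c g = if c = x then 1 else 0 := fun g => by
    ext s t
    simp only [wireKraus, of_apply, gatesOp, one_apply, hj, Sum.elim_eq_iff]
    by_cases h : c = x <;> simp [h, one_apply]
  simp only [hK]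
  split_ifs <;> simp

theorem Realizable.andThen {t1 t2 : ℕ} {T1 : Instrument CI QI M QM} {T2 : Instrument C2 QM CO2 QO2}
    (h1 : Realizable t1 T1) (h2 : Realizable t2 T2) (sel : C2 → M) :
    Realizable (t1 + 2 * t2) (fun x ρ c => T2 (fun i => c (Sum.inl (sel i)))
      (T1 x ρ fun i => c (Sum.inl i)) (fun i => c (Sum.inr i)) :
        Instrument CI QI (M ⊕ CO2) QO2) := by
  refine ((h1.call h2 sel (Equiv.sumEmpty QM Empty).symm).relabelQ (Equiv.sumEmpty QO2 Empty)).congr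
    fun x ρ c => ?_
  rfl

/-- The effect of `Realizable.call` on a product state. -/
theorem Realizable.callInstr_tensorOp {t2 : ℕ} {T1 : Instrument CI QI M QM}
    {T2 : Instrument C2 Q2 CO2 QO2} (h2 : Realizable t2 T2) (sel : C2 → M) (e : QM ≃ Q2 ⊕ QB)
    {x : CI → Bool} {ρ : Op QI} {c : M ⊕ CO2 → Bool} {A : Op Q2} {B : Op QB}
    (h : relabel e (T1 x ρ fun i => c (Sum.inl i)) = tensorOp A B) :
    callInstr T1 T2 sel e x ρ c =
      tensorOp (T2 (fun i => c (Sum.inl (sel i))) A (fun i => c (Sum.inr i))) B := by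
  ext s t
  have hb : ∀ b b', block e (T1 x ρ fun i => c (Sum.inl i)) b b' = B b b' • A := fun b b' => by
    ext i j
    have := congrFun (congrFun h (Sum.elim i b)) (Sum.elim j b')
    rw [Matrix.smul_apply, smul_eq_mul, mul_comm]
    exact this
  simp only [callInstr, of_apply, hb, h2.smul, tensorOp, Matrix.smul_apply, smul_eq_mul, mul_comm]

theorem relabel_sumComm_tensorOp (A : Op Q2) (B : Op QB) :
    relabel (Equiv.sumComm Q2 QB) (tensorOp A B) = tensorOp B A := by
  ext s t
  exact mul_comm _ _

theorem Realizable.zero {t : ℕ} {T : Instrument CI QI M QM} (h : Realizable t T) (x : CI → Bool)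
    (c : M → Bool) : T x 0 c = 0 := by
  have := h.smul x 0 0 c
  rwa [zero_smul, zero_smul] at this

theorem tensorOp_zero_left (B : Op QB) : tensorOp (0 : Op Q2) B = 0 := by
  ext; simp [tensorOp]

theorem Realizable.callInstr_zero {t2 : ℕ} {T1 : Instrument CI QI M QM}
    {T2 : Instrument C2 Q2 CO2 QO2} (h2 : Realizable t2 T2) (sel : C2 → M) (e : QM ≃ Q2 ⊕ QB)
    {x : CI → Bool} {ρ : Op QI} {c : M ⊕ CO2 → Bool} (h : T1 x ρ (fun i => c (Sum.inl i)) = 0) :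
    callInstr T1 T2 sel e x ρ c = 0 := by
  rw [h2.callInstr_tensorOp sel e (A := 0) (B := 0), h2.zero, tensorOp_zero_left]
  rw [h, tensorOp_zero_left]; rfl

/-- Evaluate a function and keep everything else. -/
theorem Realizable.detKeep {t : ℕ} {f : (CI → Bool) → M → Bool} (h : Realizable t (detInstr f)) :
    Realizable (Fintype.card CI + Fintype.card QI + 2 * t)
      (fun x ρ c => if c = Sum.elim x (f x) then ρ else 0 : Instrument CI QI (CI ⊕ M) QI) := by
  refine (realizable_id.stepClassical h id).congr fun x ρ c => ?_
  have he : c = Sum.elim x (f x) ↔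
      (fun i => c (Sum.inl i)) = x ∧ (fun i => c (Sum.inr i)) = f x := by
    constructor
    · rintro rfl; exact ⟨rfl, rfl⟩
    · rintro ⟨h1, h2⟩
      funext i
      cases i with
      | inl i => exact congrFun h1 i
      | inr i => exact congrFun h2 i
  by_cases h1 : (fun i => c (Sum.inl i)) = x
  · have h1' : ∀ i, c (Sum.inl i) = x i := fun i => congrFun h1 i
    simp only [he, h1', detInstr, id, true_and, if_true]
    split_ifs <;> simp
  · simp only [he, h1, false_and, if_false, smul_zero]

theorem relabel_refl (A : Op Q2) : relabel (Equiv.refl Q2) A = A := rfl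

end Quantum

/-! ### The simulator after the reply of the functionality -/

section Reply

variable {n l r : ℕ}

/-- The messages that the simulator sends: `s_k ⊕ h_k` and a random string. -/
def simMask (s : Bits l) (k : Bool) (h : Bool → Bits l) (u : Bits l) (b : Bool) : Bits l :=
  fun i => if b = k then xor (s i) (h b i) else u i

/-- A multiplexer: the wire `y (.inr (.inr (.inl b)))` carries the bit `b = k`, and AND and OR gates
use it to select the masked string or the random one. -/
theorem realizable_simMask : Realizable (68 * l + 18 * r + 11)
    (detInstr fun (y : Fin l ⊕ SimData r l → Bool) => (Sum.elim (fun _ => y (.inr (.inl ())))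
      (Sum.elim (fun p => y (.inr (.inr (.inr (.inl p))))) fun p => if y (.inr (.inr (.inl p.1)))
        then xor (y (.inl p.2)) (y (.inr (.inr (.inr (.inr (.inl p))))))
        else y (.inr (.inr (.inr (.inr (.inr p.2)))))) :
          Unit ⊕ ((Bool × Fin r) ⊕ (Bool × Fin l)) → Bool)) := by
  have h1 := (realizable_det_id (CI := Fin l ⊕ SimData r l)).append (ι := Bool × Fin l)
    (fun p => .inl p.2) (fun p => .inr (.inr (.inr (.inr (.inl p))))) fun _ u v => xor u v
  have h2 := h1.append (ι := (Bool × Fin l) ⊕ (Bool × Fin l))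
    (Sum.elim .inr fun p => .inl (.inr (.inr (.inr (.inr (.inr p.2))))))
    (Sum.elim (fun p => .inl (.inr (.inr (.inl p.1)))) fun p => .inl (.inr (.inr (.inl p.1))))
    (Sum.elim (fun _ u v => u && v) fun _ u v => u && !v)
  have h3 := h2.layer (ι := Unit ⊕ ((Bool × Fin r) ⊕ (Bool × Fin l)))
    (Sum.elim (fun _ => .inl (.inl (.inr (.inl ())))) (Sum.elim
      (fun p => .inl (.inl (.inr (.inr (.inr (.inl p)))))) fun p => .inr (.inl p)))
    (Sum.elim (fun _ => .inl (.inl (.inr (.inl ())))) (Sum.elim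
      (fun p => .inl (.inl (.inr (.inr (.inr (.inl p)))))) fun p => .inr (.inr p)))
    (fun _ u v => u || v)
  refine (h3.mono ?_).congr fun y ρ c => if_congr (Eq.congr_right ?_) rfl rfl
  · simp only [Fintype.card_sum, Fintype.card_prod, Fintype.card_bool, Fintype.card_fin,
      Fintype.card_unit]
    omega
  · funext i
    rcases i with i | p | p
    · simp
    · simp
    · simp only [Sum.elim_inr, Sum.elim_inl]
      cases y (.inr (.inr (.inl p.1))) <;> simp

/-- The output of the receiver on the message of the simulator. -/
def simFinish (B : DishonestBob n l r) (s : Bits l) (k : Bool) (κ : Bool → Bits r)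
    (h : Bool → Bits l) (u : Bits l) (σ : Op (Fin B.memLen)) : Op (Fin B.outLen) :=
  B.finish.run (Sum.elim (Function.uncurry κ) (Function.uncurry (simMask s k h u))) σ Empty.elim

/-- The circuit cannot branch on the abort flag, so `finish` is always run and the flag selects
which of two registers is output. The discarded register contributes its trace. -/
theorem exists_reply (B : DishonestBob n l r) :
    ∃ T : Instrument (Fin l ⊕ SimData r l) (Fin B.outLen ⊕ Fin B.memLen) Empty (Fin B.outLen),
      Realizable (200 * l + 50 * r + 100 + 10 * B.outLen + B.memLen + 2 * B.finish.time) T ∧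
        ∀ s a k κ h u A A' c, T (Sum.elim s (simData a k κ h u)) (tensorOp A A') c =
          if a then (simFinish B s k κ h u A').trace • A else A.trace • simFinish B s k κ h u A' := by
  obtain ⟨Ts, hs, hs0, hs1⟩ := exists_select (ι := Fin B.outLen)
  have h1 := (realizable_simMask (l := l) (r := r)).detKeep (QI := Fin B.outLen ⊕ Fin B.memLen)
  have h2 := (h1.call B.finish.realizable (fun i => .inr (.inr i)) (Equiv.sumComm _ _)).andThen hs
    fun _ => .inl (.inr (.inl ()))
  have h3 := h2.discardC (Equiv.emptySum Empty _).symm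
  refine ⟨_, h3.mono ?_, fun s a k κ h u A A' c => ?_⟩
  · simp only [Fintype.card_sum, Fintype.card_prod, Fintype.card_bool, Fintype.card_fin,
      Fintype.card_unit]
    omega
  · let m0 : (Fin l ⊕ SimData r l) ⊕ (Unit ⊕ ((Bool × Fin r) ⊕ (Bool × Fin l))) → Bool :=
      Sum.elim (Sum.elim s (simData a k κ h u)) (Sum.elim (fun _ => a)
        (Sum.elim (Function.uncurry κ) (Function.uncurry (simMask s k h u))))
    -- The intermediate classical wires are determined by the input: `m0` is their only value of
    -- nonzero weight.
    rw [Fintype.sum_eq_single (Sum.elim (Sum.elim m0 Empty.elim) Empty.elim)]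
    · change (Ts _ (callInstr _ _ _ _ _ _ _) _) = _
      rw [B.finish.realizable.callInstr_tensorOp (A := A') (B := A)]
      · cases a
        · exact hs0 _ _ _
        · exact hs1 _ _ _
      · rw [if_pos, relabel_sumComm_tensorOp]
        funext i
        rcases i with i | i | i | ⟨b, i⟩
        · rfl
        · rfl
        · rfl
        · by_cases hb : b = k
          · simp [m0, simData, simMask, hb]
          · simp [m0, simData, simMask, hb]
    · intro d hd
      rw [B.finish.realizable.callInstr_zero]
      · exact hs.zero _ _
      · rw [if_neg]
        intro he
        apply hd
        funext i
        rcases i with (i | i) | i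
        · refine (congrFun he i).trans ?_
          rcases i with i | i | i | ⟨b, i⟩
          · rfl
          · rfl
          · rfl
          · by_cases hb : b = k
            · simp [m0, simData, simMask, hb]
            · simp [m0, simData, simMask, hb]
        · exact i.elim
        · exact i.elim

end Reply

/-! ### The simulator up to the query -/

section Query

variable {n l r : ℕ}

/-- The quantum registers of the simulator before the query: what the receiver outputs if he
aborts, and what he keeps after announcing the partition if he does not. -/
def simState (B : DishonestBob n l r) (z : Bits B.zLen) (σ : Op (Fin B.vLen)) (x θ : Bits n)
    (a : Bool) (θ' : Bits n) (w : Bits B.wLen) (J : Bits n) : Op (Fin B.outLen ⊕ Fin B.memLen) :=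
  tensorOp
    (B.onAbort.run (Sum.elim θ' w) (if a then B.prepGiven z σ x θ a θ' w else zeroOp _) Empty.elim)
    (B.partition.run (Sum.elim (Sum.elim θ' w) θ)
      (if a then zeroOp _ else B.prepGiven z σ x θ a θ' w) J)

/-- The classical registers of the simulator before the query. -/
abbrev SimReg (B : DishonestBob n l r) : Type :=
  ((((Fin n ⊕ Fin n) ⊕ (Unit ⊕ (Fin n ⊕ Fin B.wLen))) ⊕ Empty) ⊕ Fin n) ⊕ Empty

/-- The random BB84 states are generated next to Bob's input and handed to his preparation circuit;
the kept copy of `z` is forgotten at the end. -/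
theorem realizable_prep (B : DishonestBob n l r) :
    Realizable (B.zLen + B.vLen + 8 * n + 2 * B.prep.time)
      (fun z σ c => B.prepGiven z σ (fun i => c (.inl (.inl i))) (fun i => c (.inl (.inr i)))
        (c (.inr (.inl ()))) (fun i => c (.inr (.inr (.inl i)))) (fun i => c (.inr (.inr (.inr i)))) :
        Instrument (Fin B.zLen) (Fin B.vLen) ((Fin n ⊕ Fin n) ⊕ (Unit ⊕ (Fin n ⊕ Fin B.wLen)))
          (Fin B.eLen)) := by
  have h1 := (realizable_id (CI := Fin B.zLen) (QI := Fin B.vLen)).call (realizable_bb84 n) Empty.elim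
    (Equiv.emptySum Empty _).symm
  have h2 := h1.andThen B.prep.realizable Sum.inl
  let e : (Fin B.zLen ⊕ (Fin n ⊕ Fin n)) ⊕ (Unit ⊕ (Fin n ⊕ Fin B.wLen)) ≃
      ((Fin n ⊕ Fin n) ⊕ (Unit ⊕ (Fin n ⊕ Fin B.wLen))) ⊕ Fin B.zLen :=
    (Equiv.sumAssoc _ _ _).trans (Equiv.sumComm _ _)
  refine ((h2.discardC e).mono (by simp; omega)).congr fun z σ c => ?_
  have hb : ∀ c', callInstr (fun (x : Fin B.zLen → Bool) (ρ : Op (Fin B.vLen)) c => if c = x then ρ else 0)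
      (fun _ ρ c => Matrix.of fun s t => ((1 / 2 : ℝ) ^ n * (1 / 2 : ℝ) ^ n) •
      (bb84Ket (fun i => c (Sum.inl i)) (fun i => c (Sum.inr i)) s *
        star (bb84Ket (fun i => c (Sum.inl i)) (fun i => c (Sum.inr i)) t) *
          ρ Empty.elim Empty.elim) : Instrument Empty Empty (Fin n ⊕ Fin n) (Fin n)) Empty.elim
      (Equiv.emptySum Empty _).symm z σ c' = if (fun i => c' (.inl i)) = z then
        ((1 / 2 : ℝ) ^ n * (1 / 2 : ℝ) ^ n) • bb84With (fun i => c' (.inr (.inl i)))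
          (fun i => c' (.inr (.inr i))) σ else 0 := fun c' => by
    ext s t
    simp only [callInstr, of_apply, block, submatrix_apply]
    split_ifs with hz
    · rw [Matrix.smul_apply]
      rfl
    · simp
  rw [Fintype.sum_eq_single z]
  · rw [hb, if_pos]
    · rw [Circuit.run_real_smul]
      rw [DishonestBob.prepGiven]
      congr 2
      funext i
      rcases i with i | i | i <;> rfl
    · rfl
  · intro d hd
    rw [hb, if_neg, Circuit.run_zero]
    exact hd

/-- Both continuations of Bob are always run: a controlled swap sends `E` to the circuit that the
abort flag demands, and a dummy zero state to the other one. -/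
theorem realizable_simState (B : DishonestBob n l r) :
    Realizable (B.zLen + B.vLen + 8 * n + 2 * B.prep.time + 8 * B.eLen + 2 * B.partition.time +
        2 * B.onAbort.time)
      (fun z σ c => simState B z σ (fun i => c (.inl (.inl (.inl (.inl (.inl i))))))
        (fun i => c (.inl (.inl (.inl (.inl (.inr i)))))) (c (.inl (.inl (.inl (.inr (.inl ()))))))
        (fun i => c (.inl (.inl (.inl (.inr (.inr (.inl i))))))) 
        (fun i => c (.inl (.inl (.inl (.inr (.inr (.inr i))))))) (fun i => c (.inl (.inr i))) :
        Instrument (Fin B.zLen) (Fin B.vLen) (SimReg B) (Fin B.outLen ⊕ Fin B.memLen)) := by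
  obtain ⟨Ts, hs, hs0, hs1⟩ := exists_split (ι := Fin B.eLen)
  have h1 := (realizable_prep B).andThen hs fun _ => .inr (.inl ())
  have h2 := h1.call B.partition.realizable
    (Sum.elim (Sum.elim (fun i => .inl (.inr (.inr (.inl i)))) fun i => .inl (.inr (.inr (.inr i))))
      fun i => .inl (.inl (.inr i))) (Equiv.refl _)
  have h3 := h2.call B.onAbort.realizable
    (Sum.elim (fun i => .inl (.inl (.inr (.inr (.inl i)))))
      fun i => .inl (.inl (.inr (.inr (.inr i))))) (Equiv.sumComm _ _)
  refine (h3.mono (by simp; omega)).congr fun z σ c => ?_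
  have hT : ∀ (a : Bool) (ρ : Op (Fin B.eLen)) (d : Empty → Bool), Ts (fun _ => a) ρ d =
      tensorOp (if a then zeroOp _ else ρ) (if a then ρ else zeroOp _) := fun a ρ d => by
    cases a
    · exact hs0 _ _
    · exact hs1 _ _
  rw [simState, B.onAbort.realizable.callInstr_tensorOp _ _ (by
    rw [B.partition.realizable.callInstr_tensorOp _ _ (by rw [relabel_refl, hT]),
      relabel_sumComm_tensorOp])]
  congr 2
  · funext i
    rcases i with i | i <;> rfl
  · funext i
    exact i.elim
  · funext i
    rcases i with (i | i) | i <;> rfl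

theorem randInstr_smul {CI CO Ω QO : Type} [Fintype CO] [DecidableEq CO] [Fintype Ω] (p : Ω → ℝ)
    (F : (CI → Bool) → Ω → CO → Bool) (x : CI → Bool) (c : CO → Bool) (A : Op QO) :
    (randInstr p F x 1 c Empty.elim Empty.elim) • A = ∑ ω, if c = F x ω then p ω • A else 0 := by
  rw [randInstr, Matrix.sum_apply, Finset.sum_smul]
  refine Finset.sum_congr rfl fun ω _ => ?_
  split_ifs
  · ext; simp
  · simp

theorem sum_bits_sum {A B V : Type} [Fintype A] [DecidableEq A] [Fintype B] [DecidableEq B]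
    [AddCommMonoid V] (f : (A ⊕ B → Bool) → V) : ∑ m, f m = ∑ a, ∑ b, f (Sum.elim a b) := by
  rw [← (Equiv.sumArrowEquivProdArrow A B Bool).symm.sum_comp, Fintype.sum_prod_type]
  rfl

theorem sum_bits_unit {V : Type} [AddCommMonoid V] (f : (Unit → Bool) → V) :
    ∑ m, f m = ∑ a, f fun _ => a :=
  (Equiv.sum_comp (Equiv.funUnique Unit Bool).symm f).symm

theorem sum_simReg (B : DishonestBob n l r) {V : Type} [AddCommMonoid V]
    (f : (SimReg B → Bool) → V) : ∑ m, f m = ∑ x : Bits n, ∑ θ : Bits n, ∑ a : Bool,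
      ∑ θ' : Bits n, ∑ w : Bits B.wLen, ∑ J : Bits n, f (Sum.elim (Sum.elim (Sum.elim (Sum.elim
        (Sum.elim x θ) (Sum.elim (fun _ => a) (Sum.elim θ' w))) Empty.elim) J) Empty.elim) := by
  simp only [sum_bits_sum, Fintype.sum_unique, sum_bits_unit]
  simp only [Unique.eq_default]

/-- An `IdealBob` keeps only qubits across the query, so flag, indicator of `k`, keys, masks and
random string are stored as basis states, and `k` is the only classical output. -/
theorem exists_query {ℓ : ℕ → ℕ} (H : HashFamily ℓ) (B : DishonestBob n (ℓ n) (H.keyLen n)) {th : ℕ}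
    (t : ℕ)
    (hs : ∃ C : Circuit Empty Empty (Fin (H.keyLen n)) Empty, C.time ≤ th ∧
      ∀ κ, C.run Empty.elim 1 κ = if κ ∈ H.keys n then ((H.keys n).card : ℝ)⁻¹ • 1 else 0)
    (hh : ∃ C : Circuit (Fin (H.keyLen n) ⊕ (Fin n ⊕ Fin n)) Empty (Fin (ℓ n)) Empty,
      C.time ≤ th ∧ ∀ κ ∈ H.keys n, ∀ (I : Finset (Fin n)) (x : Bits n),
        C.run (Sum.elim κ (Sum.elim (fun i => decide (i ∈ I)) x)) 1
          (H.hash n κ I (I.restrict x)) = 1) :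
    ∃ C : Circuit (Fin B.zLen) (Fin B.vLen) Unit
        (Fin (Fintype.card (SimData (H.keyLen n) (ℓ n) ⊕ (Fin B.outLen ⊕ Fin B.memLen)))),
      C.time ≤ B.zLen + B.vLen + 8 * n + 2 * B.prep.time + 8 * B.eLen + 2 * B.partition.time +
        2 * B.onAbort.time + 2 * (4 * n + 1 + B.wLen + 8 * th + 8 * ℓ n + 40 * n +
        2 * (n + 1 + 8 * (t + 1) + n * (8 * (n + 2 * t + 3)) + 8) +
        (32 + 16 * H.keyLen n + 24 * ℓ n)) + 2 * (3 + 2 * H.keyLen n + 3 * ℓ n) ∧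
      ∀ z σ k, C.run z σ k = relabel (Fintype.equivFin _) (diagOp fun d : SimData _ _ → Bool =>
        ∑ x : Bits n, ∑ θ : Bits n, ∑ a : Bool, ∑ θ' : Bits n, ∑ w : Bits B.wLen, ∑ J : Bits n,
          ∑ ω : SimCoins (H.keyLen n) (ℓ n),
            if Sum.elim k d = Sum.elim (fun _ => simChoice t θ θ' J) (simData a (simChoice t θ θ' J)
              (keyPair ω.1.1.2 ω.1.2) (hashMask H (keyPair ω.1.1.2 ω.1.2) J x) ω.2) then
              (1 * keyProb H n ω.1.1.2 * keyProb H n ω.1.2 * (1 / 2) ^ ℓ n) •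
                simState B z σ x θ a θ' w J else 0) := by
  have h1 := (realizable_simState B).stepClassical (realizable_simClassical H t hs hh
    (C2 := SimReg B) (.inl (.inl (.inl (.inr (.inl ())))))
    (fun i => .inl (.inl (.inl (.inl (.inl i))))) (fun i => .inl (.inl (.inl (.inl (.inr i)))))
    (fun i => .inl (.inl (.inl (.inr (.inr (.inl i)))))) fun i => .inl (.inr i)) id
  have h2 := h1.discardC (Equiv.sumComm _ _)
  have h3 := h2.toQuantum
  have h4 := h3.relabelQ (Fintype.equivFin _)
  obtain ⟨C, hC, hr⟩ := h4
  refine ⟨C, hC.trans ?_, fun z σ k => ?_⟩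
  · simp only [Fintype.card_sum, Fintype.card_prod, Fintype.card_bool, Fintype.card_fin,
      Fintype.card_unit, Fintype.card_empty]
    omega
  · refine (hr z σ k).trans (congrArg _ (congrArg _ (funext fun d => ?_)))
    simp only [randInstr_smul]
    exact sum_simReg B _

/-- The stored data are classical, so by linearity each random path `p` contributes only at its own
query and its own data. -/
theorem sum_ite_reply {l : ℕ} {D QI QO P : Type} [Fintype D] [DecidableEq D] [Fintype QI] [DecidableEq QI]
    [Fintype QO] [DecidableEq QO] [Fintype P] {t : ℕ} {T : Instrument (Fin l ⊕ D) QI Empty QO}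
    (hT : Realizable t T) (s : Bool → Bits l) (k : P → Bool) (d : P → D → Bool) (q : P → ℝ)
    (A : P → Op QI) :
    ∑ k', ∑ d', T (Sum.elim (s k') d') (∑ p, if Sum.elim (fun _ : Unit => k') d' =
      Sum.elim (fun _ => k p) (d p) then q p • A p else 0) Empty.elim =
        ∑ p, q p • T (Sum.elim (s (k p)) (d p)) (A p) Empty.elim := by
  obtain ⟨C, -, hr⟩ := hT
  simp only [← hr, C.run_sum, Sum.elim_eq_iff]
  simp only [Finset.sum_comm (s := Finset.univ) (t := (Finset.univ : Finset P))]
  refine Finset.sum_congr rfl fun p _ => ?_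
  rw [Fintype.sum_eq_single (k p), Fintype.sum_eq_single (d p), if_pos ⟨rfl, rfl⟩, C.run_real_smul]
  · intro d' hd
    rw [if_neg (fun h => hd h.2), C.run_zero]
  · intro k' hk
    refine Finset.sum_eq_zero fun d' _ => ?_
    rw [if_neg (fun h => hk (congrFun h.1 ())), C.run_zero]

theorem trace_run_empty {CI QI QO : Type} [Fintype CI] [DecidableEq CI] [Fintype QI] [DecidableEq QI]
    [Fintype QO] [DecidableEq QO] (C : Circuit CI QI Empty QO) (x : CI → Bool) (ρ : Op QI) :
    (C.run x ρ Empty.elim).trace = ρ.trace := by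
  rw [← C.sum_trace_run x ρ,
    Fintype.sum_eq_single Empty.elim fun c hc => absurd (Subsingleton.elim c Empty.elim) hc]

/-- Strings outside `H.keys n` have weight zero, which reduces the sum over all samples to the one
over `piFinset` in the real experiment. -/
theorem sum_simCoins {ℓ : ℕ → ℕ} (H : HashFamily ℓ) {V : Type} [AddCommGroup V] [Module ℝ V]
    (f : (Bool → Bits (H.keyLen n)) → Bits (ℓ n) → V) :
    ∑ ω : SimCoins (H.keyLen n) (ℓ n),
      (1 * keyProb H n ω.1.1.2 * keyProb H n ω.1.2 * (1 / 2) ^ ℓ n) • f (keyPair ω.1.1.2 ω.1.2) ω.2 =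
    ∑ κ ∈ Fintype.piFinset (fun _ : Bool => H.keys n), (((H.keys n).card : ℝ) ^ 2)⁻¹ •
      ∑ u, ((1 / 2 : ℝ) ^ ℓ n) • f κ u := by
  have h1 : ∀ κ : Bool → Bits (H.keyLen n), keyProb H n (κ false) * keyProb H n (κ true) =
      if κ ∈ Fintype.piFinset (fun _ : Bool => H.keys n) then (((H.keys n).card : ℝ) ^ 2)⁻¹ else 0 :=
    fun κ => by
      rw [keyProb, keyProb]
      simp only [Fintype.mem_piFinset, Bool.forall_bool]
      by_cases h : κ false ∈ H.keys n <;> by_cases h' : κ true ∈ H.keys n <;> simp [h, h', pow_two]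
  have h2 : ∀ g : (Bool → Bits (H.keyLen n)) → V, ∑ κ0, ∑ κ1, g (keyPair κ0 κ1) = ∑ κ, g κ :=
    fun g => by
      rw [← Fintype.sum_prod_type', ← (Equiv.boolArrowEquivProd _).symm.sum_comp]
      refine Finset.sum_congr rfl fun p _ => congrArg g ?_
      funext b
      cases b <;> rfl
  simp only [Fintype.sum_prod_type, Fintype.sum_unique, one_mul]
  refine (h2 fun κ => ∑ u, (keyProb H n (κ false) * keyProb H n (κ true) * (1 / 2) ^ ℓ n) •
    f κ u).trans ?_
  rw [← Finset.univ_inter (Fintype.piFinset fun _ : Bool => H.keys n), ← Finset.sum_ite_mem]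
  refine Finset.sum_congr rfl fun κ _ => ?_
  rw [h1]
  split_ifs
  · simp only [mul_smul, Finset.smul_sum]
  · simp

end Query

/-! ### The ideal-world adversary -/

section Simulator

variable {ℓ : ℕ → ℕ} {n : ℕ}

/-- Every register length, including those of the messages, is at most the number of wires of some
circuit that reads or writes it; so the overhead of the simulator is bounded in terms of `B.time`.
-/
theorem DishonestBob.le_time {l r : ℕ} (B : DishonestBob n l r) :
    B.zLen + (n + B.vLen) ≤ B.prep.time ∧ 1 + (n + B.wLen) ≤ B.prep.time ∧
      B.eLen ≤ B.onAbort.time ∧ 2 * r + 2 * l ≤ B.finish.time ∧ B.memLen ≤ B.finish.time ∧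
        B.outLen ≤ B.finish.time := by
  have h1 := Fintype.card_congr B.prep.layout
  have h2 := Fintype.card_congr B.finish.layout
  simp only [Fintype.card_sum, Fintype.card_prod, Fintype.card_bool, Fintype.card_fin,
    Fintype.card_unit, Fintype.card_empty] at h1 h2
  simp only [Circuit.time, Fintype.card_sum, Fintype.card_prod, Fintype.card_bool,
    Fintype.card_fin]
  omega

/-- The output of the ideal experiment with the simulator, for fixed inputs and as a function of the
state after the preparation phase. -/
def simOut (H : HashFamily ℓ) (B : DishonestBob n (ℓ n) (H.keyLen n)) (t : ℕ)
    (s : Bool → Bits (ℓ n)) (τ : Bits n → Bits n → Bool → Bits n → Bits B.wLen → Op (Fin B.eLen)) :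
    Op (Fin B.outLen) :=
  ∑ x, ∑ θ, ∑ θ', ∑ w,
    (B.onAbort.run (Sum.elim θ' w) (τ x θ true θ' w) Empty.elim +
      ∑ J : Bits n, ∑ κ ∈ Fintype.piFinset (fun _ : Bool => H.keys n),
        (((H.keys n).card : ℝ) ^ 2)⁻¹ • ∑ u, ((1 / 2 : ℝ) ^ ℓ n) •
          simFinish B (s (simChoice t θ θ' J)) (simChoice t θ θ' J) κ (hashMask H κ J x) u
            (B.partition.run (Sum.elim (Sum.elim θ' w) θ) (τ x θ false θ' w) J))

theorem sum_coins_const {H : HashFamily ℓ} {V : Type} [AddCommGroup V] [Module ℝ V] (v : V) :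
    ∑ _κ ∈ Fintype.piFinset (fun _ : Bool => H.keys n), (((H.keys n).card : ℝ) ^ 2)⁻¹ •
      ∑ _u : Bits (ℓ n), ((1 / 2 : ℝ) ^ ℓ n) • v = v := by
  have : ((H.keys n).card : ℝ) ≠ 0 := by
    exact_mod_cast (Finset.card_pos.2 (H.keys_nonempty n)).ne'
  simp only [Finset.sum_const, Finset.card_univ, Fintype.card_piFinset, Fintype.card_pi,
    Fintype.card_bool, Finset.prod_const, Fintype.card_fin, ← Nat.cast_smul_eq_nsmul ℝ, smul_smul]
  push_cast
  have h2 : (2 : ℝ) ^ ℓ n * (1 / 2) ^ ℓ n = 1 := by rw [← mul_pow]; norm_num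
  rw [h2, mul_one, mul_inv_cancel₀ (pow_ne_zero _ this), one_smul]

/-- The quadratic term comes from counting: `n` rounds with a number of gates linear in `n`, as `t ≤
n`. Everything else is linear in `B.time` and in the size `th` of the hash circuits. -/
theorem exists_simulator (H : HashFamily ℓ) (B : DishonestBob n (ℓ n) (H.keyLen n)) {th : ℕ}
    {t : ℕ} (ht : t ≤ n)
    (hs : ∃ C : Circuit Empty Empty (Fin (H.keyLen n)) Empty, C.time ≤ th ∧
      ∀ κ, C.run Empty.elim 1 κ = if κ ∈ H.keys n then ((H.keys n).card : ℝ)⁻¹ • 1 else 0)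
    (hh : ∃ C : Circuit (Fin (H.keyLen n) ⊕ (Fin n ⊕ Fin n)) Empty (Fin (ℓ n)) Empty,
      C.time ≤ th ∧ ∀ κ ∈ H.keys n, ∀ (I : Finset (Fin n)) (x : Bits n),
        C.run (Sum.elim κ (Sum.elim (fun i => decide (i ∈ I)) x)) 1
          (H.hash n κ I (I.restrict x)) = 1) :
    ∃ S : IdealBob (ℓ n) B.zLen B.vLen B.outLen,
      S.time ≤ 100 * B.time ^ 2 + 2000 * B.time + 16 * th + 400 ∧
      ∀ (inp : LegitInput (ℓ n) B.zLen B.vLen) s z, S.idealOut inp (s, z) =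
        (inp.prob (s, z)).toReal • simOut H B t s (B.prepGiven z (inp.state z)) := by
  obtain ⟨Q, hQ, hQr⟩ := exists_query H B t hs hh
  obtain ⟨T, hT, hTr⟩ := exists_reply B
  obtain ⟨R, hR, hRr⟩ := Realizable.fromQuantum hT (Fintype.equivFin _)
  refine ⟨⟨_, Q, R⟩, ?_, fun inp s z => ?_⟩
  · obtain ⟨h1, h2, h3, h4, h5, h6⟩ := B.le_time
    have h7 : B.time = B.prep.time + B.onAbort.time + B.partition.time + B.finish.time := rfl
    have h8 : n * (8 * (n + 2 * t + 3)) ≤ B.time * (8 * (3 * B.time + 3)) :=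
      Nat.mul_le_mul (by omega) (by omega)
    have h9 : B.time * (8 * (3 * B.time + 3)) = 24 * B.time ^ 2 + 24 * B.time := by ring
    change Q.time + R.time ≤ _
    generalize B.time ^ 2 = N2 at *
    omega
  · rw [IdealBob.idealOut]
    congr 1
    simp only [otFunctionality, hQr, hRr]
    have hP := sum_ite_reply hT s
      (P := Bits n × Bits n × Bool × Bits n × Bits B.wLen × Bits n × SimCoins (H.keyLen n) (ℓ n))
      (fun (x, θ, a, θ', w, J, ω) => simChoice t θ θ' J)
      (fun (x, θ, a, θ', w, J, ω) => simData a (simChoice t θ θ' J) (keyPair ω.1.1.2 ω.1.2)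
        (hashMask H (keyPair ω.1.1.2 ω.1.2) J x) ω.2)
      (fun (x, θ, a, θ', w, J, ω) =>
        1 * keyProb H n ω.1.1.2 * keyProb H n ω.1.2 * (1 / 2) ^ ℓ n)
      (fun (x, θ, a, θ', w, J, ω) => simState B z (inp.state z) x θ a θ' w J)
    refine (Finset.sum_congr rfl fun k' _ => Finset.sum_congr rfl fun d' _ =>
      congrArg (fun A => T _ A Empty.elim) ?_).trans (hP.trans ?_)
    · simp only [Fintype.sum_prod_type]
    clear hP
    rw [simOut, Fintype.sum_prod_type]
    refine Finset.sum_congr rfl fun x _ => ?_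
    rw [Fintype.sum_prod_type]
    refine Finset.sum_congr rfl fun θ _ => ?_
    rw [Fintype.sum_prod_type, Fintype.sum_bool, Fintype.sum_prod_type, Fintype.sum_prod_type]
    simp only [Finset.sum_add_distrib]
    congr 1
    · refine Finset.sum_congr rfl fun θ' _ => ?_
      rw [Fintype.sum_prod_type]
      refine Finset.sum_congr rfl fun w _ => ?_
      rw [Fintype.sum_prod_type]
      simp only [simState, hTr, if_true]
      -- In the abort branch `finish` acts on a dummy and is discarded. Trace preservation removes
      -- its dependence on the messages, after which the coins and then `J` sum to weight one.
      have hf : ∀ J k κ h u, (simFinish B (s k) k κ h u (B.partition.run (Sum.elim (Sum.elim θ' w) θ)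
          (zeroOp _) J)).trace = (B.partition.run (Sum.elim (Sum.elim θ' w) θ) (zeroOp _) J).trace :=
        fun J k κ h u => trace_run_empty _ _ _
      simp only [hf]
      refine (Finset.sum_congr rfl fun J _ => (sum_simCoins H (fun _ _ => (B.partition.run
        (Sum.elim (Sum.elim θ' w) θ) (zeroOp _) J).trace • B.onAbort.run (Sum.elim θ' w)
          (B.prepGiven z (inp.state z) x θ true θ' w) Empty.elim)).trans
            (sum_coins_const _)).trans ?_
      rw [← Finset.sum_smul, B.partition.sum_trace_run, zeroOp_trace, one_smul]
    · refine Finset.sum_congr rfl fun θ' _ => ?_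
      rw [Fintype.sum_prod_type]
      refine Finset.sum_congr rfl fun w _ => ?_
      rw [Fintype.sum_prod_type]
      refine Finset.sum_congr rfl fun J _ => ?_
      simp only [simState, hTr, Bool.false_eq_true, if_false, trace_run_empty, zeroOp_trace, one_smul]
      exact sum_simCoins H fun κ u => simFinish B (s (simChoice t θ θ' J)) (simChoice t θ θ' J) κ
        (hashMask H κ J x) u (B.partition.run (Sum.elim (Sum.elim θ' w) θ)
          (B.prepGiven z (inp.state z) x θ false θ' w) J)

end Simulator

/-! ### Privacy amplification against a circuit -/

section Amplification

variable {QI CI CO QO : Type} [Fintype CI] [DecidableEq CI] [Fintype QI] [DecidableEq QI]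
  [Fintype CO] [DecidableEq CO] [Fintype QO] [DecidableEq QO]

/-- A family of states with pointwise purifications of low rank, as the image of pure states on a
space of low dimension. -/
theorem exists_pure_family {X ι : Type} [Fintype X] [Fintype ι] [DecidableEq ι] {τ : X → Matrix ι ι ℂ}
    (hτ : ∀ x, (τ x).PosSemidef) (hτ0 : 0 < ∑ x, (τ x).trace.re) {d : ℕ} {ψ : X → ι × Fin d → ℂ}
    (hψ : IsPointwisePurification (fun x => (τ x).trace.re / ∑ x', (τ x').trace.re)
      (fun x => ((τ x).trace.re)⁻¹ • τ x) ψ) :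
    ∃ (D : Type) (_ : Fintype D) (_ : DecidableEq D) (B : Fin d → Matrix ι D ℂ) (χ : X → D → ℂ),
      Fintype.card D = (mixture (fun x => (τ x).trace.re / ∑ x', (τ x').trace.re) ψ).rank ∧
      ∑ r, (B r)ᴴ * B r = 1 ∧ (∀ x, τ x = ∑ r, B r * vecMulVec (χ x) (star (χ x)) * (B r)ᴴ) ∧
      ∀ x, (star (χ x) ⬝ᵥ χ x).re = (τ x).trace.re := by
  have hq : ∀ x, 0 ≤ (τ x).trace.re := fun x => trace_re_nonneg (hτ x)
  obtain ⟨D, _, _, B, φ, hD, hB, hφ⟩ := exists_isometry_of_mixture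
    (P := fun x => (τ x).trace.re / ∑ x', (τ x').trace.re) (fun x => div_nonneg (hq x) hτ0.le) ψ
  -- The slices of the isometry along the basis states of the purifying register are the Kraus
  -- operators of tracing it out.
  have hB1 : ∑ r, (B.submatrix (fun i => (i, r)) id)ᴴ * B.submatrix (fun i => (i, r)) id = 1 := by
    rw [← hB]
    ext i j
    simp only [Matrix.sum_apply, mul_apply, conjTranspose_apply, submatrix_apply, id]
    rw [Fintype.sum_prod_type, Finset.sum_comm]
  have hτe : ∀ x, τ x = ∑ r, B.submatrix (fun i => (i, r)) id *
      vecMulVec ((√(τ x).trace.re : ℂ) • φ x) (star ((√(τ x).trace.re : ℂ) • φ x)) *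
        (B.submatrix (fun i => (i, r)) id)ᴴ := fun x => by
    -- Nothing is known about `ψ x` at probability zero, but the factor `√0` removes the vector
    -- there.
    by_cases hx : (τ x).trace.re = 0
    · have h0 : τ x = 0 := (hτ x).trace_eq_zero_iff.1 (by rw [posSemidef_trace_eq_re (hτ x), hx]; simp)
      rw [h0]
      simp
    · ext i j
      have h1 : ∑ r, ψ x (i, r) * star (ψ x (j, r)) = ((τ x).trace.re⁻¹ • τ x) i j :=
        hψ x (div_ne_zero hx hτ0.ne') i j
      have h2 := hφ x (div_ne_zero hx hτ0.ne')
      rw [Matrix.smul_apply] at h1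
      have h3 : τ x i j = (τ x).trace.re • ∑ r, ψ x (i, r) * star (ψ x (j, r)) := by
        rw [h1, smul_smul, mul_inv_cancel₀ hx, one_smul]
      rw [h3, Matrix.sum_apply, Finset.smul_sum]
      refine Finset.sum_congr rfl fun r _ => ?_
      rw [mul_vecMulVec, vecMulVec_mul, vecMulVec_apply, h2, ← star_mulVec]
      have h4 : (√(τ x).trace.re : ℂ) * (√(τ x).trace.re : ℂ) = ((τ x).trace.re : ℂ) := by
        rw [← Complex.ofReal_mul, Real.mul_self_sqrt (hq x)]
      simp only [mulVec_smul, Pi.smul_apply, Pi.star_apply, smul_eq_mul, star_mul', Complex.real_smul,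
        Complex.star_def, Complex.conj_ofReal]
      rw [← h4]
      change _ * ((B *ᵥ φ x) (i, r) * _) = _ * (B *ᵥ φ x) (i, r) * (_ * _)
      rw [mul_mul_mul_comm]
      rfl
  refine ⟨D, _, _, fun r => B.submatrix (fun i => (i, r)) id,
    fun x => (√(τ x).trace.re : ℂ) • φ x, hD, hB1, hτe, fun x => ?_⟩
  conv_rhs => rw [hτe x]
  simp only [trace_sum, trace_mul_comm _ (_ᴴ), ← Matrix.mul_assoc]
  rw [← trace_sum, ← Matrix.sum_mul, hB1, Matrix.one_mul, trace_vecMulVec, dotProduct_comm]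

/-- The garbage `g` and the purifying index `r` are treated as additional outcomes besides `J`,
while the hashed part depends on `J` alone. Summing over `g` and `r` afterwards is covered by the
triangle inequality. -/
theorem Circuit.privacyAmplification (C : Circuit CI QI CO QO) (ci : CI → Bool) {X K V : Type}
    {Y Z : (CO → Bool) → Type} [Fintype X] [∀ j, Fintype (Y j)] [∀ j, DecidableEq (Y j)]
    [∀ j, Fintype (Z j)] [Fintype V] [DecidableEq V] [Nonempty V] (keys : Finset K)
    (f : ∀ j, K → Y j → V) (hf : ∀ j y y', y ≠ y' →
      (keys.filter fun κ => f j κ y = f j κ y').card * Fintype.card V ≤ keys.card)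
    (e : ∀ j, Y j × Z j ≃ X) {τ : X → Op QI} (hτ : ∀ x, (τ x).PosSemidef)
    (hτ0 : 0 < ∑ x, (τ x).trace.re) {d : ℕ} {ψ : X → (QI → Bool) × Fin d → ℂ}
    (hψ : IsPointwisePurification (fun x => (τ x).trace.re / ∑ x', (τ x').trace.re)
      (fun x => ((τ x).trace.re)⁻¹ • τ x) ψ) {ε : ℝ} (hε : 0 ≤ ε)
    (hχ : ∀ j y c, (τ (e j (y, c))).trace.re ≤ ε * ∑ y', (τ (e j (y', c))).trace.re) :
    ∑ J, ∑ κ ∈ keys, ∑ c, ∑ v : V, traceNorm (C.run ci (∑ y, ((if f J κ y = v then 1 else 0) -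
        (Fintype.card V : ℝ)⁻¹) • τ (e J (y, c))) J) ≤
      keys.card * (√(Fintype.card V *
        (mixture (fun x => (τ x).trace.re / ∑ x', (τ x').trace.re) ψ).rank * ε) *
          ∑ x, (τ x).trace.re) := by
  obtain ⟨D, _, _, B, χ, hD, hB, hτe, hχ'⟩ := exists_pure_family hτ hτ0 hψ
  have hM : ∑ j : (CO → Bool) × (Fin C.garbage → Bool) × Fin d,
      (C.kraus ci j.1 j.2.1 * B j.2.2)ᴴ * (C.kraus ci j.1 j.2.1 * B j.2.2) = 1 := by
    rw [← hB, Fintype.sum_prod_type]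
    simp only [Fintype.sum_prod_type]
    rw [Finset.sum_congr rfl fun J _ => Finset.sum_comm, Finset.sum_comm]
    refine Finset.sum_congr rfl fun r _ => ?_
    have := C.sum_kraus ci
    calc _ = (B r)ᴴ * (∑ c, ∑ g, (C.kraus ci c g)ᴴ * C.kraus ci c g) * B r := by
          simp only [Matrix.mul_sum, Matrix.sum_mul, conjTranspose_mul, Matrix.mul_assoc]
      _ = _ := by rw [this, Matrix.mul_one]
  have h := QOT.privacyAmplification (J := (CO → Bool) × (Fin C.garbage → Bool) × Fin d)
    (Y := fun j => Y j.1) (C := fun j => Z j.1) keys (fun j => f j.1) (fun j => hf j.1) (fun j => e j.1) χ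
    (fun j => C.kraus ci j.1 j.2.1 * B j.2.2) hM hε (fun j y c => by
      simp only [hχ']; exact hχ j.1 y c)
  simp only [hχ', hD] at h
  refine le_trans ?_ h
  rw [Fintype.sum_prod_type]
  refine Finset.sum_le_sum fun J _ => ?_
  have hcomm : ∀ F : (Fin C.garbage → Bool) × Fin d → K → (Z J → V → ℝ),
      ∑ j, ∑ κ ∈ keys, ∑ c, ∑ v, F j κ c v = ∑ κ ∈ keys, ∑ c, ∑ v, ∑ j, F j κ c v := fun F => by
    rw [Finset.sum_comm]
    refine Finset.sum_congr rfl fun κ _ => ?_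
    rw [Finset.sum_comm]
    refine Finset.sum_congr rfl fun c _ => ?_
    rw [Finset.sum_comm]
  rw [hcomm]
  refine Finset.sum_le_sum fun κ _ => Finset.sum_le_sum fun c _ => Finset.sum_le_sum fun v _ => ?_
  have hH : ∀ j : (Fin C.garbage → Bool) × Fin d,
      (C.kraus ci J j.1 * B j.2 * (∑ y, ((if f J κ y = v then 1 else 0) - (Fintype.card V : ℝ)⁻¹) •
        vecMulVec (χ (e J (y, c))) (star (χ (e J (y, c))))) * (C.kraus ci J j.1 * B j.2)ᴴ).IsHermitian :=
    fun j => isHermitian_mul_mul_conjTranspose _ (isHermitian_sum _ fun y _ =>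
      isHermitian_real_smul (vecMulVec_star_isHermitian _) _)
  refine le_trans (le_of_eq (congrArg traceNorm ?_)) (traceNorm_sum_le _ fun j _ => hH j)
  rw [C.run_eq, Fintype.sum_prod_type]
  refine Finset.sum_congr rfl fun g _ => ?_
  simp only [hτe, Matrix.mul_sum, Matrix.sum_mul, Finset.smul_sum, Matrix.mul_smul, Matrix.smul_mul,
    conjTranspose_mul, Matrix.mul_assoc]
  exact Finset.sum_comm

end Amplification

/-! ### The difference between the real experiment and the simulation -/

section Difference

variable {CI QI CO QO : Type} [Fintype CI] [DecidableEq CI] [Fintype QI] [DecidableEq QI]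
  [Fintype CO] [DecidableEq CO] [Fintype QO] [DecidableEq QO]

theorem Circuit.sum_traceNorm_run_le (C : Circuit CI QI CO QO) (x : CI → Bool) {A : Op QI}
    (hA : A.IsHermitian) : ∑ c, traceNorm (C.run x A c) ≤ traceNorm A :=
  sum_traceNorm_map_le _ (fun c A => C.run x A c) (fun c A B => C.run_sub x A B c)
    (fun c _ hA => C.run_posSemidef x hA c)
    (fun A _ => by rw [← Complex.re_sum, C.sum_trace_run]) hA

theorem Circuit.traceNorm_run_le (C : Circuit CI QI CO QO) (x : CI → Bool) {A : Op QI}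
    (hA : A.IsHermitian) (c : CO → Bool) : traceNorm (C.run x A c) ≤ traceNorm A :=
  (Finset.single_le_sum (f := fun c => traceNorm (C.run x A c)) (fun _ _ => traceNorm_nonneg _)
    (Finset.mem_univ c)).trans (C.sum_traceNorm_run_le x hA)

/-- Average over two keys. -/
theorem traceNorm_keyAverage_le {K ι : Type} [DecidableEq K] [Fintype ι] [DecidableEq ι] {keys : Finset K}
    {A : (Bool → K) → Matrix ι ι ℂ} (hA : ∀ κ, (A κ).IsHermitian) {g : (Bool → K) → ℝ}
    (hg : ∀ κ, traceNorm (A κ) ≤ g κ) :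
    traceNorm (∑ κ ∈ Fintype.piFinset (fun _ : Bool => keys), ((keys.card : ℝ) ^ 2)⁻¹ • A κ) ≤
      ((keys.card : ℝ) ^ 2)⁻¹ * ∑ κ ∈ Fintype.piFinset (fun _ : Bool => keys), g κ := by
  rw [Finset.mul_sum]
  refine (traceNorm_sum_le _ fun κ _ => isHermitian_real_smul (hA κ) _).trans ?_
  exact Finset.sum_le_sum fun κ _ => (traceNorm_smul_le (hA κ) (by positivity)).trans
    (mul_le_mul_of_nonneg_left (hg κ) (by positivity))

/-- Only the key of one half occurs in the bound; the other one averages out. -/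
theorem sum_piFinset_bool {K : Type} [DecidableEq K] {keys : Finset K} (hk : keys.Nonempty)
    (g : K → ℝ) (b : Bool) :
    ((keys.card : ℝ) ^ 2)⁻¹ * ∑ κ ∈ Fintype.piFinset (fun _ : Bool => keys), g (κ b) =
      (keys.card : ℝ)⁻¹ * ∑ κ ∈ keys, g κ := by
  have : (keys.card : ℝ) ≠ 0 := by exact_mod_cast (Finset.card_pos.2 hk).ne'
  rw [Fintype.sum_piFinset_apply g keys b, Fintype.card_bool, nsmul_eq_mul, ← mul_assoc]
  congr 1
  field_simp
  simp

variable {ℓ : ℕ → ℕ} {n : ℕ} (H : HashFamily ℓ) (B : DishonestBob n (ℓ n) (H.keyLen n))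

/-- The output of the receiver on the honest messages. -/
def realFinish (s : Bool → Bits (ℓ n)) (κ : Bool → Bits (H.keyLen n)) (h : Bool → Bits (ℓ n))
    (σ : Op (Fin B.memLen)) : Op (Fin B.outLen) :=
  B.finish.run (Sum.elim (Function.uncurry κ) (Function.uncurry fun b i => xor (s b i) (h b i))) σ
    Empty.elim

/-- The average output of the receiver on the messages of the simulator. -/
def simFinishAvg (s : Bool → Bits (ℓ n)) (k : Bool) (κ : Bool → Bits (H.keyLen n))
    (h : Bool → Bits (ℓ n)) (σ : Op (Fin B.memLen)) : Op (Fin B.outLen) :=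
  ∑ u, ((1 / 2 : ℝ) ^ ℓ n) • simFinish B (s k) k κ h u σ

theorem realFinish_isHermitian {s : Bool → Bits (ℓ n)} {κ h} {σ : Op (Fin B.memLen)}
    (hσ : σ.IsHermitian) : (realFinish H B s κ h σ).IsHermitian :=
  B.finish.run_isHermitian _ hσ _

theorem simFinishAvg_isHermitian {s : Bool → Bits (ℓ n)} {k κ h} {σ : Op (Fin B.memLen)}
    (hσ : σ.IsHermitian) : (simFinishAvg H B s k κ h σ).IsHermitian :=
  isHermitian_sum _ fun _ _ => isHermitian_real_smul (B.finish.run_isHermitian _ hσ _) _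

theorem traceNorm_realFinish_le {s : Bool → Bits (ℓ n)} {κ h} {σ : Op (Fin B.memLen)}
    (hσ : σ.IsHermitian) : traceNorm (realFinish H B s κ h σ) ≤ traceNorm σ :=
  B.finish.traceNorm_run_le _ hσ _

theorem traceNorm_simFinishAvg_le {s : Bool → Bits (ℓ n)} {k κ h} {σ : Op (Fin B.memLen)}
    (hσ : σ.IsHermitian) : traceNorm (simFinishAvg H B s k κ h σ) ≤ traceNorm σ := by
  refine (traceNorm_sum_le _ fun u _ =>
    isHermitian_real_smul (B.finish.run_isHermitian _ hσ _) _).trans ?_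
  refine (Finset.sum_le_sum fun u _ => (traceNorm_smul_le (B.finish.run_isHermitian _ hσ _)
    (by positivity)).trans (mul_le_mul_of_nonneg_left (B.finish.traceNorm_run_le _ hσ _)
      (by positivity))).trans ?_
  rw [Finset.sum_const, Finset.card_univ, nsmul_eq_mul, ← mul_assoc]
  have : (Fintype.card (Bits (ℓ n)) : ℝ) * (1 / 2) ^ ℓ n = 1 := by
    simp
  rw [this, one_mul]

/-- Strings, split into the parts inside and outside `I`. -/
def splitBits (I : Finset (Fin n)) : (I → Bool) × ({i // i ∉ I} → Bool) ≃ Bits n :=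
  (Equiv.piEquivPiSubtypeProd (· ∈ I) fun _ => Bool).symm

theorem restrict_splitBits (I : Finset (Fin n)) (y : I → Bool) (c : {i // i ∉ I} → Bool) :
    I.restrict (splitBits I (y, c)) = y := by
  funext i
  simp [splitBits, Equiv.piEquivPiSubtypeProd]

theorem glue_splitBits (I : Finset (Fin n)) (y y' : I → Bool) (c : {i // i ∉ I} → Bool) :
    glue I y' (splitBits I (y, c)) = splitBits I (y', c) := by
  funext i
  by_cases h : i ∈ I <;> simp [glue, splitBits, Equiv.piEquivPiSubtypeProd, h]

/-- The mask of `I_k` does not see the bits in `I_(1-k)`, so these may be set to `false` in it. -/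
theorem hashMask_splitBits (κ : Bool → Bits (H.keyLen n)) (J : Bits n) (k : Bool)
    (y : part J (!k) → Bool) (c : {i // i ∉ part J (!k)} → Bool) :
    hashMask H κ J (splitBits _ (y, c)) = fun b => if b = k then
      hashMask H κ J (splitBits _ (fun _ => false, c)) k else H.hash n (κ (!k)) (part J (!k)) y := by
  funext b
  by_cases hb : b = k
  · subst hb
    rw [if_pos rfl, hashMask, hashMask]
    congr 1
    funext i
    have hi : J i.1 = b := (Finset.mem_filter.1 i.2).2
    simp [splitBits, Equiv.piEquivPiSubtypeProd, hi]
  · obtain rfl : b = !k := by cases b <;> cases k <;> simp_all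
    rw [if_neg hb, hashMask, restrict_splitBits]

/-- One-time pad: the random string of the simulator can be written as `s_(1-k) ⊕ v` with `v`
uniform. The simulation is thus the real last step with a uniform mask `v`, and the difference
carries the weight "indicator of the hash value minus uniform". -/
theorem realFinish_sub_simFinishAvg (s : Bool → Bits (ℓ n)) (κ : Bool → Bits (H.keyLen n)) (J : Bits n)
    (k : Bool) (y : part J (!k) → Bool) (c : {i // i ∉ part J (!k)} → Bool)
    (σ : Op (Fin B.memLen)) :
    realFinish H B s κ (hashMask H κ J (splitBits _ (y, c))) σ -
      simFinishAvg H B s k κ (hashMask H κ J (splitBits _ (y, c))) σ =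
    ∑ v, ((if H.hash n (κ (!k)) (part J (!k)) y = v then 1 else 0) -
      (Fintype.card (Bits (ℓ n)) : ℝ)⁻¹) • realFinish H B s κ (fun b => if b = k then
        hashMask H κ J (splitBits _ (fun _ => false, c)) k else v) σ := by
  simp only [sub_smul, ite_smul, one_smul, zero_smul, Finset.sum_sub_distrib, Finset.sum_ite_eq,
    Finset.mem_univ, if_true]
  rw [hashMask_splitBits]
  congr 1
  rw [simFinishAvg]
  let π : Bits (ℓ n) ≃ Bits (ℓ n) :=
    Function.Involutive.toPerm (fun v i => xor (s (!k) i) (v i)) fun v => by funext i; simp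
  rw [← π.sum_comp]
  have hc : (1 / 2 : ℝ) ^ ℓ n = (Fintype.card (Bits (ℓ n)) : ℝ)⁻¹ := by simp
  rw [hc]
  refine Finset.sum_congr rfl fun v _ => congrArg (_ • ·) (congrArg
    (fun q => B.finish.run (Sum.elim (Function.uncurry κ) q) σ Empty.elim) (funext fun p => ?_))
  obtain ⟨b, i⟩ := p
  by_cases hb : b = k
  · simp [Function.uncurry, simMask, hb]
  · obtain rfl : b = !k := by cases b <;> cases k <;> simp_all
    simp [Function.uncurry, simMask, π]
    rfl

/-- For a fixed announcement and fixed keys, the difference of the two experiments is bounded by the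
distance of the hash value from uniform. -/
theorem traceNorm_sum_finish_sub_le (s : Bool → Bits (ℓ n)) (κ : Bool → Bits (H.keyLen n)) (J : Bits n)
    (k : Bool) {P : Bits n → Op (Fin B.memLen)} (hP : ∀ x, (P x).IsHermitian) :
    traceNorm (∑ x, (realFinish H B s κ (hashMask H κ J x) (P x) -
      simFinishAvg H B s k κ (hashMask H κ J x) (P x))) ≤
    ∑ c, ∑ v, traceNorm (∑ y, ((if H.hash n (κ (!k)) (part J (!k)) y = v then 1 else 0) -
      (Fintype.card (Bits (ℓ n)) : ℝ)⁻¹) • P (splitBits (part J (!k)) (y, c))) := by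
  have hH : ∀ c v, (∑ y, ((if H.hash n (κ (!k)) (part J (!k)) y = v then 1 else 0) -
      (Fintype.card (Bits (ℓ n)) : ℝ)⁻¹) • P (splitBits (part J (!k)) (y, c))).IsHermitian :=
    fun c v => isHermitian_sum _ fun y _ => isHermitian_real_smul (hP _) _
  -- For fixed `c` and `v` the messages do not depend on `y`, so the sum over `y` moves inside the
  -- circuit, which does not increase trace norms.
  have he : ∑ x, (realFinish H B s κ (hashMask H κ J x) (P x) -
      simFinishAvg H B s k κ (hashMask H κ J x) (P x)) =
      ∑ c, ∑ v, realFinish H B s κ (fun b => if b = k then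
        hashMask H κ J (splitBits (part J (!k)) (fun _ => false, c)) k else v)
          (∑ y, ((if H.hash n (κ (!k)) (part J (!k)) y = v then 1 else 0) -
      (Fintype.card (Bits (ℓ n)) : ℝ)⁻¹) • P (splitBits (part J (!k)) (y, c))) := by
    rw [← (splitBits (part J (!k))).sum_comp, Fintype.sum_prod_type_right]
    refine Finset.sum_congr rfl fun c _ => ?_
    simp only [realFinish_sub_simFinishAvg]
    rw [Finset.sum_comm]
    refine Finset.sum_congr rfl fun v _ => ?_
    rw [realFinish, Circuit.run_sum]
    refine Finset.sum_congr rfl fun y _ => ?_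
    rw [Circuit.run_real_smul]
    rfl
  rw [he]
  refine (traceNorm_sum_le _ fun c _ => isHermitian_sum _ fun v _ =>
    realFinish_isHermitian H B (hH c v)).trans (Finset.sum_le_sum fun c _ => ?_)
  refine (traceNorm_sum_le _ fun v _ => realFinish_isHermitian H B (hH c v)).trans
    (Finset.sum_le_sum fun v _ => traceNorm_realFinish_le H B (hH c v))

/-- The difference of the two experiments for fixed `θ`, `θ'`, `w`, as a function of the state `τ`
of `X` and `E` after a preparation phase without abort. -/
def branchDiff (t : ℕ) (s : Bool → Bits (ℓ n)) (θ θ' : Bits n) (w : Bits B.wLen)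
    (τ : Bits n → Op (Fin B.eLen)) : Op (Fin B.outLen) :=
  ∑ J : Bits n, ∑ κ ∈ Fintype.piFinset (fun _ : Bool => H.keys n), (((H.keys n).card : ℝ) ^ 2)⁻¹ •
    ∑ x, (realFinish H B s κ (hashMask H κ J x)
        (B.partition.run (Sum.elim (Sum.elim θ' w) θ) (τ x) J) -
      simFinishAvg H B s (simChoice t θ θ' J) κ (hashMask H κ J x)
        (B.partition.run (Sum.elim (Sum.elim θ' w) θ) (τ x) J))

theorem branchDiff_summand_isHermitian (s : Bool → Bits (ℓ n)) (κ : Bool → Bits (H.keyLen n))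
    (J : Bits n) (k : Bool) {P : Bits n → Op (Fin B.memLen)} (hP : ∀ x, (P x).IsHermitian) :
    (∑ x, (realFinish H B s κ (hashMask H κ J x) (P x) -
      simFinishAvg H B s k κ (hashMask H κ J x) (P x))).IsHermitian :=
  isHermitian_sum _ fun x _ =>
    (realFinish_isHermitian H B (hP x)).sub (simFinishAvg_isHermitian H B (hP x))

theorem branchDiff_isHermitian (t : ℕ) (s : Bool → Bits (ℓ n)) (θ θ' : Bits n) (w : Bits B.wLen)
    {τ : Bits n → Op (Fin B.eLen)} (hτ : ∀ x, (τ x).IsHermitian) :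
    (branchDiff H B t s θ θ' w τ).IsHermitian :=
  isHermitian_sum _ fun J _ => isHermitian_sum _ fun κ _ => isHermitian_real_smul
    (branchDiff_summand_isHermitian H B s κ J _ fun x => B.partition.run_isHermitian _ (hτ x) J) _

/-- No secrecy is used: each experiment contributes at most the norm of its state. The bound serves
for the improbable basis strings and for replacing the real state by `τ`. -/
theorem traceNorm_branchDiff_le (t : ℕ) (s : Bool → Bits (ℓ n)) (θ θ' : Bits n) (w : Bits B.wLen)
    {τ : Bits n → Op (Fin B.eLen)} (hτ : ∀ x, (τ x).IsHermitian) :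
    traceNorm (branchDiff H B t s θ θ' w τ) ≤ 2 * ∑ x, traceNorm (τ x) := by
  have hP : ∀ x J, (B.partition.run (Sum.elim (Sum.elim θ' w) θ) (τ x) J).IsHermitian :=
    fun x J => B.partition.run_isHermitian _ (hτ x) J
  have hc : ((H.keys n).card : ℝ) ≠ 0 := by
    exact_mod_cast (Finset.card_pos.2 (H.keys_nonempty n)).ne'
  calc _ ≤ ∑ J : Bits n, ∑ x, 2 * traceNorm (B.partition.run (Sum.elim (Sum.elim θ' w) θ) (τ x) J) := by
        refine (traceNorm_sum_le _ fun J _ => isHermitian_sum _ fun κ _ => isHermitian_real_smul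
          (branchDiff_summand_isHermitian H B s κ J _ fun x => hP x J) _).trans
            (Finset.sum_le_sum fun J _ => ?_)
        refine (traceNorm_keyAverage_le (g := fun _ => ∑ x, 2 * traceNorm (B.partition.run
          (Sum.elim (Sum.elim θ' w) θ) (τ x) J)) (fun κ => branchDiff_summand_isHermitian H B s κ J _
            fun x => hP x J) fun κ => ?_).trans_eq ?_
        · refine (traceNorm_sum_le _ fun x _ => (realFinish_isHermitian H B (hP x J)).sub
            (simFinishAvg_isHermitian H B (hP x J))).trans (Finset.sum_le_sum fun x _ => ?_)
          rw [sub_eq_add_neg, two_mul]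
          exact (traceNorm_add_le (realFinish_isHermitian H B (hP x J))
            (simFinishAvg_isHermitian H B (hP x J)).neg).trans
              (add_le_add (traceNorm_realFinish_le H B (hP x J))
                ((traceNorm_neg (simFinishAvg_isHermitian H B (hP x J))).trans
                  (traceNorm_simFinishAvg_le H B (hP x J))))
        · rw [Finset.sum_const, Fintype.card_piFinset]
          simp only [Finset.prod_const, Finset.card_univ, Fintype.card_bool, nsmul_eq_mul]
          push_cast
          rw [← mul_assoc, inv_mul_cancel₀ (pow_ne_zero _ hc), one_mul]
    _ ≤ _ := by
        rw [Finset.sum_comm, Finset.mul_sum]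
        refine Finset.sum_le_sum fun x _ => ?_
        rw [← Finset.mul_sum]
        exact mul_le_mul_of_nonneg_left (B.partition.sum_traceNorm_run_le _ (hτ x)) two_pos.le

/-- The privacy amplification bound. -/
theorem traceNorm_branchDiff_le_sqrt (hU : H.TwoUniversal) (t : ℕ) (s : Bool → Bits (ℓ n))
    (θ θ' : Bits n) (w : Bits B.wLen) {τ : Bits n → Op (Fin B.eLen)} (hτ : ∀ x, (τ x).PosSemidef)
    (hτ0 : 0 < ∑ x, (τ x).trace.re) {d : ℕ} {ψ : Bits n → Bits B.eLen × Fin d → ℂ}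
    (hψ : IsPointwisePurification (fun x => (τ x).trace.re / ∑ x', (τ x').trace.re)
      (fun x => ((τ x).trace.re)⁻¹ • τ x) ψ) {ε : ℝ} (hε : 0 ≤ ε)
    (hχ : ∀ J y c, (τ (splitBits (part J (!simChoice t θ θ' J)) (y, c))).trace.re ≤
      ε * ∑ y', (τ (splitBits (part J (!simChoice t θ θ' J)) (y', c))).trace.re) :
    traceNorm (branchDiff H B t s θ θ' w τ) ≤ √(2 ^ ℓ n *
      (mixture (fun x => (τ x).trace.re / ∑ x', (τ x').trace.re) ψ).rank * ε) *
        ∑ x, (τ x).trace.re := by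
  have hP : ∀ x J, (B.partition.run (Sum.elim (Sum.elim θ' w) θ) (τ x) J).IsHermitian :=
    fun x J => B.partition.run_isHermitian _ (hτ x).isHermitian J
  have hc : ((H.keys n).card : ℝ) ≠ 0 := by
    exact_mod_cast (Finset.card_pos.2 (H.keys_nonempty n)).ne'
  have hV : (Fintype.card (Bits (ℓ n)) : ℝ) = 2 ^ ℓ n := by simp
  have hpa := B.partition.privacyAmplification (Sum.elim (Sum.elim θ' w) θ) (V := Bits (ℓ n)) (H.keys n)
    (fun J κ y => H.hash n κ (part J (!simChoice t θ θ' J)) y)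
    (fun J y y' hy => by
      simpa using hU n (part J (!simChoice t θ θ' J)) y y' hy)
    (fun J => splitBits (part J (!simChoice t θ θ' J))) hτ hτ0 hψ hε hχ
  rw [hV] at hpa
  have hle : traceNorm (branchDiff H B t s θ θ' w τ) ≤ ((H.keys n).card : ℝ)⁻¹ *
      ∑ J, ∑ κ ∈ H.keys n, ∑ c, ∑ v : Bits (ℓ n), traceNorm (B.partition.run
        (Sum.elim (Sum.elim θ' w) θ) (∑ y, ((if H.hash n κ (part J (!simChoice t θ θ' J)) y = v
          then 1 else 0) - (2 ^ ℓ n : ℝ)⁻¹) • τ (splitBits (part J (!simChoice t θ θ' J)) (y, c))) J) := by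
    rw [Finset.mul_sum]
    refine (traceNorm_sum_le _ fun J _ => isHermitian_sum _ fun κ _ => isHermitian_real_smul
      (branchDiff_summand_isHermitian H B s κ J _ fun x => hP x J) _).trans
        (Finset.sum_le_sum fun J _ => ?_)
    refine (traceNorm_keyAverage_le (fun κ => branchDiff_summand_isHermitian H B s κ J _
      fun x => hP x J) fun κ => traceNorm_sum_finish_sub_le H B s κ J _ fun x => hP x J).trans_eq ?_
    refine (sum_piFinset_bool (H.keys_nonempty n) (fun κ => ∑ c, ∑ v, traceNorm (∑ y, ((if H.hash n κ
      (part J (!simChoice t θ θ' J)) y = v then 1 else 0) - (Fintype.card (Bits (ℓ n)) : ℝ)⁻¹) •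
        B.partition.run (Sum.elim (Sum.elim θ' w) θ)
          (τ (splitBits (part J (!simChoice t θ θ' J)) (y, c))) J)) (!simChoice t θ θ' J)).trans ?_
    simp only [hV, Circuit.run_sum, Circuit.run_real_smul]
  refine (hle.trans (mul_le_mul_of_nonneg_left hpa (by positivity))).trans_eq ?_
  rw [← mul_assoc, inv_mul_cancel₀ hc, one_mul]

end Difference

/-! ### The basis of the sender is independent of the guess of the receiver -/

section Guess

variable {n : ℕ}

theorem sum_bb84Qubit (t y y' : Bool) :
    ∑ b, bb84Qubit t b y * star (bb84Qubit t b y') = if y = y' then 1 else 0 := by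
  have h : ((√2 : ℝ) : ℂ) * ((√2 : ℝ) : ℂ) = 2 := by
    rw [← Complex.ofReal_mul, Real.mul_self_sqrt (by norm_num)]; norm_num
  have h2 : ((√2 : ℝ) : ℂ)⁻¹ * ((√2 : ℝ) : ℂ)⁻¹ = 1 / 2 := by rw [← mul_inv, h]; norm_num
  cases t <;> cases y <;> cases y' <;> simp [bb84Qubit, neg_div, h2]; norm_num

theorem sum_bb84Ket (θ s t : Bits n) :
    ∑ x, bb84Ket x θ s * star (bb84Ket x θ t) = if s = t then 1 else 0 := by
  have h : ∀ x : Bits n, bb84Ket x θ s * star (bb84Ket x θ t) =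
      ∏ i, bb84Qubit (θ i) (x i) (s i) * star (bb84Qubit (θ i) (x i) (t i)) := fun x => by
    rw [bb84Ket, bb84Ket, star_prod, Finset.prod_mul_distrib]
  simp only [h]
  rw [← Fintype.prod_sum (fun i b => bb84Qubit (θ i) b (s i) * star (bb84Qubit (θ i) b (t i)))]
  simp only [sum_bb84Qubit]
  rw [Finset.prod_ite_zero]
  simp [funext_iff]

/-- Averaged over `x`, the state sent does not depend on the basis. -/
theorem sum_bb84With {b : ℕ} (θ : Bits n) (σ : Op (Fin b)) :
    ∑ x, bb84With x θ σ = tensorOp 1 σ := by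
  ext s t
  rw [Matrix.sum_apply]
  simp only [bb84With, of_apply, ← Finset.sum_mul, sum_bb84Ket, tensorOp, one_apply]
  rfl

theorem trace_tensorOp {Q R : Type} [Fintype Q] [DecidableEq Q] [Fintype R] [DecidableEq R]
    (A : Op Q) (B : Op R) : (tensorOp A B).trace = A.trace * B.trace := by
  rw [trace, sum_bits_sum, trace, trace, Finset.sum_mul_sum]
  rfl

/-- The moment generating function of `n - 2 d`, a sum of independent signs over the positions. -/
theorem hammingDist_sum_exp (θ' : Bits n) (c : ℝ) :
    ∑ θ : Bits n, Real.exp (c * (n - 2 * hammingDist θ θ')) = (2 * Real.cosh c) ^ n := by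
  have h : ∀ θ : Bits n, Real.exp (c * (n - 2 * hammingDist θ θ')) =
      ∏ i, Real.exp (if θ i = θ' i then c else -c) := fun θ => by
    rw [← Real.exp_sum]
    congr 1
    have h1 : ∀ i, (if θ i = θ' i then c else -c) = c - 2 * c * (if θ i ≠ θ' i then 1 else 0) :=
      fun i => by by_cases h : θ i = θ' i <;> simp [h]; ring
    simp only [h1]
    rw [Finset.sum_sub_distrib, ← Finset.mul_sum, Finset.sum_boole, hammingDist]
    simp
    ring
  simp only [h]
  rw [← Fintype.prod_sum (fun i b => Real.exp (if b = θ' i then c else -c))]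
  have h2 : ∀ i : Fin n, ∑ b, Real.exp (if b = θ' i then c else -c) = 2 * Real.cosh c := fun i => by
    rw [Fintype.sum_bool, Real.cosh_eq]
    cases θ' i <;> simp <;> ring
  simp only [h2]
  simp

/-- Few strings have a distance from `θ'` that is much smaller than `n / 2`. -/
theorem card_hammingDist_lt_le (θ' : Bits n) {ε : ℝ} (hε : 0 ≤ ε) :
    ((Finset.univ.filter fun θ : Bits n => (hammingDist θ θ' : ℝ) < (1 / 2 - ε) * n).card : ℝ) *
      (1 / 2) ^ n ≤ Real.exp (-(2 * ε ^ 2 * n)) := by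
  -- Exponential Markov inequality with parameter `c = 2 * ε`: below the threshold, `c * (n - 2 d) ≥
  -- 4 * ε ^ 2 * n`.
  have h1 : ((Finset.univ.filter fun θ : Bits n => (hammingDist θ θ' : ℝ) < (1 / 2 - ε) * n).card : ℝ) *
      Real.exp (4 * ε ^ 2 * n) ≤ (2 * Real.cosh (2 * ε)) ^ n := by
    rw [← hammingDist_sum_exp θ', ← nsmul_eq_mul, ← Finset.sum_const]
    refine (Finset.sum_le_sum fun θ hθ => ?_).trans (Finset.sum_le_sum_of_subset_of_nonneg
      (Finset.filter_subset _ _) fun _ _ _ => (Real.exp_pos _).le)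
    rw [Finset.mem_filter] at hθ
    refine Real.exp_le_exp.2 ?_
    nlinarith [hθ.2]
  -- `cosh c ≤ exp (c ^ 2 / 2)` at `c = 2 * ε` gives back half of the exponent gained above.
  have h2 : Real.cosh (2 * ε) ^ n ≤ Real.exp (2 * ε ^ 2 * n) := by
    refine (pow_le_pow_left₀ (Real.cosh_pos _).le (Real.cosh_le_exp_half_sq _) n).trans_eq ?_
    rw [← Real.exp_nat_mul]
    congr 1
    ring
  have h3 : Real.exp (-(2 * ε ^ 2 * n)) = Real.exp (2 * ε ^ 2 * n) / Real.exp (4 * ε ^ 2 * n) := by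
    rw [← Real.exp_sub]; congr 1; ring
  rw [h3, le_div_iff₀ (Real.exp_pos _)]
  calc _ = (((Finset.univ.filter fun θ : Bits n => (hammingDist θ θ' : ℝ) < (1 / 2 - ε) * n).card : ℝ) *
      Real.exp (4 * ε ^ 2 * n)) * (1 / 2) ^ n := by ring
    _ ≤ (2 * Real.cosh (2 * ε)) ^ n * (1 / 2) ^ n := mul_le_mul_of_nonneg_right h1 (by positivity)
    _ = Real.cosh (2 * ε) ^ n := by rw [← mul_pow]; congr 1; ring
    _ ≤ _ := h2

variable {l r : ℕ} (B : DishonestBob n l r)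

theorem bb84With_posSemidef {b : ℕ} (x θ : Bits n) {σ : Op (Fin b)} (hσ : σ.PosSemidef) :
    (bb84With x θ σ).PosSemidef := by
  let K : Matrix (Fin n ⊕ Fin b → Bool) (Fin b → Bool) ℂ :=
    Matrix.of fun s q => if q = s ∘ Sum.inr then bb84Ket x θ (s ∘ Sum.inl) else 0
  have : bb84With x θ σ = K * σ * Kᴴ := by
    ext s t
    rw [mul_mul_conjTranspose_apply]
    simp only [K, of_apply, bb84With, ite_mul, zero_mul, Finset.sum_ite_eq', Finset.mem_univ,
      if_true, apply_ite star, star_zero, mul_ite, mul_zero]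
    ring
  rw [this]
  exact hσ.mul_mul_conjTranspose_same K

theorem prepGiven_posSemidef (z : Bits B.zLen) {σ : Op (Fin B.vLen)} (hσ : σ.PosSemidef) (x θ a θ' w) :
    (B.prepGiven z σ x θ a θ' w).PosSemidef :=
  (B.prep.run_posSemidef z (bb84With_posSemidef x θ hσ) _).smul (by positivity)

/-- The right side does not contain `θ`: abort flag, `θ'` and `w` are independent of Alice's basis.
-/
theorem sum_prepGiven_trace (z : Bits B.zLen) (σ : Op (Fin B.vLen)) (θ : Bits n) (a θ' w) :
    ∑ x, (B.prepGiven z σ x θ a θ' w).trace.re = (1 / 2) ^ n * ((1 / 2) ^ n *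
      (B.prep.run z (tensorOp 1 σ) (Sum.elim (fun _ => a) (Sum.elim θ' w))).trace.re) := by
  rw [← sum_bb84With θ, Circuit.run_sum, trace_sum, Complex.re_sum, Finset.mul_sum, Finset.mul_sum]
  refine Finset.sum_congr rfl fun x _ => ?_
  rw [DishonestBob.prepGiven, trace_smul, ← mul_assoc]
  exact Complex.smul_re _ _

/-- The receiver's guess is far from the sender's basis. -/
theorem sum_prepGiven_near_le (z : Bits B.zLen) {σ : Op (Fin B.vLen)} (hσ : σ.PosSemidef)
    (hσ1 : σ.trace = 1) {ε : ℝ} (hε : 0 ≤ ε) :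
    ∑ θ : Bits n, ∑ θ' : Bits n, ∑ w, (if (hammingDist θ θ' : ℝ) < (1 / 2 - ε) * n then
      ∑ x, (B.prepGiven z σ x θ false θ' w).trace.re else 0) ≤ Real.exp (-(2 * ε ^ 2 * n)) := by
  have hpos : (tensorOp (1 : Op (Fin n)) σ).PosSemidef := by
    rw [← sum_bb84With fun _ => false]
    exact posSemidef_sum _ fun x _ => bb84With_posSemidef x _ hσ
  have h0 : ∀ c, 0 ≤ (B.prep.run z (tensorOp 1 σ) c).trace.re := fun c =>
    trace_re_nonneg (B.prep.run_posSemidef z hpos c)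
  -- As `tensorOp 1 σ` has trace `2 ^ n`, this is the probability that Bob does not abort.
  have h1 : ∑ θ' : Bits n, ∑ w, (1 / 2 : ℝ) ^ n *
      (B.prep.run z (tensorOp 1 σ) (Sum.elim (fun _ => false) (Sum.elim θ' w))).trace.re ≤ 1 := by
    have h2 := congrArg Complex.re (B.prep.sum_trace_run z (tensorOp 1 σ))
    rw [Complex.re_sum, trace_tensorOp, hσ1, sum_bits_sum, sum_bits_unit, Fintype.sum_bool,
      sum_bits_sum, sum_bits_sum] at h2
    have h3 : 0 ≤ ∑ θ' : Bits n, ∑ w, (B.prep.run z (tensorOp 1 σ)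
      (Sum.elim (fun _ => true) (Sum.elim θ' w))).trace.re :=
        Finset.sum_nonneg fun _ _ => Finset.sum_nonneg fun _ _ => h0 _
    have h4 : ((1 : Op (Fin n)).trace * 1).re = 2 ^ n := by
      rw [mul_one, trace_one]
      simp
      norm_cast
    simp only [← Finset.mul_sum]
    rw [h4] at h2
    calc _ ≤ (1 / 2 : ℝ) ^ n * 2 ^ n := by gcongr; linarith
      _ = 1 := by rw [← mul_pow]; norm_num
  simp only [sum_prepGiven_trace]
  calc _ = ∑ θ' : Bits n, ∑ w, (((Finset.univ.filter fun θ : Bits n =>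
        (hammingDist θ θ' : ℝ) < (1 / 2 - ε) * n).card : ℝ) * (1 / 2) ^ n) * ((1 / 2) ^ n *
          (B.prep.run z (tensorOp 1 σ) (Sum.elim (fun _ => false) (Sum.elim θ' w))).trace.re) := by
        rw [Finset.sum_comm]
        refine Finset.sum_congr rfl fun θ' _ => ?_
        rw [Finset.sum_comm]
        refine Finset.sum_congr rfl fun w _ => ?_
        rw [← Finset.sum_filter, Finset.sum_const, nsmul_eq_mul, mul_assoc]
    _ ≤ ∑ θ' : Bits n, ∑ w, Real.exp (-(2 * ε ^ 2 * n)) * ((1 / 2) ^ n *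
          (B.prep.run z (tensorOp 1 σ) (Sum.elim (fun _ => false) (Sum.elim θ' w))).trace.re) :=
        Finset.sum_le_sum fun θ' _ => Finset.sum_le_sum fun w _ =>
          mul_le_mul_of_nonneg_right (card_hammingDist_lt_le θ' hε)
            (mul_nonneg (by positivity) (h0 _))
    _ ≤ _ := by
        simp only [← Finset.mul_sum] at h1 ⊢
        exact mul_le_of_le_one_right (Real.exp_pos _).le h1

end Guess

/-! ### Security for fixed `n` -/

section Security

variable {ℓ : ℕ → ℕ} {n : ℕ}

theorem le_two_rpow_mul_of_le_minEntropy {P : Bits n → ℝ} {I : Finset (Fin n)}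
    {x : Bits n} {h : ℝ} (hpos : 0 < ∑ y : I → Bool, P (glue I y x))
    (hh : h ≤ minEntropy (condDist P I x)) (y : I → Bool) :
    P (glue I y x) ≤ 2 ^ (-h) * ∑ y' : I → Bool, P (glue I y' x) := by
  rw [← div_le_iff₀ hpos]
  change condDist P I x y ≤ _
  have h1 : condDist P I x y ≤ ⨆ y, condDist P I x y :=
    le_ciSup (Set.finite_range _).bddAbove y
  -- The logarithm in `minEntropy` can be inverted only at a positive supremum; otherwise the bound
  -- is trivial.
  rcases le_or_gt (⨆ y, condDist P I x y) 0 with h0 | h0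
  · exact (h1.trans h0).trans (by positivity)
  · refine h1.trans ((Real.logb_le_iff_le_rpow one_lt_two h0).1 ?_)
    rw [minEntropy] at hh
    linarith

theorem hammingDist_restrict (θ θ' J : Bits n) (b : Bool) :
    hammingDist ((part J b).restrict θ) ((part J b).restrict θ') =
      (Finset.univ.filter fun i : Fin n => θ i ≠ θ' i ∧ J i = b).card := by
  rw [hammingDist, ← Finset.card_map (Function.Embedding.subtype _)]
  congr 1
  ext i
  simp only [Finset.mem_map, Finset.mem_filter, Finset.mem_univ, true_and]
  constructor
  · rintro ⟨⟨j, hj⟩, h, rfl⟩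
    exact ⟨h, (Finset.mem_filter.1 hj).2⟩
  · rintro ⟨h, hj⟩
    exact ⟨⟨i, by simp [hj]⟩, h, rfl⟩

/-- The half that the simulator does not query differs in many positions. -/
theorem le_hammingDist_restrict_simChoice {t : ℕ} (ht1 : (n : ℝ) / 4 ≤ t) (ht2 : (t : ℝ) ≤ n / 4 + 1)
    {ε : ℝ} (hε : 0 ≤ ε) {θ θ' : Bits n} (hd : (1 / 2 - ε) * n ≤ (hammingDist θ θ' : ℝ)) (J : Bits n) :
    (1 / 4 - ε) * n ≤ (hammingDist ((part J (!simChoice t θ θ' J)).restrict θ)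
      ((part J (!simChoice t θ θ' J)).restrict θ') : ℝ) := by
  rw [hammingDist_restrict]
  have h1 : (Finset.univ.filter fun i : Fin n => (xor (θ i) (θ' i) && J i) = true).card =
      (Finset.univ.filter fun i : Fin n => θ i ≠ θ' i ∧ J i = true).card := by
    congr 1
    ext i
    simp
  have h2 : (Finset.univ.filter fun i : Fin n => θ i ≠ θ' i ∧ J i = true).card +
      (Finset.univ.filter fun i : Fin n => θ i ≠ θ' i ∧ J i = false).card = hammingDist θ θ' := by
    rw [hammingDist, ← Finset.card_union_of_disjoint]
    · congr 1
      ext i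
      cases h : J i <;> simp [h]
    · rw [Finset.disjoint_filter]
      rintro i - ⟨-, h⟩ ⟨-, h'⟩
      simp [h] at h'
  have h3 : (0 : ℝ) ≤ ε * n := by positivity
  unfold simChoice
  rw [h1]
  by_cases hc : t ≤ (Finset.univ.filter fun i : Fin n => θ i ≠ θ' i ∧ J i = true).card
  · simp only [hc, decide_true, Bool.not_not]
    have : (t : ℝ) ≤ ((Finset.univ.filter fun i : Fin n => θ i ≠ θ' i ∧ J i = true).card : ℝ) := by
      exact_mod_cast hc
    linarith
  -- Here `k = 1`. At most `t - 1 ≤ n / 4` differences lie in `I_1`, so the ceiling in `t` costs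
  -- nothing, and the remaining ones are in `I_0`.
  · simp only [hc, decide_false, Bool.not_not]
    have h4 : ((Finset.univ.filter fun i : Fin n => θ i ≠ θ' i ∧ J i = true).card : ℝ) + 1 ≤ t := by
      exact_mod_cast not_le.1 hc
    have h5 : ((Finset.univ.filter fun i : Fin n => θ i ≠ θ' i ∧ J i = true).card : ℝ) +
        (Finset.univ.filter fun i : Fin n => θ i ≠ θ' i ∧ J i = false).card = hammingDist θ θ' := by
      exact_mod_cast h2
    linarith

variable (H : HashFamily ℓ) (B : DishonestBob n (ℓ n) (H.keyLen n))

/-- The error of privacy amplification. -/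
def amplificationError (l n : ℕ) (β ε : ℝ) : ℝ :=
  √(2 ^ l * 2 ^ (β * n) * 2 ^ (-((1 / 4 - ε) * n - β * n)))

/-- If `θ'` is too close to `θ` the trivial factor `2` is accepted, this event being improbable.
Otherwise the half not queried has min-entropy at least `(1/4 - ε) n - β n`, whatever partition `J`
is announced. -/
theorem traceNorm_branchDiff_le_of_entropy (hU : H.TwoUniversal) {β : ℝ}
    {τ : B.PrepReg → Op (Fin B.eLen)} (hτ : ∀ j, (τ j).PosSemidef) (hE : B.EntropyConditions β τ)
    {t : ℕ} (ht1 : (n : ℝ) / 4 ≤ t) (ht2 : (t : ℝ) ≤ n / 4 + 1) {ε : ℝ} (hε : 0 ≤ ε)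
    (s : Bool → Bits (ℓ n)) (θ θ' : Bits n) (z : Bits B.zLen) (w : Bits B.wLen) :
    traceNorm (branchDiff H B t s θ θ' w fun x => τ (x, θ, z, false, θ', w)) ≤
      amplificationError (ℓ n) n β ε * (∑ x, (τ (x, θ, z, false, θ', w)).trace.re) +
        2 * if (hammingDist θ θ' : ℝ) < (1 / 2 - ε) * n then
          ∑ x, (τ (x, θ, z, false, θ', w)).trace.re else 0 := by
  have hq : ∀ x, 0 ≤ (τ (x, θ, z, false, θ', w)).trace.re := fun x => trace_re_nonneg (hτ _)
  have hQ : 0 ≤ ∑ x, (τ (x, θ, z, false, θ', w)).trace.re := Finset.sum_nonneg fun x _ => hq x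
  have hΓ : 0 ≤ amplificationError (ℓ n) n β ε := Real.sqrt_nonneg _
  have htriv : traceNorm (branchDiff H B t s θ θ' w fun x => τ (x, θ, z, false, θ', w)) ≤
      2 * ∑ x, (τ (x, θ, z, false, θ', w)).trace.re :=
    (traceNorm_branchDiff_le H B t s θ θ' w fun x => (hτ _).isHermitian).trans
      (mul_le_mul_of_nonneg_left (Finset.sum_le_sum fun x _ => traceNorm_posSemidef_le (hτ _))
        two_pos.le)
  split_ifs with hd
  · exact htriv.trans (le_add_of_nonneg_left (mul_nonneg hΓ hQ))
  -- The entropy conditions are void at values of probability zero, where the trivial bound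
  -- vanishes.
  rcases hQ.eq_or_lt with hQ0 | hQ0
  · rw [← hQ0] at htriv ⊢
    linarith
  obtain ⟨hmin, d, ψ, hψ, hmax⟩ := hE θ θ' z w hQ0
  rw [mul_zero, add_zero]
  refine (traceNorm_branchDiff_le_sqrt H B hU t s θ θ' w (fun x => hτ _) hQ0 hψ
    (ε := 2 ^ (-((1 / 4 - ε) * n - β * n))) (by positivity) fun J y c => ?_).trans
      (mul_le_mul_of_nonneg_right ?_ hQ)
  · have hP : ∀ x, 0 ≤ (τ (x, θ, z, false, θ', w)).trace.re /
        ∑ x', (τ (x', θ, z, false, θ', w)).trace.re := fun x => div_nonneg (hq x) hQ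
    have hg := fun y' => glue_splitBits (part J (!simChoice t θ θ' J)) y y' c
    -- Likewise for outside bits of probability zero: then the weight of every completion is zero.
    rcases (Finset.sum_nonneg fun y' _ => hP (glue (part J (!simChoice t θ θ' J)) y'
      (splitBits _ (y, c)))).eq_or_lt with h0 | h0
    · have h1 := (Finset.sum_eq_zero_iff_of_nonneg fun y' _ => hP _).1 h0.symm y (Finset.mem_univ y)
      rw [hg, div_eq_zero_iff, or_iff_left hQ0.ne'] at h1
      rw [h1]
      exact mul_nonneg (by positivity) (Finset.sum_nonneg fun _ _ => hq _)
    · have h1 := le_two_rpow_mul_of_le_minEntropy h0 (hmin _ _ h0) y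
      simp only [hg, ← Finset.sum_div] at h1
      rw [← mul_div_assoc, div_le_div_iff_of_pos_right hQ0] at h1
      refine h1.trans (mul_le_mul_of_nonneg_right ?_ (Finset.sum_nonneg fun _ _ => hq _))
      refine Real.rpow_le_rpow_of_exponent_le one_le_two ?_
      have := le_hammingDist_restrict_simChoice ht1 ht2 hε (not_lt.1 hd) J
      linarith
  · refine Real.sqrt_le_sqrt (mul_le_mul_of_nonneg_right (mul_le_mul_of_nonneg_left ?_
      (by positivity)) (by positivity))
    rw [maxEntropy] at hmax
    -- The logarithm in `maxEntropy` can be inverted only for positive rank.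
    rcases Nat.eq_zero_or_pos (mixture (fun x => (τ (x, θ, z, false, θ', w)).trace.re /
        ∑ x', (τ (x', θ, z, false, θ', w)).trace.re) ψ).rank with h0 | h0
    · rw [h0]; push_cast; positivity
    · exact (Real.logb_le_iff_le_rpow one_lt_two (by exact_mod_cast h0)).1 hmax

theorem branchDiff_sub (t : ℕ) (s : Bool → Bits (ℓ n)) (θ θ' : Bits n) (w : Bits B.wLen)
    (τ σ : Bits n → Op (Fin B.eLen)) : branchDiff H B t s θ θ' w (fun x => τ x - σ x) =
      branchDiff H B t s θ θ' w τ - branchDiff H B t s θ θ' w σ := by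
  simp only [branchDiff]
  rw [← Finset.sum_sub_distrib]
  refine Finset.sum_congr rfl fun J _ => ?_
  rw [← Finset.sum_sub_distrib]
  refine Finset.sum_congr rfl fun κ _ => ?_
  rw [← smul_sub, ← Finset.sum_sub_distrib]
  refine congrArg _ (Finset.sum_congr rfl fun x _ => ?_)
  simp only [realFinish, simFinishAvg, simFinish, Circuit.run_sub, smul_sub, Finset.sum_sub_distrib]
  abel

theorem branchDiff_smul (t : ℕ) (s : Bool → Bits (ℓ n)) (θ θ' : Bits n) (w : Bits B.wLen)
    (c : ℝ) (τ : Bits n → Op (Fin B.eLen)) : branchDiff H B t s θ θ' w (fun x => c • τ x) =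
      c • branchDiff H B t s θ θ' w τ := by
  simp only [branchDiff, Finset.smul_sum]
  refine Finset.sum_congr rfl fun J _ => Finset.sum_congr rfl fun κ _ => Finset.sum_congr rfl
    fun x _ => ?_
  rw [smul_comm c]
  congr 1
  simp only [realFinish, simFinishAvg, simFinish, Circuit.run_real_smul, smul_sub, Finset.smul_sum]
  congr 1
  exact Finset.sum_congr rfl fun u _ => smul_comm _ _ _

/-- The abort terms of the two experiments cancel exactly. -/
theorem realOut_sub_simOut (t : ℕ) (inp : LegitInput (ℓ n) B.zLen B.vLen) (s : Bool → Bits (ℓ n))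
    (z : Bits B.zLen) : B.realOut H inp (s, z) -
      (inp.prob (s, z)).toReal • simOut H B t s (B.prepGiven z (inp.state z)) =
    (inp.prob (s, z)).toReal • ∑ θ, ∑ θ', ∑ w, branchDiff H B t s θ θ' w
      fun x => B.prepGiven z (inp.state z) x θ false θ' w := by
  have hcomm : ∀ F : Bits n → Bits n → Bits n → Bits B.wLen → Bits n → (Bool → Bits (H.keyLen n)) →
      Op (Fin B.outLen), ∑ x, ∑ θ, ∑ θ', ∑ w, ∑ J, ∑ κ ∈ Fintype.piFinset (fun _ : Bool => H.keys n),
        F x θ θ' w J κ = ∑ θ, ∑ θ', ∑ w, ∑ J, ∑ κ ∈ Fintype.piFinset (fun _ : Bool => H.keys n),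
          ∑ x, F x θ θ' w J κ := fun F => by
    rw [Finset.sum_comm]
    refine Finset.sum_congr rfl fun θ _ => ?_
    rw [Finset.sum_comm]
    refine Finset.sum_congr rfl fun θ' _ => ?_
    rw [Finset.sum_comm]
    refine Finset.sum_congr rfl fun w _ => ?_
    rw [Finset.sum_comm]
    refine Finset.sum_congr rfl fun J _ => ?_
    rw [Finset.sum_comm]
  simp only [branchDiff, Finset.smul_sum (r := (((H.keys n).card : ℝ) ^ 2)⁻¹)]
  rw [← hcomm, DishonestBob.realOut]
  dsimp only
  rw [← smul_sub, simOut]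
  simp only [← Finset.sum_sub_distrib, add_sub_add_left_eq_sub, ← smul_sub]
  rfl

/-- The conditional probability of `s` given `z`. -/
def condProb {l a b : ℕ} (inp : LegitInput l a b) (s : Bool → Bits l) (z : Bits a) : ℝ :=
  (inp.prob (s, z)).toReal / inp.probZ z

theorem condProb_nonneg {l a b : ℕ} (inp : LegitInput l a b) (s : Bool → Bits l) (z : Bits a) :
    0 ≤ condProb inp s z :=
  div_nonneg ENNReal.toReal_nonneg (Finset.sum_nonneg fun _ _ => ENNReal.toReal_nonneg)

theorem condProb_mul_probZ {l a b : ℕ} (inp : LegitInput l a b) (s : Bool → Bits l) (z : Bits a) :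
    condProb inp s z * inp.probZ z = (inp.prob (s, z)).toReal := by
  -- If `z` has probability zero then so has `(s, z)`, and the value of the quotient does not
  -- matter.
  by_cases h : inp.probZ z = 0
  · rw [h, mul_zero]
    exact ((Finset.sum_eq_zero_iff_of_nonneg fun _ _ => ENNReal.toReal_nonneg).1 h s
      (Finset.mem_univ s)).symm
  · rw [condProb, div_mul_cancel₀ _ h]

theorem sum_condProb_le {l a b : ℕ} (inp : LegitInput l a b) (z : Bits a) :
    ∑ s, condProb inp s z ≤ 1 := by
  simp only [condProb]
  rw [← Finset.sum_div]
  exact div_self_le_one _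

theorem sum_probZ {l a b : ℕ} (inp : LegitInput l a b) : ∑ z, inp.probZ z = 1 := by
  have h := inp.prob.tsum_coe
  rw [tsum_fintype] at h
  have h2 := congrArg ENNReal.toReal h
  rw [ENNReal.toReal_sum fun a _ => inp.prob.apply_ne_top a, Fintype.sum_prod_type_right] at h2
  exact h2

theorem trace_re_le_add_traceNorm {ι : Type} [Fintype ι] [DecidableEq ι] {A A' : Matrix ι ι ℂ}
    (hA : A.IsHermitian) (hA' : A'.IsHermitian) :
    A.trace.re ≤ A'.trace.re + traceNorm (A' - A) := by
  obtain ⟨P, Q, hP, hQ, h, e⟩ := exists_posSemidef_sub (hA'.sub hA)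
  have h1 : A'.trace - A.trace = P.trace - Q.trace := by rw [← trace_sub, ← trace_sub, h]
  have h2 := congrArg Complex.re h1
  simp only [Complex.sub_re] at h2
  have := trace_re_nonneg hP
  rw [e]
  linarith

end Security

/-! ### From the state with the entropy conditions to the real state -/

section Bound

variable {ℓ : ℕ → ℕ} {n : ℕ} (H : HashFamily ℓ) (B : DishonestBob n (ℓ n) (H.keyLen n))

theorem prepState_posSemidef (inp : LegitInput (ℓ n) B.zLen B.vLen) (j : B.PrepReg) :
    (B.prepState inp j).PosSemidef :=
  (prepGiven_posSemidef B j.2.2.1 (inp.state_posSemidef _) _ _ _ _ _).smul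
    (Finset.sum_nonneg fun _ _ => ENNReal.toReal_nonneg)

/-- Bob's state depends on Alice's input only through `z`. Splitting the probability of `(s, z)` as
conditional times marginal exhibits `prepState`, the object that is compared with `τ`. -/
theorem realOut_sub_simOut_eq_condProb (t : ℕ) (inp : LegitInput (ℓ n) B.zLen B.vLen)
    (s : Bool → Bits (ℓ n)) (z : Bits B.zLen) : B.realOut H inp (s, z) -
      (inp.prob (s, z)).toReal • simOut H B t s (B.prepGiven z (inp.state z)) =
    condProb inp s z • ∑ θ, ∑ θ', ∑ w, branchDiff H B t s θ θ' w
      fun x => B.prepState inp (x, θ, z, false, θ', w) := by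
  rw [realOut_sub_simOut, ← condProb_mul_probZ, mul_smul]
  simp only [Finset.smul_sum]
  refine Finset.sum_congr rfl fun θ _ => Finset.sum_congr rfl fun θ' _ =>
    Finset.sum_congr rfl fun w _ => ?_
  rw [← branchDiff_smul]
  rfl

/-- The real state is `τ` plus a difference, which costs a factor `2` by the trivial bound. Another
`2` arises because the event that `θ'` is close to `θ` is evaluated in the real state, where `θ` is
independent of `θ'`, and not in `τ`, for which no independence is assumed. -/
theorem traceNorm_branchDiff_prepState_le (hU : H.TwoUniversal) {β : ℝ}
    {τ : B.PrepReg → Op (Fin B.eLen)} (hτ : ∀ j, (τ j).PosSemidef) (hE : B.EntropyConditions β τ)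
    {t : ℕ} (ht1 : (n : ℝ) / 4 ≤ t) (ht2 : (t : ℝ) ≤ n / 4 + 1) {ε : ℝ} (hε : 0 ≤ ε)
    (inp : LegitInput (ℓ n) B.zLen B.vLen)
    (s : Bool → Bits (ℓ n)) (θ θ' : Bits n) (z : Bits B.zLen) (w : Bits B.wLen) :
    traceNorm (branchDiff H B t s θ θ' w fun x => B.prepState inp (x, θ, z, false, θ', w)) ≤
      amplificationError (ℓ n) n β ε * (∑ x, (τ (x, θ, z, false, θ', w)).trace.re) +
        2 * (if (hammingDist θ θ' : ℝ) < (1 / 2 - ε) * n then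
          ∑ x, (B.prepState inp (x, θ, z, false, θ', w)).trace.re else 0) +
        4 * ∑ x, traceNorm (B.prepState inp (x, θ, z, false, θ', w) - τ (x, θ, z, false, θ', w)) := by
  have hp := prepState_posSemidef H B inp
  have hd : ∀ x, (B.prepState inp (x, θ, z, false, θ', w) -
      τ (x, θ, z, false, θ', w)).IsHermitian := fun x => (hp _).isHermitian.sub (hτ _).isHermitian
  have h1 := traceNorm_branchDiff_le_of_entropy H B hU hτ hE ht1 ht2 hε s θ θ' z w
  have h2 := traceNorm_branchDiff_le H B t s θ θ' w hd
  have h3 := traceNorm_add_le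
    (branchDiff_isHermitian H B t s θ θ' w fun x => (hτ (x, θ, z, false, θ', w)).isHermitian)
    (branchDiff_isHermitian H B t s θ θ' w hd)
  rw [branchDiff_sub, add_sub_cancel, ← branchDiff_sub] at h3
  have h4 : (if (hammingDist θ θ' : ℝ) < (1 / 2 - ε) * n then
      ∑ x, (τ (x, θ, z, false, θ', w)).trace.re else 0) ≤
      (if (hammingDist θ θ' : ℝ) < (1 / 2 - ε) * n then
        ∑ x, (B.prepState inp (x, θ, z, false, θ', w)).trace.re else 0) +
      ∑ x, traceNorm (B.prepState inp (x, θ, z, false, θ', w) - τ (x, θ, z, false, θ', w)) := by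
    split_ifs
    · rw [← Finset.sum_add_distrib]
      exact Finset.sum_le_sum fun x _ =>
        trace_re_le_add_traceNorm (hτ _).isHermitian (hp _).isHermitian
    · rw [zero_add]
      exact Finset.sum_nonneg fun x _ => traceNorm_nonneg _
  linarith

theorem sum_prepReg_false_le {f : B.PrepReg → ℝ} (hf : ∀ j, 0 ≤ f j) :
    ∑ z, ∑ θ, ∑ θ', ∑ w, ∑ x, f (x, θ, z, false, θ', w) ≤ ∑ j, f j := by
  have hcomm : ∑ j, f j = ∑ z, ∑ θ, ∑ a, ∑ θ', ∑ w, ∑ x, f (x, θ, z, a, θ', w) := by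
    simp only [Fintype.sum_prod_type]
    have h1 : ∀ θ z a θ', ∑ w, ∑ x, f (x, θ, z, a, θ', w) = ∑ x, ∑ w, f (x, θ, z, a, θ', w) :=
      fun _ _ _ _ => Finset.sum_comm
    have h2 : ∀ θ z a, ∑ θ', ∑ x, ∑ w, f (x, θ, z, a, θ', w) =
      ∑ x, ∑ θ', ∑ w, f (x, θ, z, a, θ', w) := fun _ _ _ => Finset.sum_comm
    have h3 : ∀ θ z, ∑ a, ∑ x, ∑ θ', ∑ w, f (x, θ, z, a, θ', w) =
      ∑ x, ∑ a, ∑ θ', ∑ w, f (x, θ, z, a, θ', w) := fun _ _ => Finset.sum_comm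
    have h4 : ∀ z, ∑ θ, ∑ x, ∑ a, ∑ θ', ∑ w, f (x, θ, z, a, θ', w) =
      ∑ x, ∑ θ, ∑ a, ∑ θ', ∑ w, f (x, θ, z, a, θ', w) := fun _ => Finset.sum_comm
    simp only [h1, h2, h3, h4]
    symm
    rw [Finset.sum_comm]
    exact Finset.sum_congr rfl fun x _ => Finset.sum_comm
  rw [hcomm]
  refine Finset.sum_le_sum fun z _ => Finset.sum_le_sum fun θ _ => ?_
  rw [Fintype.sum_bool]
  refine le_add_of_nonneg_left ?_
  exact Finset.sum_nonneg fun θ' _ => Finset.sum_nonneg fun w _ => Finset.sum_nonneg fun x _ => hf _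

theorem sum_prepState_near_le (inp : LegitInput (ℓ n) B.zLen B.vLen) {ε : ℝ} (hε : 0 ≤ ε) :
    ∑ z, ∑ θ : Bits n, ∑ θ' : Bits n, ∑ w, (if (hammingDist θ θ' : ℝ) < (1 / 2 - ε) * n then
      ∑ x, (B.prepState inp (x, θ, z, false, θ', w)).trace.re else 0) ≤
        Real.exp (-(2 * ε ^ 2 * n)) := by
  calc _ = ∑ z, inp.probZ z * ∑ θ : Bits n, ∑ θ' : Bits n, ∑ w,
        (if (hammingDist θ θ' : ℝ) < (1 / 2 - ε) * n then
          ∑ x, (B.prepGiven z (inp.state z) x θ false θ' w).trace.re else 0) := by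
        simp only [Finset.mul_sum]
        refine Finset.sum_congr rfl fun z _ => Finset.sum_congr rfl fun θ _ =>
          Finset.sum_congr rfl fun θ' _ => Finset.sum_congr rfl fun w _ => ?_
        rw [mul_ite, mul_zero, Finset.mul_sum]
        refine if_congr Iff.rfl (Finset.sum_congr rfl fun x _ => ?_) rfl
        rw [DishonestBob.prepState, trace_smul]
        exact Complex.smul_re _ _
    _ ≤ ∑ z, inp.probZ z * Real.exp (-(2 * ε ^ 2 * n)) :=
        Finset.sum_le_sum fun z _ => mul_le_mul_of_nonneg_left
          (sum_prepGiven_near_le B z (inp.state_posSemidef z) (inp.state_trace z) hε)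
          (Finset.sum_nonneg fun _ _ => ENNReal.toReal_nonneg)
    _ = _ := by rw [← Finset.sum_mul, sum_probZ, one_mul]

/-- Security for a fixed security parameter. -/
theorem traceDist_realOut_le (hU : H.TwoUniversal) {β : ℝ} (inp : LegitInput (ℓ n) B.zLen B.vLen)
    {τ : B.PrepReg → Op (Fin B.eLen)} (hτ : IsCQState τ) (hE : B.EntropyConditions β τ)
    {t : ℕ} (ht1 : (n : ℝ) / 4 ≤ t) (ht2 : (t : ℝ) ≤ n / 4 + 1) {ε : ℝ} (hε : 0 ≤ ε)
    {out : (Bool → Bits (ℓ n)) × Bits B.zLen → Op (Fin B.outLen)} (hout : ∀ s z,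
      out (s, z) = (inp.prob (s, z)).toReal • simOut H B t s (B.prepGiven z (inp.state z))) :
    traceDist (B.realOut H inp) out ≤ amplificationError (ℓ n) n β ε +
      Real.exp (-(2 * ε ^ 2 * n)) + 4 * traceDist (B.prepState inp) τ := by
  have hp := prepState_posSemidef H B inp
  set Γ := amplificationError (ℓ n) n β ε with hΓ
  have hΓ0 : 0 ≤ Γ := Real.sqrt_nonneg _
  -- A bound for fixed `z` that does not depend on `s`, so averaging over `s` with `condProb` costs
  -- nothing.
  let F : Bits B.zLen → ℝ := fun z => ∑ θ : Bits n, ∑ θ' : Bits n, ∑ w : Bits B.wLen,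
    (Γ * (∑ x, (τ (x, θ, z, false, θ', w)).trace.re) +
        2 * (if (hammingDist θ θ' : ℝ) < (1 / 2 - ε) * n then
          ∑ x, (B.prepState inp (x, θ, z, false, θ', w)).trace.re else 0) +
        4 * ∑ x, traceNorm (B.prepState inp (x, θ, z, false, θ', w) - τ (x, θ, z, false, θ', w)))
  have hF0 : ∀ z, 0 ≤ F z := fun z => Finset.sum_nonneg fun θ _ => Finset.sum_nonneg fun θ' _ =>
    Finset.sum_nonneg fun w _ => (traceNorm_nonneg _).trans
      (traceNorm_branchDiff_prepState_le H B hU hτ.1 hE ht1 ht2 hε inp (fun _ _ => false) θ θ' z w)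
  have h1 : ∀ s z, traceNorm (B.realOut H inp (s, z) - out (s, z)) ≤ condProb inp s z * F z := by
    intro s z
    have hh : ∀ θ θ' w, (branchDiff H B t s θ θ' w
        fun x => B.prepState inp (x, θ, z, false, θ', w)).IsHermitian := fun θ θ' w =>
      branchDiff_isHermitian H B t s θ θ' w fun x => (hp _).isHermitian
    rw [hout, realOut_sub_simOut_eq_condProb]
    refine (traceNorm_smul_le (isHermitian_sum _ fun θ _ => isHermitian_sum _ fun θ' _ =>
      isHermitian_sum _ fun w _ => hh θ θ' w) (condProb_nonneg _ _ _)).trans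
        (mul_le_mul_of_nonneg_left ?_ (condProb_nonneg _ _ _))
    refine (traceNorm_sum_le _ fun θ _ => isHermitian_sum _ fun θ' _ => isHermitian_sum _ fun w _ =>
      hh θ θ' w).trans (Finset.sum_le_sum fun θ _ => ?_)
    refine (traceNorm_sum_le _ fun θ' _ => isHermitian_sum _ fun w _ =>
      hh θ θ' w).trans (Finset.sum_le_sum fun θ' _ => ?_)
    exact (traceNorm_sum_le _ fun w _ => hh θ θ' w).trans (Finset.sum_le_sum fun w _ =>
      traceNorm_branchDiff_prepState_le H B hU hτ.1 hE ht1 ht2 hε inp s θ θ' z w)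
  have h2 : ∑ z, F z ≤ Γ + 2 * Real.exp (-(2 * ε ^ 2 * n)) +
      4 * ∑ j, traceNorm (B.prepState inp j - τ j) := by
    simp only [F, Finset.sum_add_distrib, ← Finset.mul_sum]
    have ha := sum_prepReg_false_le H B (f := fun j => (τ j).trace.re) fun j => trace_re_nonneg (hτ.1 j)
    have hb : ∑ j, (τ j).trace.re = 1 := by
      rw [← Complex.re_sum, hτ.2, Complex.one_re]
    have hc := sum_prepReg_false_le H B (f := fun j => traceNorm (B.prepState inp j - τ j))
      fun j => traceNorm_nonneg _
    have hd := sum_prepState_near_le H B inp hε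
    rw [hb] at ha
    have he := mul_le_mul_of_nonneg_left ha hΓ0
    rw [mul_one] at he
    refine add_le_add (add_le_add he ?_) ?_
    · exact mul_le_mul_of_nonneg_left hd two_pos.le
    · exact mul_le_mul_of_nonneg_left hc (by norm_num)
  have h3 : ∑ j, traceNorm (B.realOut H inp j - out j) ≤ ∑ z, F z := by
    rw [Fintype.sum_prod_type_right]
    refine Finset.sum_le_sum fun z _ => (Finset.sum_le_sum fun s _ => h1 s z).trans ?_
    rw [← Finset.sum_mul]
    exact mul_le_of_le_one_left (hF0 z) (sum_condProb_le inp z)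
  -- The factor `1 / 2` of the trace distance turns `2 * exp` into `exp` and `4 * ∑` into four trace
  -- distances; `Γ / 2` is bounded by `Γ`.
  rw [traceDist, traceDist]
  linarith

end Bound

/-! ### Negligible functions and the exponents -/

section Asymptotics

theorem negligible_pow {r : ℝ} (h0 : 0 ≤ r) (h1 : r < 1) : Negligible fun n => r ^ n := fun z =>
  tendsto_pow_const_mul_const_pow_of_abs_lt_one z (abs_lt.2 ⟨by linarith, h1⟩)

theorem Negligible.of_le {f g : ℕ → ℝ} (hg : Negligible g) (h0 : ∀ n, 0 ≤ f n)
    (h : ∀ n, f n ≤ g n) : Negligible f :=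
  Asymptotics.SuperpolynomialDecay.trans_abs_le hg fun n => by
    rw [abs_of_nonneg (h0 n), abs_of_nonneg ((h0 n).trans (h n))]
    exact h n

/-- The three exponents add up to at most `-(1/4 - 2 β - λ - ε) n`, and the square root halves this.
-/
theorem amplificationError_le {l n : ℕ} {lam β : ℝ} (hl : (l : ℝ) ≤ lam * n) (ε : ℝ) :
    amplificationError l n β ε ≤ (2 ^ (-((1 / 4 - 2 * β - lam - ε) / 2)) : ℝ) ^ n := by
  have h : (2 ^ (-((1 / 4 - 2 * β - lam - ε) / 2)) : ℝ) ^ n =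
      √(2 ^ (-((1 / 4 - 2 * β - lam - ε) * n))) := by
    rw [← Real.rpow_natCast, ← Real.rpow_mul two_pos.le, Real.sqrt_eq_rpow,
      ← Real.rpow_mul two_pos.le]
    congr 1
    ring
  rw [h, amplificationError, ← Real.rpow_natCast, ← Real.rpow_add two_pos, ← Real.rpow_add two_pos]
  refine Real.sqrt_le_sqrt (Real.rpow_le_rpow_of_exponent_le one_le_two ?_)
  linarith

theorem traceDist_nonneg {J W : Type} [Fintype J] [Fintype W] [DecidableEq W] (ρ σ : J → Op W) :
    0 ≤ traceDist ρ σ :=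
  mul_nonneg (by norm_num) (Finset.sum_nonneg fun _ _ => traceNorm_nonneg _)

theorem eval_mono (p : Polynomial ℕ) {a b : ℕ} (h : a ≤ b) : p.eval a ≤ p.eval b := by
  rw [Polynomial.eval_eq_sum, Polynomial.eval_eq_sum]
  exact Finset.sum_le_sum fun i _ => Nat.mul_le_mul_left _ (Nat.pow_le_pow_left h i)

end Asymptotics

end QOT

end

/-! ### Choice of the constants and conclusion -/

theorem mainTheorem6 (lam β : ℝ) (hlam : 0 < lam) (hβ : 0 ≤ β) (hβlam : β < 1 / 8 - lam / 2)
    (H : QOT.HashFamily (fun n => ⌊lam * (n : ℝ)⌋₊)) (hU : H.TwoUniversal) (hE : H.Efficient) :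
    QOT.SecureAgainstBenignBob H β := by
  obtain ⟨pH, hpH⟩ := hE
  -- `pH` is a polynomial in `n`, and `n` is at most Bob's running time because his first circuit
  -- receives `n` qubits.
  refine ⟨100 * Polynomial.X ^ 2 + 2000 * Polynomial.X + 16 * pH + 400, fun B hB => ?_⟩
  -- The threshold is half of the expected number `n / 2` of differing positions, rounded up.
  have ht : ∀ n : ℕ, ⌈(n : ℝ) / 4⌉₊ ≤ n := fun n => by
    rw [Nat.ceil_le]
    linarith [(Nat.cast_nonneg n : (0 : ℝ) ≤ n)]
  choose S hS hout using fun n => QOT.exists_simulator H (B n) (ht n) (hpH n).1 (hpH n).2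
  refine ⟨S, fun n => ?_, fun inp => ?_⟩
  · have hn : n ≤ (B n).time := by
      have h := (B n).le_time.1
      unfold QOT.DishonestBob.time
      omega
    have h1 := QOT.eval_mono pH hn
    have h2 := hS n
    simp only [Polynomial.eval_add, Polynomial.eval_mul, Polynomial.eval_pow, Polynomial.eval_X,
      Polynomial.eval_ofNat]
    omega
  · obtain ⟨τ, hτ, hτE, hneg⟩ := hB inp
    -- Half of the gap left by `λ + 2 β < 1/4`: the Chernoff error and the amplification error both
    -- decay exponentially.
    set ε : ℝ := (1 / 4 - 2 * β - lam) / 2 with hε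
    have hε0 : 0 < ε := by rw [hε]; linarith
    have hA : (2 ^ (-((1 / 4 - 2 * β - lam - ε) / 2)) : ℝ) < 1 :=
      Real.rpow_lt_one_of_one_lt_of_neg one_lt_two (by linarith)
    have hB1 : Real.exp (-(2 * ε ^ 2)) < 1 := Real.exp_zero ▸
      Real.exp_lt_exp.2 (by have := pow_pos hε0 2; linarith)
    refine QOT.Negligible.of_le (((QOT.negligible_pow (by positivity) hA).add
      (QOT.negligible_pow (Real.exp_pos _).le hB1)).add (hneg.const_mul 4))
      (fun n => QOT.traceDist_nonneg _ _) fun n => ?_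
    have h1 := QOT.traceDist_realOut_le H (B n) hU (inp n) (hτ n) (hτE n) (Nat.le_ceil _)
      (Nat.ceil_lt_add_one (by positivity)).le hε0.le (hout n (inp n))
    have h2 := QOT.amplificationError_le (n := n) (lam := lam) (β := β)
      (Nat.floor_le (a := lam * (n : ℝ)) (by positivity)) ε
    have h3 : Real.exp (-(2 * ε ^ 2 * n)) = Real.exp (-(2 * ε ^ 2)) ^ n := by
      rw [← Real.exp_nat_mul]
      congr 1
      ring
    rw [h3] at h1
    exact h1.trans (add_le_add_left (add_le_add_left h2 _) _)
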